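/- For an edge-coloring $f$ of a connected finite graph $G$ let the color-distance $cd_f(u,v)$ of two vertices be the minimum number of distinct colors on a $uv$-path, and let the color-diameter be $\max_{u,v} cd_f(u,v)$. For a positive integer $k$, $f$ is a $k$-color connection coloring if its color-diameter is at most $k$; the $k$-color connection number $cc_k(G)$ is the maximum number of colors of a $k$-color connection coloring of $G$, and a $k$-color connection coloring with $cc_k(G)$ colors is called extremal. Let $k\ge 1$ and let $T$ be a tree on $n$ vertices with $diam(T)\ge k$. A legal input for $(T,k)$ consists of $n$, $k$, a numbering $v_1,\dots,v_n$ of $V(T)$ and parent pointers such that $T$ is rooted at $v_n$, every $v_i$ with $i<n$ has a parent $v_j$ (its neighbor on the path to the root) with $j>i$, and the root $v_n$ lies on a path whose length is $diam(T)$, at distance at least $\lfloor k/2\rfloor$ from both ends of this path. Consider the following two algorithms. Algorithm 1 ($k$ odd). Put $a(v_i)=b(v_i)=0$ for all $i$. For $i=1,\dots,n$, if $v_i$ has a parent $v_j$: if $b(v_i)=\frac{k-1}{2}$, put $a(v_j)=a(v_i)+a(v_j)$ and $b(v_j)=b(v_i)$; otherwise put $a(v_j)=a(v_i)+a(v_j)+1$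 and $b(v_j)=\max\{b(v_j),b(v_i)+1\}$. Return $a(v_n)+1$. Algorithm 2 ($k$ even). Put $a(v_i)=b(v_i)=0$ for all $i$ and $S=\emptyset$. For $i=1,\dots,n$, if $v_i$ has a parent $v_j$: if $b(v_i)=\frac{k}{2}-1$, put $a(v_j)=a(v_i)+a(v_j)$, $b(v_j)=b(v_i)$ and $S=S\cup\{v_iv_j\}$; otherwise put $a(v_j)=a(v_i)+a(v_j)+1$ and $b(v_j)=\max\{b(v_j),b(v_i)+1\}$. Return $a(v_n)+\Delta$, where $\Delta$ is the maximum degree of the subgraph induced by the edge set $S$. Theorem. There are an absolute constant $C$ and a program $P$ for the unit-cost random access machine such that the following holds for every $k\ge 1$ and every tree $T$ on $n$ vertices. (1) If $diam(T)\ge k$, then on every legal input for $(T,k)$, Algorithm 1 (if $k$ is odd) or Algorithm 2 (if $k$ is even), run on the unit-cost random access machine, halts after at most $Cn$ steps and returns $cc_k(T)$. If $diam(T)<k$, then $cc_k(T)=n-1$. (2) Given $n$, $k$ and adjacency lists of $T$, the program $P$ computes in at most $Cn$ steps the number $diam(T)$ and, if $diam(T)\ge k$, a legal input for $(T,k)$.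 The program that runs $P$ and then returns $n-1$ if $diam(T)<k$, and otherwise runs Algorithm 1 or 2 according to the parity of $k$, returns $cc_k(T)$ after at most $Cn$ steps. (3) $T$ has an extremal $k$-color connection coloring $f$ such that the edges of each color form a tree; any two of these trees that have more than one edge share a vertex; and for each of these trees $T_c$ that has more than one edge and each vertex $u$ of degree one of $T$, some vertex $w$ of $T_c$ satisfies $cd_f(u,w)\le\lfloor k/2\rfloor$. -/

import Mathlib

namespace ColorConn

/-! ### Color distance and the `k`-color connection number -/

section Graph

variable {V : Type*}

/-- The number of distinct colors that the edge-coloring `f` uses on `G`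
(only the values of `f` on edges of `G` matter). -/
noncomputable def numColors (G : SimpleGraph V) (f : Sym2 V → ℕ) : ℕ :=
  (f '' G.edgeSet).ncard

/-- The number of distinct colors on a walk. -/
noncomputable def walkColors {G : SimpleGraph V} (f : Sym2 V → ℕ) {u v : V} (p : G.Walk u v) : ℕ :=
  (f '' {e | e ∈ p.edges}).ncard

/-- The color-distance: the minimum number of distinct colors on a `uv`-path. -/
noncomputable def colorDist (G : SimpleGraph V) (f : Sym2 V → ℕ) (u v : V) : ℕ :=
  sInf {c | ∃ p : G.Walk u v, p.IsPath ∧ walkColors f p = c}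

/-- The color-diameter: the maximum color-distance of two vertices. -/
noncomputable def colorDiam (G : SimpleGraph V) (f : Sym2 V → ℕ) : ℕ :=
  ⨆ q : V × V, colorDist G f q.1 q.2

/-- `f` is a `k`-color connection coloring of (the connected graph) `G`. -/
def IsColorConnection (G : SimpleGraph V) (k : ℕ) (f : Sym2 V → ℕ) : Prop :=
  colorDiam G f ≤ k

/-- The `k`-color connection number `cc_k(G)`: the maximum number of colors of a
`k`-color connection coloring. -/
noncomputable def cc (G : SimpleGraph V) (k : ℕ) : ℕ :=
  sSup {p | ∃ f : Sym2 V → ℕ, IsColorConnection G k f ∧ numColors G f = p}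

/-- A `k`-color connection coloring with `cc_k(G)` colors. -/
def IsExtremal (G : SimpleGraph V) (k : ℕ) (f : Sym2 V → ℕ) : Prop :=
  IsColorConnection G k f ∧ numColors G f = cc G k

/-- The color forest of the color `c`: the subgraph induced by the edges of color `c`. -/
def colorForest (G : SimpleGraph V) (f : Sym2 V → ℕ) (c : ℕ) : G.Subgraph where
  verts := {u | ∃ w, G.Adj u w ∧ f s(u, w) = c}
  Adj u w := G.Adj u w ∧ f s(u, w) = c
  adj_sub h := h.1
  edge_vert {u w} h := ⟨w, h⟩
  symm := ⟨fun u w h => ⟨h.1.symm, by rw [Sym2.eq_swap]; exact h.2⟩⟩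

/-- The color forest of `c` has more than one edge. -/
def Nontriv (G : SimpleGraph V) (f : Sym2 V → ℕ) (c : ℕ) : Prop :=
  1 < (colorForest G f c).edgeSet.ncard

end Graph

/-! ### A random access machine with unit cost

Programs work on registers and on arrays of natural numbers, both indexed by natural numbers.
Every symbol of an expression that is evaluated, and every command that is executed, costs one
step. -/

/-- The memory: registers `reg x` and arrays `mem a` with cells `mem a i`. -/
structure State where
  reg : ℕ → ℕ
  mem : ℕ → ℕ → ℕ

/-- Write the value `m` into the register `x`. -/
def State.setReg (s : State) (x m : ℕ) : State :=
  { s with reg := Function.update s.reg x m }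

/-- Write the value `m` into the cell `i` of the array `a`. -/
def State.setMem (s : State) (a i m : ℕ) : State :=
  { s with mem := Function.update s.mem a (Function.update (s.mem a) i m) }

/-- Expressions: constants, registers, array cells, addition, truncated subtraction, halving. -/
inductive Expr where
  | lit (m : ℕ)
  | var (x : ℕ)
  | get (a : ℕ) (e : Expr)
  | add (e₁ e₂ : Expr)
  | sub (e₁ e₂ : Expr)
  | half (e : Expr)

def Expr.eval (s : State) : Expr → ℕ
  | .lit m => m
  | .var x => s.reg x
  | .get a e => s.mem a (e.eval s)
  | .add e₁ e₂ => e₁.eval s + e₂.eval s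
  | .sub e₁ e₂ => e₁.eval s - e₂.eval s
  | .half e => e.eval s / 2

/-- The cost of evaluating an expression. -/
def Expr.cost : Expr → ℕ
  | .lit _ => 1
  | .var _ => 1
  | .get _ e => e.cost + 1
  | .add e₁ e₂ => e₁.cost + e₂.cost + 1
  | .sub e₁ e₂ => e₁.cost + e₂.cost + 1
  | .half e => e.cost + 1

/-- Tests. -/
inductive Test where
  | lt (e₁ e₂ : Expr)
  | eq (e₁ e₂ : Expr)

def Test.Holds (s : State) : Test → Prop
  | .lt e₁ e₂ => e₁.eval s < e₂.eval s
  | .eq e₁ e₂ => e₁.eval s = e₂.eval s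

/-- The cost of a test. -/
def Test.cost : Test → ℕ
  | .lt e₁ e₂ => e₁.cost + e₂.cost + 1
  | .eq e₁ e₂ => e₁.cost + e₂.cost + 1

/-- Programs. -/
inductive Prog where
  | skip
  | assign (x : ℕ) (e : Expr)
  | store (a : ℕ) (i e : Expr)
  | seq (p q : Prog)
  | ite (c : Test) (p q : Prog)
  | loop (c : Test) (p : Prog)

/-- `Runs p s s' t`: started in the state `s`, the program `p` halts in the state `s'` after
exactly `t` steps. -/
inductive Runs : Prog → State → State → ℕ → Prop
  | skip (s : State) : Runs .skip s s 1
  | assign (s : State) (x : ℕ) (e : Expr) :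
      Runs (.assign x e) s (s.setReg x (e.eval s)) (e.cost + 1)
  | store (s : State) (a : ℕ) (i e : Expr) :
      Runs (.store a i e) s (s.setMem a (i.eval s) (e.eval s)) (i.cost + e.cost + 1)
  | seq {p q : Prog} {s s' s'' : State} {t t' : ℕ} :
      Runs p s s' t → Runs q s' s'' t' → Runs (.seq p q) s s'' (t + t')
  | ite_true {c : Test} {p q : Prog} {s s' : State} {t : ℕ} :
      c.Holds s → Runs p s s' t → Runs (.ite c p q) s s' (c.cost + 1 + t)
  | ite_false {c : Test} {p q : Prog} {s s' : State} {t : ℕ} :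
      ¬ c.Holds s → Runs q s s' t → Runs (.ite c p q) s s' (c.cost + 1 + t)
  | loop_stop {c : Test} {p : Prog} {s : State} :
      ¬ c.Holds s → Runs (.loop c p) s s (c.cost + 1)
  | loop_step {c : Test} {p : Prog} {s s' s'' : State} {t t' : ℕ} :
      c.Holds s → Runs p s s' t → Runs (.loop c p) s' s'' t' →
        Runs (.loop c p) s s'' (c.cost + 1 + t + t')

/-- `for x = 0, 1, …, e - 1 do p`. -/
def Prog.forTo (x : ℕ) (e : Expr) (p : Prog) : Prog :=
  .seq (.assign x (.lit 0))
    (.loop (.lt (.var x) e) (.seq p (.assign x (.add (.var x) (.lit 1)))))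

/-! ### Registers and arrays used by the algorithms -/

/-- the number `n` of vertices -/
abbrev rN : ℕ := 0
/-- the parameter `k` -/
abbrev rK : ℕ := 1
/-- the loop variable `i` -/
abbrev rI : ℕ := 2
/-- the index `j` of the parent -/
abbrev rJ : ℕ := 3
/-- the maximum degree `Δ` -/
abbrev rDelta : ℕ := 4
/-- the returned value -/
abbrev rOut : ℕ := 5
/-- the diameter of the tree (used only for choosing the algorithm) -/
abbrev rDiam : ℕ := 6
/-- the parents in the rooted tree -/
abbrev aPar : ℕ := 0
/-- the numbers `a(v_i)` -/
abbrev aA : ℕ := 1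
/-- the numbers `b(v_i)` -/
abbrev aB : ℕ := 2
/-- the edge set `S`; the edge from `v_i` to its parent is in `S` iff cell `i` is `1` -/
abbrev aS : ℕ := 3
/-- the degrees in the subgraph induced by `S` -/
abbrev aDeg : ℕ := 4
/-- adjacency lists: the neighbors of `v` are in the cells `aOff[v], …, aOff[v+1] - 1` of `aNbr` -/
abbrev aOff : ℕ := 5
/-- adjacency lists: the entries -/
abbrev aNbr : ℕ := 6

/-- `a[i]` and `a[j]`, for the current values of `i` and `j`. -/
abbrev cellI (a : ℕ) : Expr := .get a (.var rI)
abbrev cellJ (a : ℕ) : Expr := .get a (.var rJ)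

/-- `a(v_i) = 0; b(v_i) = 0` for all `i`. -/
def initAB : Prog :=
  .forTo rI (.var rN) (.seq (.store aA (.var rI) (.lit 0)) (.store aB (.var rI) (.lit 0)))

/-- `a(v_j) = a(v_i) + a(v_j); b(v_j) = b(v_i)`. -/
def mergeUp : Prog :=
  .seq (.store aA (.var rJ) (.add (cellI aA) (cellJ aA)))
    (.store aB (.var rJ) (cellI aB))

/-- `a(v_j) = a(v_i) + a(v_j) + 1; b(v_j) = max {b(v_j), b(v_i) + 1}`. -/
def freshUp : Prog :=
  .seq (.store aA (.var rJ) (.add (.add (cellI aA) (cellJ aA)) (.lit 1)))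
    (.ite (.lt (cellJ aB) (.add (cellI aB) (.lit 1)))
      (.store aB (.var rJ) (.add (cellI aB) (.lit 1)))
      .skip)

/-- Do `p` for every `i` such that `v_i` has a parent `v_j` (that is, `v_i` is not the last vertex,
which is the root). -/
def forNonRoot (p : Prog) : Prog :=
  .forTo rI (.var rN)
    (.ite (.lt (.add (.var rI) (.lit 1)) (.var rN))
      (.seq (.assign rJ (cellI aPar)) p)
      .skip)

/-- The algorithm for odd `k`; it returns `a(v_n) + 1`. -/
def algOdd : Prog :=
  .seq initAB
    (.seq
      (forNonRoot
        (.ite (.eq (cellI aB) (.half (.sub (.var rK) (.lit 1)))) mergeUp freshUp))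
      (.assign rOut (.add (.get aA (.sub (.var rN) (.lit 1))) (.lit 1))))

/-- Compute in `Δ` the maximum degree of the subgraph induced by the edge set `S`. -/
def maxDegS : Prog :=
  .seq (.forTo rI (.var rN) (.store aDeg (.var rI) (.lit 0)))
    (.seq
      (forNonRoot
        (.ite (.eq (cellI aS) (.lit 1))
          (.seq (.store aDeg (.var rI) (.add (cellI aDeg) (.lit 1)))
            (.store aDeg (.var rJ) (.add (cellJ aDeg) (.lit 1))))
          .skip))
      (.seq (.assign rDelta (.lit 0))
        (.forTo rI (.var rN)
          (.ite (.lt (.var rDelta) (cellI aDeg))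
            (.assign rDelta (cellI aDeg))
            .skip))))

/-- The algorithm for even `k`; it returns `a(v_n) + Δ`. -/
def algEven : Prog :=
  .seq initAB
    (.seq (.forTo rI (.var rN) (.store aS (.var rI) (.lit 0)))
      (.seq
        (forNonRoot
          (.ite (.eq (cellI aB) (.sub (.half (.var rK)) (.lit 1)))
            (.seq mergeUp (.store aS (.var rI) (.lit 1)))
            freshUp))
        (.seq maxDegS
          (.assign rOut (.add (.get aA (.sub (.var rN) (.lit 1))) (.var rDelta))))))

/-- Run `prep`; then return `n - 1` if the diameter is less than `k`, and otherwise run the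
algorithm for the parity of `k`. -/
def solver (prep : Prog) : Prog :=
  .seq prep
    (.ite (.lt (.var rDiam) (.var rK))
      (.assign rOut (.sub (.var rN) (.lit 1)))
      (.ite (.eq (.add (.half (.var rK)) (.half (.var rK))) (.var rK)) algEven algOdd))

/-! ### Inputs -/

/-- The state holds `n`, `k` and the adjacency lists of the graph `T` on `{0, …, n - 1}`: every
neighbor of `v` occurs exactly once in the list of `v`. All other cells are arbitrary. -/
def HoldsGraph {n : ℕ} (T : SimpleGraph (Fin n)) (k : ℕ) (s : State) : Prop :=
  s.reg rN = n ∧ s.reg rK = k ∧ s.mem aOff 0 = 0 ∧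
    ∀ v : Fin n, s.mem aOff v ≤ s.mem aOff (v + 1) ∧
      Set.BijOn (s.mem aNbr) (Set.Ico (s.mem aOff v) (s.mem aOff (v + 1)))
        {w : ℕ | ∃ h : w < n, T.Adj v ⟨w, h⟩}

/-- The vertex `r` lies on a path whose length is the diameter of `T`, at distance at least
`⌊k/2⌋` from both ends of that path. -/
def IsGoodRoot {V : Type*} (T : SimpleGraph V) (k : ℕ) (r : V) : Prop :=
  ∃ (x y : V) (p : T.Walk x y), p.IsPath ∧ p.length = T.diam ∧ r ∈ p.support ∧
    k / 2 ≤ T.dist x r ∧ k / 2 ≤ T.dist y r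

/-- The state holds `n`, `k` and the tree `T` in the form required by the algorithms: `T` is rooted
at the last vertex `r` of the numbering `v` of its vertices, `r` is a good root, and for every other
vertex `v i` the cell `aPar[i]` is the number of its parent, which is greater than `i`. All other
cells are arbitrary. -/
def HoldsRooted {n : ℕ} (T : SimpleGraph (Fin n)) (k : ℕ) (v : Fin n ≃ Fin n) (s : State) : Prop :=
  s.reg rN = n ∧ s.reg rK = k ∧
    ∃ root : Fin n, (root : ℕ) + 1 = n ∧ IsGoodRoot T k (v root) ∧
      ∀ i : Fin n, i ≠ root → ∃ j : Fin n, s.mem aPar i = j ∧ i < j ∧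
        T.Adj (v i) (v j) ∧ T.dist (v i) (v root) = T.dist (v j) (v root) + 1

end ColorConn

/-! Write k = 2c + 1 or k = 2c + 2 and root T at a good root r. A vertex is low if it is not r and
the subtree below it has height less than c. An edge is high if it does not join a low vertex to its
parent. The high edges form a subtree around r, and a path from r contains at most c other edges.

Lower bound. Every edge that is not high gets a color of its own, so these edges contribute at most
2c colors to any path. For odd k all high edges share one color. For even k a vertex h of maximum
degree Δ in the high subtree is chosen, and the branches of the high subtree at h get one color
each; a path meets at most two branches. This gives the number of low vertices plus 1 or plus Δ
(`exists_coloring_of_odd`, `exists_coloring_of_even`). Every color class with more than one edge is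
a tree through the hub r or h, which yields the structural claims.

Upper bound. Choose one edge of each color. A path contains at most 2(c + 1) chosen edges, so in the
tree obtained by contracting the others there is a center z with at most c + 1 chosen edges on each
path from z (`exists_center`). Let W be the set of lower ends of the chosen edges for the root z.
From every path with c + 1 members of W its topmost one is removed; let Q be the set of removed
vertices. What is left has at most c members on each path, hence at most as many members as there
are low vertices for the root z (`card_le_card_isLow`), and a good root has at least as many low
vertices as any other root (`IsLow.of_root`). Two members of Q give a path with 2c + 2 colors. So Q
has at most one member for odd k. For even k, if Q has at least three members, their legs meet in
one vertex and leave it through different high edges, so Q has at most Δ members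
(`ColorLegs.card_le_highDegree`).

Algorithms. Since children precede parents, b holds the height of the subtree cut off at c, a adds
up the low vertices, and S is the set of high edges (`UpInv`). A legal input comes from
breadth-first searches: two sweeps find a longest path, its middle is a good root, and the reversed
queue of a third search is a valid numbering. -/

namespace ColorConn

open SimpleGraph

/-! ### The two sides of an edge of a tree. -/

section TreeMetric

variable {V : Type*} {T : SimpleGraph V}

/-- A shortest path from a to u, the edge uw and a shortest path from w to b form a walk from a to
b, which must use the bridge ab. The two shortest paths stay on their own sides, so uw itself is the
bridge. -/
theorem eq_of_crossing (hT : T.IsTree) {a b u w : V} (hab : T.Adj a b) (huw : T.Adj u w)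
    (hu : T.dist u a < T.dist u b) (hw : T.dist w b < T.dist w a) : u = a ∧ w = b := by
  classical
  have hc := hT.1
  have key : ∀ {x y z : V}, T.Adj x z → T.dist y x < T.dist y z → ∀ p : T.Walk x y,
      p.length = T.dist x y → s(x, z) ∉ p.edges := by
    intro x y z hxz hy p hp he
    have hz := Walk.snd_mem_support_of_mem_edges p he
    have h1 := congrArg Walk.length (p.take_spec hz)
    rw [Walk.length_append] at h1
    have h2 := dist_le (p.dropUntil z hz)
    rw [dist_comm] at h2
    rw [T.dist_comm (u := y)] at hy
    omega
  have hbr := isAcyclic_iff_forall_isBridge.1 hT.2 (T.mem_edgeSet.2 hab)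
  rw [isBridge_iff_forall_walk_mem_edges] at hbr
  obtain ⟨p, hp⟩ := hc.exists_walk_length_eq_dist a u
  obtain ⟨q, hq⟩ := hc.exists_walk_length_eq_dist b w
  have h := hbr (p.append (Walk.cons huw q.reverse))
  rw [Walk.edges_append, Walk.edges_cons, List.mem_append, List.mem_cons, Walk.edges_reverse,
    List.mem_reverse] at h
  rcases h with h | h | h
  · exact absurd h (key hab hu p hp)
  · rcases Sym2.eq_iff.1 h with h | h
    · exact ⟨h.1.symm, h.2.symm⟩
    · rw [h.1, h.2] at hw
      simp at hw
  · rw [Sym2.eq_swap] at h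
    exact absurd h (key hab.symm hw q hq)

/-- A walk that changes sides does so along ab by `eq_of_crossing`, so it is at least as long as the
detour through a and b. -/
theorem dist_eq_of_separated (hT : T.IsTree) {a b : V} (hab : T.Adj a b) {u w : V}
    (hu : T.dist u a < T.dist u b) (hw : T.dist w b < T.dist w a) :
    T.dist u w = T.dist u a + 1 + T.dist b w := by
  have hc := hT.1
  have key : ∀ {u w : V} (p : T.Walk u w), T.dist u a < T.dist u b → T.dist w b < T.dist w a →
      T.dist u a + 1 + T.dist b w ≤ p.length := by
    intro u w p
    induction p with
    | nil => intro h1 h2; omega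
    | @cons x y z h p ih =>
      intro h1 h2
      rw [Walk.length_cons]
      rcases adj_cases : hT.dist_eq_dist_add_one_of_adj y hab with h3 | h3
      · obtain ⟨rfl, rfl⟩ := eq_of_crossing hT hab h h1 (by omega)
        have := dist_le p
        simp
        omega
      · have := ih (by omega) h2
        have h4 := hc.dist_triangle (u := x) (v := y) (w := a)
        have h5 := dist_eq_one_iff_adj.2 h
        omega
  obtain ⟨p, hp⟩ := hc.exists_walk_length_eq_dist u w
  have h1 := key p hu hw
  have h2 := hc.dist_triangle (u := u) (v := a) (w := w)
  have h3 := hc.dist_triangle (u := a) (v := b) (w := w)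
  have h4 := dist_eq_one_iff_adj.2 hab
  omega

/-- The edge `e` of `T` lies between `u` and `w`. -/
def Sep (T : SimpleGraph V) (e : Sym2 V) (u w : V) : Prop :=
  ∃ a b, e = s(a, b) ∧ T.Adj a b ∧ T.dist u a < T.dist u b ∧ T.dist w b < T.dist w a

theorem Sep.mem_edgeSet {e : Sym2 V} {u w : V} (h : Sep T e u w) : e ∈ T.edgeSet := by
  obtain ⟨a, b, rfl, h, -⟩ := h
  exact h

theorem Sep.symm {e : Sym2 V} {u w : V} (h : Sep T e u w) : Sep T e w u := by
  obtain ⟨a, b, rfl, h1, h2, h3⟩ := h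
  exact ⟨b, a, Sym2.eq_swap, h1.symm, h3, h2⟩

theorem sep_comm {e : Sym2 V} {u w : V} : Sep T e u w ↔ Sep T e w u := ⟨Sep.symm, Sep.symm⟩

theorem sep_mk {a b u w : V} (hab : T.Adj a b) : Sep T s(a, b) u w ↔
    (T.dist u a < T.dist u b ∧ T.dist w b < T.dist w a) ∨
      (T.dist u b < T.dist u a ∧ T.dist w a < T.dist w b) := by
  constructor
  · rintro ⟨x, y, h, -, h1, h2⟩
    rcases Sym2.eq_iff.1 h with ⟨rfl, rfl⟩ | ⟨rfl, rfl⟩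
    · exact Or.inl ⟨h1, h2⟩
    · exact Or.inr ⟨h1, h2⟩
  · rintro (⟨h1, h2⟩ | ⟨h1, h2⟩)
    · exact ⟨a, b, rfl, hab, h1, h2⟩
    · exact ⟨b, a, Sym2.eq_swap, hab.symm, h1, h2⟩

theorem not_sep_self {e : Sym2 V} {u : V} : ¬ Sep T e u u := by
  rintro ⟨a, b, -, -, h1, h2⟩
  omega

/-- An edge splits the vertices into two sides, because the distances of a vertex to its two ends
differ by exactly one. This turns statements about edges on paths into propositional logic. -/
theorem sep_iff_xor (hT : T.IsTree) {e : Sym2 V} (he : e ∈ T.edgeSet) (u v w : V) :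
    Sep T e u w ↔ ¬ (Sep T e u v ↔ Sep T e v w) := by
  induction e with
  | _ a b =>
    rw [mem_edgeSet] at he
    rw [sep_mk he, sep_mk he, sep_mk he]
    have h1 := hT.dist_eq_dist_add_one_of_adj u he
    have h2 := hT.dist_eq_dist_add_one_of_adj v he
    have h3 := hT.dist_eq_dist_add_one_of_adj w he
    omega

theorem sep_trans (hT : T.IsTree) {e : Sym2 V} {u w : V} (h : Sep T e u w) (v : V) :
    Sep T e u v ∨ Sep T e v w := by
  have := sep_iff_xor hT h.mem_edgeSet u v w
  tauto

theorem sep_adj (hT : T.IsTree) {e : Sym2 V} {u w : V} (h : T.Adj u w) :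
    Sep T e u w ↔ e = s(u, w) := by
  constructor
  · rintro ⟨a, b, rfl, hab, h1, h2⟩
    obtain ⟨rfl, rfl⟩ := eq_of_crossing hT hab h h1 h2
    rfl
  · rintro rfl
    have := dist_eq_one_iff_adj.2 h
    exact ⟨u, w, rfl, h, by rw [SimpleGraph.dist_self]; omega,
      by rw [SimpleGraph.dist_self, dist_comm]; omega⟩

/-- A trail uses an edge at most once, so it contains the edge exactly when its ends are on
different sides. -/
theorem mem_edges_iff_sep (hT : T.IsTree) {u w : V} (p : T.Walk u w) (hp : p.IsTrail)
    (e : Sym2 V) : e ∈ p.edges ↔ Sep T e u w := by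
  induction p with
  | nil => simp [not_sep_self]
  | @cons x y z h p ih =>
    rw [Walk.isTrail_cons] at hp
    rw [Walk.edges_cons, List.mem_cons, ih hp.1]
    by_cases he : e ∈ T.edgeSet
    · rw [sep_iff_xor hT he x y z, sep_adj hT h]
      by_cases h1 : e = s(x, y)
      · subst h1
        have := hp.2
        rw [ih hp.1] at this
        tauto
      · tauto
    · have h1 : ¬ Sep T e y z := fun h => he h.mem_edgeSet
      have h2 : ¬ Sep T e x z := fun h => he h.mem_edgeSet
      have h3 : e ≠ s(x, y) := fun h' => he (h' ▸ h)
      tauto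

/-- Here e would split the four vertices into uy and zx, and e' into ux and zy. The splits of two
edges of a tree cannot cross in this way. -/
theorem sep_compat (hT : T.IsTree) {e e' : Sym2 V} {u z x y : V}
    (h1 : Sep T e u z) (h2 : ¬ Sep T e u y) (h3 : ¬ Sep T e z x)
    (h1' : Sep T e' u z) (h2' : ¬ Sep T e' u x) (h3' : ¬ Sep T e' z y) : False := by
  obtain ⟨a, b, rfl, hab, hu, hz⟩ := h1
  obtain ⟨a', b', rfl, hab', hu', hz'⟩ := h1'
  rw [sep_mk hab] at h2 h3
  rw [sep_mk hab'] at h2' h3'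
  have c1 := hT.dist_eq_dist_add_one_of_adj y hab
  have c2 := hT.dist_eq_dist_add_one_of_adj x hab
  have c3 := hT.dist_eq_dist_add_one_of_adj y hab'
  have c4 := hT.dist_eq_dist_add_one_of_adj x hab'
  -- The edge e makes d(u,x) + d(y,z) exceed d(u,y) + d(x,z) by at least 2, and e' gives the reverse
  -- inequality.
  have e1 := dist_eq_of_separated hT hab (u := u) (w := x) (by omega) (by omega)
  have e2 := dist_eq_of_separated hT hab (u := y) (w := z) (by omega) (by omega)
  have e3 := dist_eq_of_separated hT hab' (u := u) (w := y) (by omega) (by omega)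
  have e4 := dist_eq_of_separated hT hab' (u := x) (w := z) (by omega) (by omega)
  have t1 := hT.1.dist_triangle (u := u) (v := a) (w := y)
  have t2 := hT.1.dist_triangle (u := x) (v := b) (w := z)
  have t3 := hT.1.dist_triangle (u := u) (v := a') (w := x)
  have t4 := hT.1.dist_triangle (u := y) (v := b') (w := z)
  rw [T.dist_comm (u := a)] at t1
  rw [T.dist_comm (u := x) (v := b)] at t2
  rw [T.dist_comm (u := a')] at t3
  rw [T.dist_comm (u := y) (v := b')] at t4
  omega

end TreeMetric

/-! ### Counting the edges of a given set on the paths of a tree. -/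

section PathEdges

variable {V : Type*} [Fintype V] {T : SimpleGraph V}

open Classical in
/-- The edges between `u` and `w`. -/
noncomputable def pathEdges (T : SimpleGraph V) (u w : V) : Finset (Sym2 V) :=
  Finset.univ.filter fun e => Sep T e u w

@[simp]
theorem mem_pathEdges {u w : V} {e : Sym2 V} : e ∈ pathEdges T u w ↔ Sep T e u w := by
  simp [pathEdges]

theorem pathEdges_comm (u w : V) : pathEdges T u w = pathEdges T w u := by
  ext e
  simp [sep_comm]

open Classical in
theorem edges_toFinset (hT : T.IsTree) {u w : V} {p : T.Walk u w} (hp : p.IsTrail) :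
    p.edges.toFinset = pathEdges T u w := by
  ext e
  rw [List.mem_toFinset, mem_pathEdges, mem_edges_iff_sep hT p hp]

theorem card_pathEdges (hT : T.IsTree) (u w : V) : (pathEdges T u w).card = T.dist u w := by
  classical
  obtain ⟨p, hp, hl⟩ := hT.1.exists_path_of_dist u w
  rw [← edges_toFinset hT hp.isTrail, List.toFinset_card_of_nodup hp.isTrail.edges_nodup,
    Walk.length_edges, hl]

open Classical in
theorem pathEdges_subset_union (hT : T.IsTree) (u v w : V) :
    pathEdges T u w ⊆ pathEdges T u v ∪ pathEdges T v w := by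
  intro e he
  rw [Finset.mem_union, mem_pathEdges, mem_pathEdges]
  exact sep_trans hT (mem_pathEdges.1 he) v

open Classical in
/-- The number of edges of `E` between `u` and `w`. -/
noncomputable def cutCount (T : SimpleGraph V) (E : Finset (Sym2 V)) (u w : V) : ℕ :=
  (E ∩ pathEdges T u w).card

theorem cutCount_comm (E : Finset (Sym2 V)) (u w : V) : cutCount T E u w = cutCount T E w u := by
  rw [cutCount, cutCount, pathEdges_comm]

open Classical in
theorem cutCount_eq_sum (E : Finset (Sym2 V)) (u w : V) :
    cutCount T E u w = ∑ e ∈ E, if Sep T e u w then 1 else 0 := by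
  rw [cutCount, ← Finset.card_filter]
  congr 1
  ext e
  simp

open Classical in
theorem cutCount_univ (hT : T.IsTree) (u w : V) : cutCount T Finset.univ u w = T.dist u w := by
  rw [cutCount, Finset.univ_inter, card_pathEdges hT]

/-- This is the four-point condition after contraction of the edges outside `E`. By `sep_compat` the
splits uy|zx and ux|zy do not both occur. If the first occurs, the bound by the first sum holds edge
by edge; if it does not, the bound by the second sum does. -/
theorem cutCount_four_point (hT : T.IsTree) (E : Finset (Sym2 V)) (u z x y : V) :
    cutCount T E u z + cutCount T E x y ≤
      max (cutCount T E u x + cutCount T E z y) (cutCount T E u y + cutCount T E z x) := by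
  classical
  simp only [cutCount_eq_sum, ← Finset.sum_add_distrib]
  by_cases h : ∃ e, Sep T e u z ∧ ¬ Sep T e u y ∧ ¬ Sep T e z x
  · obtain ⟨e, h1, h2, h3⟩ := h
    refine le_max_of_le_left (Finset.sum_le_sum fun e' _ => ?_)
    by_cases he' : e' ∈ T.edgeSet
    · have key : ¬ (Sep T e' u z ∧ ¬ Sep T e' u x ∧ ¬ Sep T e' z y) := fun h' =>
        sep_compat hT h1 h2 h3 h'.1 h'.2.1 h'.2.2
      have k1 := sep_iff_xor hT he' u x z
      have k2 := sep_iff_xor hT he' u y z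
      have k3 := sep_iff_xor hT he' x u y
      rw [sep_comm (u := x) (w := u)] at k3
      rw [sep_comm (u := x) (w := z)] at k1
      rw [sep_comm (u := y) (w := z)] at k2
      split_ifs <;> first | omega | (exfalso; tauto)
    · have h0 : ∀ a b, ¬ Sep T e' a b := fun a b h => he' h.mem_edgeSet
      simp [h0]
  · push Not at h
    refine le_max_of_le_right (Finset.sum_le_sum fun e' _ => ?_)
    by_cases he' : e' ∈ T.edgeSet
    · have key := h e'
      have k1 := sep_iff_xor hT he' u x z
      have k2 := sep_iff_xor hT he' u y z
      have k3 := sep_iff_xor hT he' x u y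
      rw [sep_comm (u := x) (w := u)] at k3
      rw [sep_comm (u := x) (w := z)] at k1
      rw [sep_comm (u := y) (w := z)] at k2
      split_ifs <;> first | omega | (exfalso; tauto)
    · have h0 : ∀ a b, ¬ Sep T e' a b := fun a b h => he' h.mem_edgeSet
      simp [h0]

theorem dist_four_point (hT : T.IsTree) (u z x y : V) :
    T.dist u z + T.dist x y ≤ max (T.dist u x + T.dist z y) (T.dist u y + T.dist z x) := by
  classical
  simpa only [cutCount_univ hT] using cutCount_four_point hT Finset.univ u z x y

/-- The four-point condition for u, v, s, x bounds d(u,v) + d(s,x) by d(s,x) + d(x,y). -/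
theorem dist_le_of_double_sweep (hT : T.IsTree) {s x y : V} (hx : ∀ u, T.dist s u ≤ T.dist s x)
    (hy : ∀ u, T.dist x u ≤ T.dist x y) (u v : V) : T.dist u v ≤ T.dist x y := by
  have h := dist_four_point hT u v s x
  have h1 := hx u
  have h2 := hx v
  have h3 := hy u
  have h4 := hy v
  rw [T.dist_comm (u := u) (v := s), T.dist_comm (u := v) (v := s), T.dist_comm (u := u) (v := x),
    T.dist_comm (u := v) (v := x)] at h
  omega

end PathEdges

/-! ### Ancestors, parents and low vertices in a rooted tree. -/

section Rooted

variable {V : Type*} {T : SimpleGraph V}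

/-- In the tree `T` rooted at `r`, the vertex `v` is `u` or an ancestor of `u`. -/
def IsAnc (T : SimpleGraph V) (r v u : V) : Prop :=
  T.dist r v + T.dist v u = T.dist r u

theorem isAnc_refl (r v : V) : IsAnc T r v v := by simp [IsAnc]

theorem isAnc_root (r u : V) : IsAnc T r r u := by simp [IsAnc]

theorem IsAnc.dist_le {r v u : V} (h : IsAnc T r v u) : T.dist r v ≤ T.dist r u := by
  unfold IsAnc at h; omega

theorem IsAnc.trans (hT : T.IsTree) {r v w u : V} (h : IsAnc T r v w) (h' : IsAnc T r w u) :
    IsAnc T r v u := by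
  have h1 := hT.1.dist_triangle (u := v) (v := w) (w := u)
  have h2 := hT.1.dist_triangle (u := r) (v := v) (w := u)
  unfold IsAnc at *
  omega

theorem IsAnc.dist_eq (hT : T.IsTree) {r v w u : V} (h : IsAnc T r v w) (h' : IsAnc T r w u) :
    T.dist v u = T.dist v w + T.dist w u := by
  have h1 := h.trans hT h'
  unfold IsAnc at *
  omega

theorem IsAnc.eq_of_dist_le (hT : T.IsTree) {r v u : V} (h : IsAnc T r v u)
    (h' : T.dist r u ≤ T.dist r v) : v = u := by
  unfold IsAnc at h
  rw [← hT.1.dist_eq_zero_iff]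
  omega

theorem IsAnc.eq_root (hT : T.IsTree) {r v : V} (h : IsAnc T r v r) : v = r :=
  h.eq_of_dist_le hT (by simp)

theorem exists_parent (hT : T.IsTree) {r v : V} (hv : v ≠ r) :
    ∃ p, T.Adj v p ∧ T.dist r v = T.dist r p + 1 := by
  obtain ⟨q, hq⟩ := hT.1.exists_walk_length_eq_dist v r
  cases q with
  | nil => exact absurd rfl hv
  | @cons _ p _ h q =>
    refine ⟨p, h, ?_⟩
    have h1 := dist_le q
    rw [Walk.length_cons] at hq
    have h2 := hT.dist_eq_dist_add_one_of_adj r h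
    rw [T.dist_comm (u := v)] at hq
    rw [T.dist_comm (u := p)] at h1
    omega

theorem parent_unique (hT : T.IsTree) {r v p q : V} (hp : T.Adj v p)
    (hp' : T.dist r v = T.dist r p + 1) (hq : T.Adj v q) (hq' : T.dist r v = T.dist r q + 1) :
    p = q := by
  by_contra hne
  have h1 : T.dist q v = 1 := dist_eq_one_iff_adj.2 hq.symm
  have h2 := hT.dist_eq_dist_add_one_of_adj q hp
  have h3 := hT.1.pos_dist_of_ne (Ne.symm hne)
  have h4 := dist_eq_of_separated hT hp.symm (u := r) (w := q) (by omega) (by omega)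
  rw [T.dist_comm (u := v)] at h4
  omega

open Classical in
/-- The parent of `v` in the tree `T` rooted at `r`. -/
noncomputable def parent (T : SimpleGraph V) (r v : V) : V :=
  if h : ∃ p, T.Adj v p ∧ T.dist r v = T.dist r p + 1 then h.choose else v

theorem parent_adj (hT : T.IsTree) {r v : V} (hv : v ≠ r) : T.Adj v (parent T r v) := by
  have h := exists_parent hT hv
  rw [parent, dif_pos h]
  exact h.choose_spec.1

theorem dist_parent (hT : T.IsTree) {r v : V} (hv : v ≠ r) :
    T.dist r v = T.dist r (parent T r v) + 1 := by
  have h := exists_parent hT hv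
  rw [parent, dif_pos h]
  exact h.choose_spec.2

theorem eq_parent (hT : T.IsTree) {r v p : V} (hp : T.Adj v p)
    (hp' : T.dist r v = T.dist r p + 1) : p = parent T r v := by
  have hv : v ≠ r := by rintro rfl; simp at hp'
  exact parent_unique hT hp hp' (parent_adj hT hv) (dist_parent hT hv)

theorem isAnc_of_adj {r v p : V} (hp : T.Adj v p) (hp' : T.dist r v = T.dist r p + 1) :
    IsAnc T r p v := by
  have := dist_eq_one_iff_adj.2 hp.symm
  unfold IsAnc
  omega

theorem isAnc_parent (hT : T.IsTree) {r v : V} (hv : v ≠ r) : IsAnc T r (parent T r v) v :=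
  isAnc_of_adj (parent_adj hT hv) (dist_parent hT hv)

/-- The edge from `v` to its parent. -/
noncomputable def childEdge (T : SimpleGraph V) (r v : V) : Sym2 V := s(v, parent T r v)

theorem childEdge_mem (hT : T.IsTree) {r v : V} (hv : v ≠ r) : childEdge T r v ∈ T.edgeSet :=
  parent_adj hT hv

theorem exists_childEdge (hT : T.IsTree) (r : V) {e : Sym2 V} (he : e ∈ T.edgeSet) :
    ∃ v, v ≠ r ∧ childEdge T r v = e := by
  induction e with
  | _ a b =>
    rw [mem_edgeSet] at he
    rcases hT.dist_eq_dist_add_one_of_adj r he with h | h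
    · refine ⟨a, ?_, ?_⟩
      · rintro rfl; simp at h
      · rw [childEdge, ← eq_parent hT he h]
    · refine ⟨b, ?_, ?_⟩
      · rintro rfl; simp at h
      · rw [childEdge, ← eq_parent hT he.symm h, Sym2.eq_swap]

theorem childEdge_inj (hT : T.IsTree) {r v w : V} (hv : v ≠ r) (hw : w ≠ r)
    (h : childEdge T r v = childEdge T r w) : v = w := by
  rcases Sym2.eq_iff.1 h with h | h
  · exact h.1
  · have h1 := dist_parent hT hv
    have h2 := dist_parent hT hw
    rw [h.2] at h1
    rw [← h.1] at h2
    omega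

/-- The dictionary between the order of a rooted tree and the edges on its paths: being below v
means being cut off from the root by the edge above v. -/
theorem sep_childEdge (hT : T.IsTree) {r v : V} (hv : v ≠ r) (u : V) :
    Sep T (childEdge T r v) r u ↔ IsAnc T r v u := by
  have ha := parent_adj hT hv
  have hd := dist_parent hT hv
  rw [childEdge, sep_mk ha]
  constructor
  · intro h
    have h1 := dist_eq_of_separated hT ha.symm (u := r) (w := u) (by omega) (by omega)
    unfold IsAnc
    omega
  · intro h
    unfold IsAnc at h
    right
    refine ⟨by omega, ?_⟩
    have h1 := hT.1.dist_triangle (u := r) (v := parent T r v) (w := u)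
    rw [T.dist_comm (u := u), T.dist_comm (u := u)]
    omega

/-- If the edge above v did not separate r from w, the paths from r and from w to u would both cross
it. As w is on the path from r to u, it would then be closer to r than v. -/
theorem IsAnc.chain (hT : T.IsTree) {r v w u : V} (hv : IsAnc T r v u) (hw : IsAnc T r w u)
    (h : T.dist r v ≤ T.dist r w) : IsAnc T r v w := by
  by_cases hr : v = r
  · rw [hr]; exact isAnc_root r w
  rw [← sep_childEdge hT hr] at hv ⊢
  by_contra hn
  have h1 : Sep T (childEdge T r v) w u := by
    rcases sep_trans hT hv w with h | h
    · exact absurd h hn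
    · exact h
  have ha := parent_adj hT hr
  have hd := dist_parent hT hr
  rw [childEdge, sep_mk ha] at h1 hv
  have h2 := dist_eq_of_separated hT ha.symm (u := w) (w := u) (by omega) (by omega)
  have h3 := dist_eq_of_separated hT ha.symm (u := r) (w := u) (by omega) (by omega)
  unfold IsAnc at hw
  omega

theorem exists_dist_eq (hT : T.IsTree) (v u : V) {i : ℕ} (hi : i ≤ T.dist v u) :
    ∃ w, IsAnc T v w u ∧ T.dist w u = i := by
  induction i with
  | zero => exact ⟨u, isAnc_refl v u, by simp⟩
  | succ i ih =>
    obtain ⟨w, hw, hwi⟩ := ih (by omega)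
    have hwv : w ≠ v := by rintro rfl; omega
    have h1 := isAnc_parent hT hwv
    refine ⟨_, h1.trans hT hw, ?_⟩
    have h2 := h1.trans hT hw
    have h3 := dist_parent hT hwv
    unfold IsAnc at *
    omega

/-- In the tree `T` rooted at `r`, the vertex `v` is not the root and the height of the subtree
below `v` is less than `c`. -/
def IsLow (T : SimpleGraph V) (r : V) (c : ℕ) (v : V) : Prop :=
  v ≠ r ∧ ∀ u, IsAnc T r v u → T.dist v u < c

theorem IsLow.of_isAnc (hT : T.IsTree) {r v w : V} {c : ℕ} (h : IsLow T r c v)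
    (hw : IsAnc T r v w) : IsLow T r c w := by
  refine ⟨?_, fun u hu => ?_⟩
  · rintro rfl; exact h.1 (hw.eq_root hT)
  · have h1 := h.2 u (hw.trans hT hu)
    rw [hw.dist_eq hT hu] at h1
    omega

end Rooted

/-! ### Decomposition of a rooted tree into long chains. -/

section LongChains

variable {V : Type*} [Fintype V] {T : SimpleGraph V}

open Classical in
/-- If every path from the root contains at most `c` vertices of `W`, then `W` is at most as large
as the set of the vertices of height less than `c`. -/
theorem card_le_card_isLow (hT : T.IsTree) {r : V} {c : ℕ} {W : Finset V} (hr : r ∉ W)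
    (hW : ∀ u, (W.filter fun v => IsAnc T r v u).card ≤ c) :
    W.card ≤ (Finset.univ.filter fun v => IsLow T r c v).card := by
  -- Depth, with ties broken by an arbitrary numbering, so that every vertex v has a unique deepest
  -- descendant `l v`. The fibers of `l` are vertical chains, and the height of v is its distance to
  -- `l v`. The inequality is proved in each fiber.
  let key : V → ℕ ×ₗ Fin (Fintype.card V) := fun u => toLex (T.dist r u, Fintype.equivFin V u)
  have key_inj : Function.Injective key := by
    intro u w h
    have := congrArg (fun q => (ofLex q).2) h
    exact (Fintype.equivFin V).injective this
  have key_dist : ∀ {u w : V}, key u ≤ key w → T.dist r u ≤ T.dist r w := by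
    intro u w h
    rw [Prod.Lex.le_iff] at h
    rcases h with h | h
    · exact h.le
    · exact h.1.le
  have hex : ∀ v, ∃ u, IsAnc T r v u ∧ ∀ u', IsAnc T r v u' → key u' ≤ key u := by
    intro v
    obtain ⟨u, hu, hmax⟩ := Finset.exists_max_image (Finset.univ.filter fun u => IsAnc T r v u) key
      ⟨v, by simp [isAnc_refl]⟩
    exact ⟨u, by simpa using hu, fun u' hu' => hmax u' (by simpa using hu')⟩
  choose l hl hmax using hex
  have hl_eq : ∀ v w, IsAnc T r v w → IsAnc T r w (l v) → l w = l v := by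
    intro v w h h'
    exact key_inj (le_antisymm (hmax v _ (h.trans hT (hl w))) (hmax w _ h'))
  rw [Finset.card_eq_sum_card_fiberwise (f := l) (t := Finset.univ) (fun _ _ => by simp),
    Finset.card_eq_sum_card_fiberwise (f := l) (t := Finset.univ)
      (s := Finset.univ.filter fun v => IsLow T r c v) (fun _ _ => by simp)]
  refine Finset.sum_le_sum fun u _ => ?_
  have hlow : ∀ v, v ≠ r → l v = u → T.dist v u < c → IsLow T r c v := by
    intro v hv hvu hd
    refine ⟨hv, fun u' hu' => ?_⟩
    have h1 := key_dist (hmax v u' hu')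
    have h2 := hl v
    rw [hvu] at h1 h2
    unfold IsAnc at *
    omega
  -- Either all non-root vertices of the chain that ends in u are low, and it suffices that `W`
  -- avoids the root; or the chain reaches up to distance at least c from u, and then it contains at
  -- least c low vertices, while `W` has at most c members on the path to u.
  by_cases h : ∀ v, v ≠ r → l v = u → T.dist v u < c
  · refine Finset.card_le_card fun v hv => ?_
    simp only [Finset.mem_filter, Finset.mem_univ, true_and] at hv ⊢
    have hvr : v ≠ r := fun h => hr (h ▸ hv.1)
    exact ⟨hlow v hvr hv.2 (h v hvr hv.2), hv.2⟩
  · push Not at h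
    obtain ⟨v₀, hv₀, hl₀, hd₀⟩ := h
    have h1 : (W.filter fun v => l v = u).card ≤ c := by
      refine (Finset.card_le_card fun v hv => ?_).trans (hW u)
      simp only [Finset.mem_filter] at hv ⊢
      exact ⟨hv.1, hv.2 ▸ hl v⟩
    refine h1.trans ?_
    have h2 : Finset.range c ⊆ ((Finset.univ.filter fun v => IsLow T r c v).filter
        fun v => l v = u).image fun v => T.dist v u := by
      intro i hi
      rw [Finset.mem_range] at hi
      have hanc : IsAnc T r v₀ u := hl₀ ▸ hl v₀
      obtain ⟨w, hw, hwi⟩ := exists_dist_eq hT v₀ u (i := i) (by omega)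
      have h3 : IsAnc T r v₀ w ∧ IsAnc T r w u := by
        have t1 := hT.1.dist_triangle (u := r) (v := v₀) (w := w)
        have t2 := hT.1.dist_triangle (u := r) (v := w) (w := u)
        unfold IsAnc at *
        omega
      have h4 : l w = u := (hl_eq v₀ w h3.1 (hl₀.symm ▸ h3.2)).trans hl₀
      have h5 : w ≠ r := by
        rintro rfl
        exact hv₀ (h3.1.eq_root hT)
      rw [Finset.mem_image]
      refine ⟨w, ?_, hwi⟩
      simp only [Finset.mem_filter, Finset.mem_univ, true_and]
      exact ⟨hlow w h5 h4 (hwi ▸ hi), h4⟩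
    have h3 := (Finset.card_le_card h2).trans Finset.card_image_le
    rwa [Finset.card_range] at h3

end LongChains

/-! ### Color distances in a tree. -/

section Coloring

variable {V : Type*} [Fintype V] {T : SimpleGraph V}

/-- The path between two vertices of a tree is unique, so the infimum runs over a single number. -/
theorem colorDist_eq (hT : T.IsTree) (f : Sym2 V → ℕ) (u w : V) :
    colorDist T f u w = ((pathEdges T u w).image f).card := by
  have key : ∀ p : T.Walk u w, p.IsPath → walkColors f p = ((pathEdges T u w).image f).card := by
    intro p hp
    rw [walkColors, ← Set.ncard_coe_finset, Finset.coe_image]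
    congr 2
    ext e
    simp [mem_edges_iff_sep hT p hp.isTrail]
  obtain ⟨p, hp, -⟩ := hT.1.exists_path_of_dist u w
  have : {c | ∃ p : T.Walk u w, p.IsPath ∧ walkColors f p = c} =
      {((pathEdges T u w).image f).card} := by
    ext c
    constructor
    · rintro ⟨q, hq, rfl⟩
      exact key q hq
    · rintro rfl
      exact ⟨p, hp, key p hp⟩
  rw [colorDist, this, csInf_singleton]

theorem isColorConnection_iff (hT : T.IsTree) (k : ℕ) (f : Sym2 V → ℕ) :
    IsColorConnection T k f ↔ ∀ u w, ((pathEdges T u w).image f).card ≤ k := by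
  have hne := hT.1.nonempty
  simp only [IsColorConnection, colorDiam, ← colorDist_eq hT]
  constructor
  · intro h u w
    exact (le_ciSup (f := fun q : V × V => colorDist T f q.1 q.2)
      (Set.finite_range _).bddAbove (u, w)).trans h
  · intro h
    exact ciSup_le fun q => h q.1 q.2

end Coloring

/-! ### Centers and medians. -/

section Cuts

variable {V : Type*} {T : SimpleGraph V}

theorem IsAnc.symm {x z y : V} (h : IsAnc T x z y) : IsAnc T y z x := by
  unfold IsAnc at *
  rw [T.dist_comm (u := y), T.dist_comm (u := y), T.dist_comm (u := z) (v := x)]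
  omega

theorem Sep.of_isAnc (hT : T.IsTree) {x z y : V} {e : Sym2 V} (h : IsAnc T x z y)
    (he : Sep T e x z) : Sep T e x y := by
  obtain ⟨w, hw, rfl⟩ := exists_childEdge hT x he.mem_edgeSet
  rw [sep_childEdge hT hw] at he ⊢
  exact he.trans hT h

theorem not_sep_of_isAnc (hT : T.IsTree) {x z y : V} {e : Sym2 V} (h : IsAnc T x z y)
    (he : Sep T e x z) : ¬ Sep T e z y := by
  have h1 := he.of_isAnc hT h
  have := sep_iff_xor hT he.mem_edgeSet x z y
  tauto

variable [Fintype V]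

theorem cutCount_add (hT : T.IsTree) {x z y : V} (h : IsAnc T x z y) (E : Finset (Sym2 V)) :
    cutCount T E x y = cutCount T E x z + cutCount T E z y := by
  classical
  simp only [cutCount_eq_sum, ← Finset.sum_add_distrib]
  refine Finset.sum_congr rfl fun e _ => ?_
  by_cases he : e ∈ T.edgeSet
  · have h1 := sep_iff_xor hT he x z y
    have h2 := not_sep_of_isAnc hT (e := e) h
    split_ifs <;> first | rfl | (exfalso; tauto)
  · have h0 : ∀ a b, ¬ Sep T e a b := fun a b h => he h.mem_edgeSet
    simp [h0]

theorem cutCount_le_dist (hT : T.IsTree) (E : Finset (Sym2 V)) (x y : V) :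
    cutCount T E x y ≤ T.dist x y := by
  classical
  rw [← card_pathEdges hT]
  exact Finset.card_le_card Finset.inter_subset_right

theorem cutCount_triangle (hT : T.IsTree) (E : Finset (Sym2 V)) (x y z : V) :
    cutCount T E x z ≤ cutCount T E x y + cutCount T E y z := by
  classical
  refine (Finset.card_le_card ?_).trans (Finset.card_union_le _ _)
  rw [← Finset.inter_union_distrib_left]
  exact Finset.inter_subset_inter_left (pathEdges_subset_union hT x y z)

theorem cutCount_self (E : Finset (Sym2 V)) (x : V) : cutCount T E x x = 0 := by
  simp [cutCount, pathEdges, not_sep_self]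

/-- A center for the edges of `E`. -/
theorem exists_center (hT : T.IsTree) (E : Finset (Sym2 V)) (H : ℕ)
    (hE : ∀ x y, cutCount T E x y ≤ 2 * H) : ∃ z, ∀ u, cutCount T E z u ≤ H := by
  classical
  have hne := hT.1.nonempty
  obtain ⟨⟨x, y⟩, -, hmax⟩ := Finset.exists_max_image (Finset.univ : Finset (V × V))
    (fun q => cutCount T E q.1 q.2) Finset.univ_nonempty
  have hxy : ∀ u w, cutCount T E u w ≤ cutCount T E x y := fun u w => hmax (u, w) (by simp)
  -- The pair x, y has the largest count, and z is the last vertex on the path from x to y with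
  -- count at most `H` from x. One step adds at most 1, so unless z = y the count from x is exactly
  -- `H`, and at most `H` remains from z to y.
  obtain ⟨z, hz, hzmax⟩ := Finset.exists_max_image
    (Finset.univ.filter fun z => IsAnc T x z y ∧ cutCount T E x z ≤ H) (fun z => T.dist x z)
    ⟨x, by simp [isAnc_root, cutCount_self]⟩
  simp only [Finset.mem_filter, Finset.mem_univ, true_and] at hz hzmax
  have hzy : cutCount T E z y ≤ H := by
    by_cases h : z = y
    · rw [h, cutCount_self]; omega
    · have ha := parent_adj hT h
      have hd := dist_parent hT h
      generalize parent T y z = p at ha hd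
      have h1 := hT.dist_eq_dist_add_one_of_adj x ha
      have h2 := hT.1.dist_triangle (u := x) (v := p) (w := y)
      have h3 := hz.1
      unfold IsAnc at h3
      rw [T.dist_comm (u := p)] at h2
      rw [T.dist_comm (u := z)] at h3
      have h4 : IsAnc T x p y := by
        unfold IsAnc
        rw [T.dist_comm (u := p)]
        omega
      have h5 : H < cutCount T E x p := by
        by_contra hc
        have := hzmax p ⟨h4, by omega⟩
        omega
      have h6 := cutCount_triangle hT E x z p
      have h7 := cutCount_le_dist hT E z p
      rw [dist_eq_one_iff_adj.2 ha] at h7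
      have h8 := cutCount_add hT hz.1 E
      have h9 := hE x y
      omega
  refine ⟨z, fun u => ?_⟩
  -- Both sums on the right are at most count(x,y) + `H`, by the choice of x and y.
  have h := cutCount_four_point hT E u z x y
  have h1 := hxy u x
  have h2 := hxy u y
  rw [cutCount_comm E z x] at h
  rw [cutCount_comm E z u]
  omega

/-- A median of three vertices. -/
theorem exists_median (hT : T.IsTree) (u₁ u₂ u₃ : V) : ∃ x, ∀ e,
    ¬ (Sep T e x u₁ ∧ Sep T e x u₂) ∧ ¬ (Sep T e x u₁ ∧ Sep T e x u₃) ∧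
      ¬ (Sep T e x u₂ ∧ Sep T e x u₃) := by
  -- The median minimizes the sum of distances. If one edge cut x off from two of the three
  -- vertices, a step towards it would shorten two distances and lengthen the third by at most 1.
  obtain ⟨x, -, hmin⟩ := Finset.exists_min_image (Finset.univ : Finset V)
    (fun x => T.dist x u₁ + T.dist x u₂ + T.dist x u₃) ⟨u₁, by simp⟩
  have key : ∀ e v w, Sep T e x v → Sep T e x w →
      ∃ y, T.Adj x y ∧ T.dist y v < T.dist x v ∧ T.dist y w < T.dist x w := by
    intro e v w hv hw
    obtain ⟨a, b, rfl, hab, hx, hv⟩ := hv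
    rw [sep_mk hab] at hw
    have h1 := dist_eq_of_separated hT hab hx hv
    have h2 := dist_eq_of_separated hT hab hx (w := w) (by omega)
    have hxb : x ≠ b := by rintro rfl; simp at hx
    have ha := parent_adj hT hxb
    have hd := dist_parent hT hxb
    have hab' := hT.dist_eq_dist_add_one_of_adj x hab
    rw [T.dist_comm (u := b), T.dist_comm (u := b)] at hd
    have h3 := hT.1.dist_triangle (u := parent T b x) (v := b) (w := v)
    have h4 := hT.1.dist_triangle (u := parent T b x) (v := b) (w := w)
    exact ⟨_, ha, by omega, by omega⟩
  refine ⟨x, fun e => ⟨?_, ?_, ?_⟩⟩ <;>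
  · rintro ⟨h1, h2⟩
    obtain ⟨y, hy, h3, h4⟩ := key e _ _ h1 h2
    have h5 := hmin y (by simp)
    have hy1 := dist_eq_one_iff_adj.2 hy.symm
    have t1 := hT.1.dist_triangle (u := y) (v := x) (w := u₁)
    have t2 := hT.1.dist_triangle (u := y) (v := x) (w := u₂)
    have t3 := hT.1.dist_triangle (u := y) (v := x) (w := u₃)
    omega

end Cuts

/-! ### Good roots have the most low vertices. -/

section GoodRoot

variable {V : Type*} {T : SimpleGraph V}

theorem dist_le_diam_of_isTree [Finite V] (hT : T.IsTree) (u w : V) : T.dist u w ≤ T.diam := by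
  have hne := hT.1.nonempty
  exact dist_le_diam (connected_iff_ediam_ne_top.1 hT.1)

theorem IsGoodRoot.exists_ends [Fintype V] (hT : T.IsTree) {k : ℕ} {r : V}
    (h : IsGoodRoot T k r) : ∃ x y, T.dist x y = T.diam ∧ IsAnc T x r y ∧
      k / 2 ≤ T.dist x r ∧ k / 2 ≤ T.dist y r := by
  classical
  obtain ⟨x, y, p, hp, hl, hr, hx, hy⟩ := h
  have h1 : T.dist x y = p.length := by
    rw [← card_pathEdges hT, ← edges_toFinset hT hp.isTrail,
      List.toFinset_card_of_nodup hp.isTrail.edges_nodup, Walk.length_edges]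
  refine ⟨x, y, by rw [h1, hl], ?_, hx, hy⟩
  have h2 := congrArg Walk.length (p.take_spec hr)
  rw [Walk.length_append] at h2
  have h3 := dist_le (p.takeUntil r hr)
  have h4 := dist_le (p.dropUntil r hr)
  have h5 := hT.1.dist_triangle (u := x) (v := r) (w := y)
  unfold IsAnc
  omega

/-- The path from x to y passes through r below v. If both ends are below v, one of them is at
distance at least c from v because the path has length at least 2c. If just one is, its path to v
goes through r and has length at least c. They cannot both be outside, as the path would cross the
edge above v twice. -/
theorem exists_deep_of_isAnc_root (hT : T.IsTree) {z v r x y : V} {c : ℕ} (hv : v ≠ z)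
    (hr : IsAnc T z v r) (hxy : IsAnc T x r y) (hd : 2 * c ≤ T.dist x y) (hx : c ≤ T.dist x r)
    (hy : c ≤ T.dist y r) : ∃ u, IsAnc T z v u ∧ c ≤ T.dist v u := by
  have ha := parent_adj hT hv
  have hdz := dist_parent hT hv
  have hside : ∀ u, IsAnc T z v u ↔ T.dist u v < T.dist u (parent T z v) := by
    intro u
    rw [← sep_childEdge hT hv, childEdge, sep_mk ha]
    omega
  have hr' := (hside r).1 hr
  have hout : ∀ u, ¬ IsAnc T z v u →
      T.dist r u = T.dist r v + 1 + T.dist (parent T z v) u := by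
    intro u hu
    rw [hside] at hu
    have := hT.dist_eq_dist_add_one_of_adj u ha
    exact dist_eq_of_separated hT ha hr' (by omega)
  have hmix : ∀ u w, IsAnc T z v u → ¬ IsAnc T z v w →
      T.dist u w = T.dist u v + 1 + T.dist (parent T z v) w := by
    intro u w hu hw
    rw [hside] at hu hw
    have := hT.dist_eq_dist_add_one_of_adj w ha
    exact dist_eq_of_separated hT ha hu (by omega)
  unfold IsAnc at hxy
  by_cases h1 : IsAnc T z v x
  · by_cases h2 : IsAnc T z v y
    · have t := hT.1.dist_triangle (u := x) (v := v) (w := y)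
      rw [T.dist_comm (u := x) (v := v)] at t
      by_cases h3 : c ≤ T.dist v x
      · exact ⟨x, h1, h3⟩
      · exact ⟨y, h2, by omega⟩
    · refine ⟨x, h1, ?_⟩
      have e1 := hout y h2
      have e2 := hmix x y h1 h2
      rw [T.dist_comm (u := v)]
      omega
  · by_cases h2 : IsAnc T z v y
    · refine ⟨y, h2, ?_⟩
      have e1 := hout x h1
      have e2 := hmix y x h2 h1
      rw [T.dist_comm (u := v)]
      rw [T.dist_comm (u := y) (v := x)] at e2
      rw [T.dist_comm (u := y) (v := r)] at hy
      rw [T.dist_comm (u := r) (v := x)] at e1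
      omega
    · have e1 := hout x h1
      have e2 := hout y h2
      have t := hT.1.dist_triangle (u := x) (v := parent T z v) (w := y)
      rw [T.dist_comm (u := r) (v := x)] at e1
      rw [T.dist_comm (u := x) (v := parent T z v)] at t
      omega

/-- By `exists_deep_of_isAnc_root`, r is not below a vertex v that is low for z. Hence z and r are
on the same side of the edge above v, and v has the same parent and the same descendants for both
roots. -/
theorem IsLow.of_root (hT : T.IsTree) {z v r x y : V} {c : ℕ} (h : IsLow T z c v)
    (hxy : IsAnc T x r y) (hd : 2 * c ≤ T.dist x y) (hx : c ≤ T.dist x r)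
    (hy : c ≤ T.dist y r) : IsLow T r c v := by
  obtain ⟨hv, hlow⟩ := h
  have hnr : ¬ IsAnc T z v r := by
    intro hr
    obtain ⟨u, hu, hcu⟩ := exists_deep_of_isAnc_root hT hv hr hxy hd hx hy
    exact absurd (hlow u hu) (by omega)
  have hvr : v ≠ r := by
    rintro rfl
    exact hnr (isAnc_refl _ _)
  refine ⟨hvr, fun u hu => hlow u ?_⟩
  have ha := parent_adj hT hv
  have hdz := dist_parent hT hv
  rw [← sep_childEdge hT hv] at hnr ⊢
  have hpr : parent T z v = parent T r v := by
    refine eq_parent hT ha ?_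
    rw [childEdge, sep_mk ha] at hnr
    have := hT.dist_eq_dist_add_one_of_adj r ha
    omega
  have he : childEdge T z v = childEdge T r v := by rw [childEdge, childEdge, hpr]
  rw [← sep_childEdge hT hvr, ← he] at hu
  have := sep_iff_xor hT hu.mem_edgeSet z r u
  tauto

end GoodRoot

/-! ### The upper bound for the number of colors. -/

section UpperBound

variable {V : Type*} [Fintype V] {T : SimpleGraph V}

open Classical in
/-- The number of the vertices of `T`, rooted at `r`, whose subtree has height less than `c`. -/
noncomputable def lowCard (T : SimpleGraph V) (r : V) (c : ℕ) : ℕ :=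
  (Finset.univ.filter fun v => IsLow T r c v).card

open Classical in
/-- The children of the edges at `x` that do not lead down to a vertex `v` with `IsLow T r c v`. -/
noncomputable def highStar (T : SimpleGraph V) (r : V) (c : ℕ) (x : V) : Finset V :=
  Finset.univ.filter fun w => w ≠ r ∧ ¬ IsLow T r c w ∧ (w = x ∨ parent T r w = x)

theorem mem_highStar {r x w : V} {c : ℕ} :
    w ∈ highStar T r c x ↔ w ≠ r ∧ ¬ IsLow T r c w ∧ (w = x ∨ parent T r w = x) := by
  simp [highStar]

/-- The maximum degree in the subgraph of the edges that do not lead down to a vertex `v` with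
`IsLow T r c v`. -/
noncomputable def highDegree (T : SimpleGraph V) (r : V) (c : ℕ) : ℕ :=
  Finset.univ.sup fun x => (highStar T r c x).card

theorem card_highStar_le (r x : V) (c : ℕ) : (highStar T r c x).card ≤ highDegree T r c :=
  Finset.le_sup (f := fun x => (highStar T r c x).card) (Finset.mem_univ x)

/-- A family of far apart vertices `tip v` with disjoint sets `C v` of `c + 1` colors, which all
occur between the vertices. -/
structure ColorLegs (T : SimpleGraph V) (f : Sym2 V → ℕ) (c : ℕ) (Q : Finset V) (tip : V → V)
    (C : V → Finset ℕ) : Prop where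
  card_eq : ∀ v ∈ Q, (C v).card = c + 1
  disj : ∀ v ∈ Q, ∀ w ∈ Q, v ≠ w → Disjoint (C v) (C w)
  subset : ∀ v ∈ Q, ∀ w ∈ Q, v ≠ w → C v ⊆ (pathEdges T (tip v) (tip w)).image f

/-- All colors except one for each leg are counted by the low vertices for a suitable root z. It
remains to bound the number of legs, which is where the parity of k enters. -/
theorem exists_colorLegs (hT : T.IsTree) {f : Sym2 V → ℕ} {k c : ℕ} (hk : k ≤ 2 * (c + 1))
    (hf : ∀ u w, ((pathEdges T u w).image f).card ≤ k) :
    ∃ (z : V) (Q : Finset V) (tip : V → V) (C : V → Finset ℕ), ColorLegs T f c Q tip C ∧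
      numColors T f ≤ lowCard T z c + Q.card := by
  classical
  -- `E` contains exactly one edge of each color, so a path has at least as many colors as edges of
  -- `E`.
  obtain ⟨E, hE, hinj, himg⟩ : ∃ E : Finset (Sym2 V), (E : Set (Sym2 V)) ⊆ T.edgeSet ∧
      Set.InjOn f E ∧ (E.image f : Set ℕ) = f '' T.edgeSet := by
    obtain ⟨s, hs, hb⟩ := Set.SurjOn.exists_bijOn_subset (Set.surjOn_image f T.edgeSet)
    refine ⟨(Set.toFinite s).toFinset, by simpa using hs, by simpa using hb.injOn, ?_⟩
    rw [Finset.coe_image]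
    simpa using hb.image_eq
  have hnum : numColors T f = E.card := by
    rw [numColors, ← himg, Set.ncard_coe_finset, Finset.card_image_of_injOn hinj]
  obtain ⟨z, hz⟩ := exists_center hT E (c + 1) fun u w => by
    refine le_trans ?_ ((hf u w).trans hk)
    rw [cutCount, ← Finset.card_image_of_injOn (f := f)
      (hinj.mono (by simp : ((E ∩ pathEdges T u w : Finset _) : Set (Sym2 V)) ⊆ E))]
    exact Finset.card_le_card (Finset.image_subset_image Finset.inter_subset_right)
  let W : Finset V := Finset.univ.filter fun v => v ≠ z ∧ childEdge T z v ∈ E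
  have hW : ∀ {v}, v ∈ W ↔ v ≠ z ∧ childEdge T z v ∈ E := by simp [W]
  have hWinj : Set.InjOn (childEdge T z) W := fun v hv w hw h =>
    childEdge_inj hT (hW.1 hv).1 (hW.1 hw).1 h
  have hWE : W.card = E.card := by
    rw [← Finset.card_image_of_injOn hWinj]
    congr 1
    ext e
    rw [Finset.mem_image]
    constructor
    · rintro ⟨v, hv, rfl⟩
      exact (hW.1 hv).2
    · intro he
      obtain ⟨v, hv, rfl⟩ := exists_childEdge hT z (hE he)
      exact ⟨v, hW.2 ⟨hv, he⟩, rfl⟩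
  let D : V → Finset V := fun u => W.filter fun v => IsAnc T z v u
  have hD : ∀ {u v}, v ∈ D u ↔ v ∈ W ∧ IsAnc T z v u := by simp [D]
  have hDW : ∀ u, D u ⊆ W := fun u => Finset.filter_subset _ _
  have hDcard : ∀ u, (D u).card ≤ c + 1 := by
    intro u
    refine le_trans ?_ (hz u)
    rw [cutCount, ← Finset.card_image_of_injOn (hWinj.mono (Finset.coe_subset.2 (hDW u)))]
    refine Finset.card_le_card fun e he => ?_
    obtain ⟨v, hv, rfl⟩ := Finset.mem_image.1 he
    rw [hD, hW] at hv
    rw [Finset.mem_inter, mem_pathEdges, sep_childEdge hT hv.1.1]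
    exact ⟨hv.1.2, hv.2⟩
  let IsTop : V → Prop := fun v => ∀ w ∈ W, IsAnc T z w v → w = v
  -- `D u` is the set of members of `W` on the path from z to u. `Q` collects the topmost members of
  -- those sets that have the maximal size c + 1.
  let Q : Finset V := W.filter fun v => IsTop v ∧ ∃ u, IsAnc T z v u ∧ (D u).card = c + 1
  have hQ : ∀ {v}, v ∈ Q ↔ v ∈ W ∧ IsTop v ∧ ∃ u, IsAnc T z v u ∧ (D u).card = c + 1 := by
    simp [Q]
  have htip : ∀ v, ∃ u, v ∈ Q → IsAnc T z v u ∧ (D u).card = c + 1 := by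
    intro v
    by_cases hv : v ∈ Q
    · obtain ⟨u, hu⟩ := (hQ.1 hv).2.2
      exact ⟨u, fun _ => hu⟩
    · exact ⟨z, fun h => absurd h hv⟩
  choose tip htip using htip
  -- As v is topmost in `W`, every member of `D (tip v)` is below v. A vertex below two topmost
  -- vertices would make one of these an ancestor of the other.
  have hDdisj : ∀ v ∈ Q, ∀ w ∈ Q, v ≠ w → ∀ a, a ∈ D (tip v) → ¬ IsAnc T z a (tip w) := by
    intro v hv w hw hne a ha haw
    have hav := (hD.1 ha).2
    have haW := (hD.1 ha).1
    have h1 : IsAnc T z v a := by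
      rcases le_total (T.dist z v) (T.dist z a) with h | h
      · exact (htip v hv).1.chain hT hav h
      · have := (hQ.1 hv).2.1 a haW (hav.chain hT (htip v hv).1 h)
        rw [this]
        exact isAnc_refl _ _
    have h2 : IsAnc T z w a := by
      rcases le_total (T.dist z w) (T.dist z a) with h | h
      · exact (htip w hw).1.chain hT haw h
      · have := (hQ.1 hw).2.1 a haW (haw.chain hT (htip w hw).1 h)
        rw [this]
        exact isAnc_refl _ _
    rcases le_total (T.dist z v) (T.dist z w) with h | h
    · exact hne ((hQ.1 hw).2.1 v (hQ.1 hv).1 (h1.chain hT h2 h))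
    · exact hne ((hQ.1 hv).2.1 w (hQ.1 hw).1 (h2.chain hT h1 h)).symm
  have hcinj : Set.InjOn (fun a => f (childEdge T z a)) W := fun a ha b hb h =>
    hWinj ha hb (hinj (hW.1 ha).2 (hW.1 hb).2 h)
  refine ⟨z, Q, tip, fun v => (D (tip v)).image fun a => f (childEdge T z a), ⟨?_, ?_, ?_⟩, ?_⟩
  · intro v hv
    rw [Finset.card_image_of_injOn (hcinj.mono (Finset.coe_subset.2 (hDW _)))]
    exact (htip v hv).2
  · intro v hv w hw hne
    rw [Finset.disjoint_left]
    intro x hx hx'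
    obtain ⟨a, ha, rfl⟩ := Finset.mem_image.1 hx
    obtain ⟨b, hb, hab⟩ := Finset.mem_image.1 hx'
    have : b = a := hcinj (hDW _ hb) (hDW _ ha) hab
    subst this
    exact hDdisj v hv w hw hne b ha (hD.1 hb).2
  · intro v hv w hw hne x hx
    obtain ⟨a, ha, rfl⟩ := Finset.mem_image.1 hx
    refine Finset.mem_image_of_mem f ?_
    have haz := (hW.1 (hD.1 ha).1).1
    have h1 := (hD.1 ha).2
    have h2 := hDdisj v hv w hw hne a ha
    rw [← sep_childEdge hT haz] at h1 h2
    rw [mem_pathEdges]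
    rcases sep_trans hT h1 (tip w) with h | h
    · exact absurd h h2
    · exact h.symm
  -- Each set `D u` of size c + 1 loses its topmost member, so at most c members of `W \ Q` lie on
  -- any path from z.
  · have h1 : (W \ Q).card ≤ lowCard T z c := by
      refine card_le_card_isLow hT (by simp [W]) fun u => ?_
      have hsub : ((W \ Q).filter fun v => IsAnc T z v u) ⊆ D u := by
        intro v hv
        rw [Finset.mem_filter, Finset.mem_sdiff] at hv
        exact hD.2 ⟨hv.1.1, hv.2⟩
      by_cases hu : (D u).card = c + 1
      · obtain ⟨v, hv, hmin⟩ := Finset.exists_min_image (D u) (fun v => T.dist z v)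
          (Finset.card_pos.1 (by omega))
        have hvQ : v ∈ Q := by
          refine hQ.2 ⟨(hD.1 hv).1, fun w hw hwv => ?_, u, (hD.1 hv).2, hu⟩
          exact hwv.eq_of_dist_le hT (hmin w (hD.2 ⟨hw, hwv.trans hT (hD.1 hv).2⟩))
        have h2 : ((W \ Q).filter fun v => IsAnc T z v u) ⊆ (D u).erase v := by
          intro w hw
          refine Finset.mem_erase.2 ⟨?_, hsub hw⟩
          rintro rfl
          simp [hvQ] at hw
        have := Finset.card_le_card h2
        rw [Finset.card_erase_of_mem hv] at this
        omega
      · have := Finset.card_le_card hsub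
        have := hDcard u
        omega
    have hQW : Q ⊆ W := Finset.filter_subset _ _
    have h2 := Finset.card_sdiff_add_card_eq_card hQW
    omega

theorem ColorLegs.card_union {f : Sym2 V → ℕ} {c : ℕ} {Q : Finset V} {tip : V → V}
    {C : V → Finset ℕ} (h : ColorLegs T f c Q tip C) {v w : V} (hv : v ∈ Q) (hw : w ∈ Q)
    (hne : v ≠ w) : C v ∪ C w ⊆ (pathEdges T (tip v) (tip w)).image f ∧
      (C v ∪ C w).card = 2 * c + 2 := by
  constructor
  · refine Finset.union_subset (h.subset v hv w hw hne) ?_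
    rw [pathEdges_comm]
    exact h.subset w hw v hv hne.symm
  · rw [Finset.card_union_of_disjoint (h.disj v hv w hw hne), h.card_eq v hv, h.card_eq w hw]
    omega

theorem ColorLegs.card_le_one {f : Sym2 V → ℕ} {c : ℕ} {Q : Finset V} {tip : V → V}
    {C : V → Finset ℕ} (h : ColorLegs T f c Q tip C)
    (hf : ∀ u w, ((pathEdges T u w).image f).card ≤ 2 * c + 1) : Q.card ≤ 1 := by
  rw [Finset.card_le_one]
  intro v hv w hw
  by_contra hne
  obtain ⟨h1, h2⟩ := h.card_union hv hw hne
  have := Finset.card_le_card h1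
  have := hf (tip v) (tip w)
  omega

/-- Two legs already exhaust the 2c + 2 admissible colors, so only colors of `C v` and `C w` occur
between their tips. The hub is the median x of three tips. An edge between x and one of them lies on
its paths to both others, so its color is in the intersection of two unions, which is the color set
of its own leg. An edge between any further tip and x is treated in the same way, with the first two
of the three legs. -/
theorem ColorLegs.exists_hub (hT : T.IsTree) {f : Sym2 V → ℕ} {c : ℕ} {Q : Finset V} {tip : V → V}
    {C : V → Finset ℕ} (h : ColorLegs T f c Q tip C)
    (hf : ∀ u w, ((pathEdges T u w).image f).card ≤ 2 * c + 2) (hQ : 2 < Q.card) :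
    ∃ x, ∀ v ∈ Q, c + 1 ≤ T.dist (tip v) x ∧ ∀ e, Sep T e (tip v) x → f e ∈ C v := by
  obtain ⟨i₁, i₂, i₃, h₁, h₂, h₃, h12, h13, h23⟩ := Finset.two_lt_card_iff.1 hQ
  obtain ⟨x, hx⟩ := exists_median hT (tip i₁) (tip i₂) (tip i₃)
  have hcol : ∀ v ∈ Q, ∀ w ∈ Q, v ≠ w → ∀ e, Sep T e (tip v) (tip w) → f e ∈ C v ∪ C w := by
    intro v hv w hw hne e he
    obtain ⟨h1, h2⟩ := h.card_union hv hw hne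
    rw [Finset.eq_of_subset_of_card_le h1 (by rw [h2]; exact hf _ _)]
    exact Finset.mem_image_of_mem f (mem_pathEdges.2 he)
  have hthird : ∀ v ∈ Q, ∀ i ∈ Q, ∀ j ∈ Q, i ≠ j → ∀ a : ℕ, a ∈ C v ∪ C i → a ∈ C v ∪ C j →
      a ∈ C v := by
    intro v hv i hi j hj hij a h1 h2
    have : a ∈ C i → a ∉ C j := fun ha => Finset.disjoint_left.1 (h.disj i hi j hj hij) ha
    rw [Finset.mem_union] at h1 h2
    tauto
  have hleg : ∀ i ∈ Q, ∀ j ∈ Q, ∀ l ∈ Q, i ≠ j → i ≠ l → j ≠ l →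
      (∀ e, ¬ (Sep T e x (tip i) ∧ Sep T e x (tip j))) →
      (∀ e, ¬ (Sep T e x (tip i) ∧ Sep T e x (tip l))) →
      ∀ e, Sep T e (tip i) x → f e ∈ C i := by
    intro i hi j hj l hl hij hil hjl h1 h2 e he
    refine hthird i hi j hj l hl hjl _ ?_ ?_
    · refine hcol i hi j hj hij e ?_
      rcases sep_trans hT he (tip j) with h' | h'
      · exact h'
      · exact absurd ⟨he.symm, h'.symm⟩ (h1 e)
    · refine hcol i hi l hl hil e ?_
      rcases sep_trans hT he (tip l) with h' | h'
      · exact h'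
      · exact absurd ⟨he.symm, h'.symm⟩ (h2 e)
  have hl₁ := hleg i₁ h₁ i₂ h₂ i₃ h₃ h12 h13 h23 (fun e => (hx e).1) (fun e => (hx e).2.1)
  have hl₂ := hleg i₂ h₂ i₁ h₁ i₃ h₃ h12.symm h23 h13 (fun e h => (hx e).1 h.symm)
    (fun e => (hx e).2.2)
  have hall : ∀ v ∈ Q, ∀ e, Sep T e (tip v) x → f e ∈ C v := by
    intro v hv e he
    have key : ∀ i ∈ Q, (∀ e, Sep T e (tip i) x → f e ∈ C i) → f e ∈ C v ∪ C i := by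
      intro i hi hli
      by_cases hvi : v = i
      · subst hvi
        exact Finset.mem_union_left _ (hli e he)
      · rcases sep_trans hT he (tip i) with h' | h'
        · exact hcol v hv i hi hvi e h'
        · exact Finset.mem_union_right _ (hli e h')
    exact hthird v hv i₁ h₁ i₂ h₂ h12 _ (key i₁ h₁ hl₁) (key i₂ h₂ hl₂)
  refine ⟨x, fun v hv => ⟨?_, hall v hv⟩⟩
  obtain ⟨w, hw, hwv⟩ : ∃ w ∈ Q, w ≠ v := by
    by_cases h' : i₁ = v
    · exact ⟨i₂, h₂, h' ▸ h12.symm⟩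
    · exact ⟨i₁, h₁, h'⟩
  -- All c + 1 colors of `C v` occur between `tip v` and `tip w`, but none of them between x and
  -- `tip w`; so they all occur between `tip v` and x.
  rw [← h.card_eq v hv, ← card_pathEdges hT]
  classical
  refine le_trans (Finset.card_le_card fun a ha => ?_) (Finset.card_image_le (f := f))
  obtain ⟨e, he, rfl⟩ := Finset.mem_image.1 (h.subset v hv w hw hwv.symm ha)
  refine Finset.mem_image_of_mem f ?_
  rw [mem_pathEdges] at he ⊢
  rcases sep_trans hT he x with h' | h'
  · exact h'
  · exact absurd (hall w hw e h'.symm) (Finset.disjoint_left.1 (h.disj v hv w hw hwv.symm) ha)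

/-- Each leg leaves the hub x by an edge with a color of that leg. These edges are distinct, since
the color sets are disjoint, and each of them is high because at least c more levels lie below its
lower end. -/
theorem ColorLegs.card_le_highDegree (hT : T.IsTree) {f : Sym2 V → ℕ} {c : ℕ} {Q : Finset V}
    {tip : V → V} {C : V → Finset ℕ} (h : ColorLegs T f c Q tip C)
    (hf : ∀ u w, ((pathEdges T u w).image f).card ≤ 2 * c + 2) (hQ : 2 < Q.card) (r : V) :
    Q.card ≤ highDegree T r c := by
  obtain ⟨x, hx⟩ := h.exists_hub hT hf hQ
  refine le_trans ?_ (card_highStar_le r x c)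
  have hne : ∀ v ∈ Q, x ≠ tip v := by
    rintro v hv rfl
    have := (hx v hv).1
    simp at this
  have hsep : ∀ v ∈ Q, Sep T (childEdge T (tip v) x) (tip v) x := fun v hv =>
    (sep_childEdge hT (hne v hv) x).2 (isAnc_refl _ _)
  have hsep' : ∀ v ∈ Q, ∀ w ∈ Q, v ≠ w → ¬ Sep T (childEdge T (tip v) x) (tip w) x := by
    intro v hv w hw hvw hs
    exact Finset.disjoint_left.1 (h.disj v hv w hw hvw) ((hx v hv).2 _ (hsep v hv))
      ((hx w hw).2 _ hs)
  have hex : ∀ v, ∃ a, v ∈ Q → a ∈ highStar T r c x ∧ childEdge T r a = childEdge T (tip v) x := by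
    intro v
    by_cases hv : v ∈ Q
    swap
    · exact ⟨x, fun h => absurd h hv⟩
    obtain ⟨a, ha, hae⟩ := exists_childEdge hT r (hsep v hv).mem_edgeSet
    refine ⟨a, fun _ => ⟨mem_highStar.2 ⟨ha, ?_, ?_⟩, hae⟩⟩
    · have hp := dist_parent hT (hne v hv)
      have hadj := parent_adj hT (hne v hv)
      have hd := (hx v hv).1
      rintro ⟨-, hlow⟩
      -- If r is on the side of x, then `tip v` is below the edge and deep enough.
      rcases sep_trans hT (hsep v hv) r with h1 | h1
      · have h2 : IsAnc T r a (tip v) := by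
          rw [← sep_childEdge hT ha, hae]
          exact h1.symm
        have h3 := hlow _ h2
        rcases Sym2.eq_iff.1 hae with h4 | h4
        · rw [h4.1, T.dist_comm] at h3
          omega
        · rw [h4.1, T.dist_comm] at h3
          omega
      -- If r is on the side of `tip v`, then x is the lower end of the edge, and the tip of another
      -- leg is below x.
      · obtain ⟨w, hw, hwv⟩ := Finset.exists_mem_ne (by omega : 1 < Q.card) v
        have hs : Sep T (childEdge T (tip v) x) r (tip w) := by
          rcases sep_trans hT h1 (tip w) with h2 | h2
          · exact h2
          · exact absurd h2 (hsep' v hv w hw hwv.symm)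
        have h2 : IsAnc T r a (tip w) := by
          rw [← sep_childEdge hT ha, hae]
          exact hs
        have h3 := hlow _ h2
        have h4 : IsAnc T r a x := by
          rw [← sep_childEdge hT ha, hae]
          exact h1
        have hdw := (hx w hw).1
        rcases Sym2.eq_iff.1 hae with h5 | h5
        · rw [h5.1, T.dist_comm] at h3
          omega
        · have hpa := dist_parent hT ha
          rw [h5.2] at hpa
          have := h4.dist_le
          omega
    · rcases Sym2.eq_iff.1 hae with h4 | h4
      · exact Or.inl h4.1
      · exact Or.inr h4.2
  choose g hg using hex
  refine Finset.card_le_card_of_injOn g (fun v hv => (hg v hv).1) ?_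
  intro v hv w hw hvw
  by_contra hne'
  have h1 := (hg v hv).2
  rw [hvw, (hg w hw).2] at h1
  exact hsep' v hv w hw hne' (h1 ▸ hsep w hw)

theorem exists_mem_highStar_root (hT : T.IsTree) {r u : V} {c : ℕ} (hu : c + 1 ≤ T.dist u r) :
    ∃ a, a ∈ highStar T r c r ∧ IsAnc T r a u := by
  have hru : r ≠ u := by
    rintro rfl
    simp at hu
  have ha := parent_adj hT hru
  have hd := dist_parent hT hru
  have h1 := dist_eq_one_iff_adj.2 ha
  have hanc : IsAnc T r (parent T u r) u := by
    unfold IsAnc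
    rw [T.dist_comm (u := parent T u r) (v := u), T.dist_comm (u := r) (v := u)]
    omega
  refine ⟨parent T u r, mem_highStar.2 ⟨ha.ne', ?_, Or.inr ?_⟩, hanc⟩
  · rintro ⟨-, h⟩
    have := h u hanc
    rw [T.dist_comm] at this
    omega
  · exact (eq_parent hT ha.symm (by simp [h1])).symm

/-- The two halves of the path through r leave r by different edges, and both continue for at least
c further steps. -/
theorem two_le_highDegree (hT : T.IsTree) {r x y : V} {c : ℕ} (hxy : IsAnc T x r y)
    (hx : c + 1 ≤ T.dist x r) (hy : c + 1 ≤ T.dist y r) : 2 ≤ highDegree T r c := by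
  refine le_trans ?_ (card_highStar_le r r c)
  obtain ⟨a, ha, hax⟩ := exists_mem_highStar_root hT hx
  obtain ⟨b, hb, hby⟩ := exists_mem_highStar_root hT hy
  have hab : a ≠ b := by
    rintro rfl
    have h1 := (mem_highStar.1 ha).1
    rw [← sep_childEdge hT h1] at hax hby
    exact not_sep_of_isAnc hT hxy hax.symm hby
  exact Finset.one_lt_card.2 ⟨a, ha, b, hb, hab⟩

theorem lowCard_mono_root (hT : T.IsTree) {z r x y : V} {c : ℕ} (hxy : IsAnc T x r y)
    (hd : 2 * c ≤ T.dist x y) (hx : c ≤ T.dist x r) (hy : c ≤ T.dist y r) :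
    lowCard T z c ≤ lowCard T r c := by
  refine Finset.card_le_card fun v hv => ?_
  simp only [Finset.mem_filter, Finset.mem_univ, true_and] at hv ⊢
  exact hv.of_root hT hxy hd hx hy

theorem numColors_le_of_odd (hT : T.IsTree) {r : V} {c : ℕ} (hd : 2 * c + 1 ≤ T.diam)
    (hr : IsGoodRoot T (2 * c + 1) r) {f : Sym2 V → ℕ}
    (hf : IsColorConnection T (2 * c + 1) f) : numColors T f ≤ lowCard T r c + 1 := by
  rw [isColorConnection_iff hT] at hf
  obtain ⟨x, y, hxy, hb, hx, hy⟩ := hr.exists_ends hT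
  obtain ⟨z, Q, tip, C, hC, hle⟩ := exists_colorLegs hT (c := c) (by omega) hf
  have h1 := hC.card_le_one hf
  have h2 := lowCard_mono_root hT (z := z) (c := c) hb (by omega) (by omega) (by omega)
  omega

theorem numColors_le_of_even (hT : T.IsTree) {r : V} {c : ℕ} (hd : 2 * c + 2 ≤ T.diam)
    (hr : IsGoodRoot T (2 * c + 2) r) {f : Sym2 V → ℕ}
    (hf : IsColorConnection T (2 * c + 2) f) :
    numColors T f ≤ lowCard T r c + highDegree T r c := by
  rw [isColorConnection_iff hT] at hf
  obtain ⟨x, y, hxy, hb, hx, hy⟩ := hr.exists_ends hT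
  obtain ⟨z, Q, tip, C, hC, hle⟩ := exists_colorLegs hT (c := c) (by omega) hf
  have h2 := lowCard_mono_root hT (z := z) (c := c) hb (by omega) (by omega) (by omega)
  have h3 := two_le_highDegree hT (c := c) hb (by omega) (by omega)
  -- At most two legs are covered by `two_le_highDegree`.
  by_cases hQ : 2 < Q.card
  · have := hC.card_le_highDegree hT hf hQ r
    omega
  · omega

end UpperBound

/-! ### High and low edges on a path. -/

section HighEdges

variable {V : Type*} {T : SimpleGraph V}

/-- No end of the edge `e` is a vertex `v` with `IsLow T r c v`. -/
def HighEdge (T : SimpleGraph V) (r : V) (c : ℕ) (e : Sym2 V) : Prop :=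
  e ∈ T.edgeSet ∧ ∀ u ∈ e, ¬ IsLow T r c u

theorem not_isLow_root (r : V) (c : ℕ) : ¬ IsLow T r c r := fun h => h.1 rfl

theorem highEdge_childEdge (hT : T.IsTree) {r v : V} {c : ℕ} (hv : v ≠ r) :
    HighEdge T r c (childEdge T r v) ↔ ¬ IsLow T r c v := by
  constructor
  · intro h
    exact h.2 v (Sym2.mem_mk_left _ _)
  · intro h
    refine ⟨childEdge_mem hT hv, fun u hu => ?_⟩
    rcases Sym2.mem_iff.1 hu with rfl | rfl
    · exact h
    · exact fun h' => h (h'.of_isAnc hT (isAnc_parent hT hv))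

/-- The vertices that are not low span a subtree: the edge above a low vertex can only cut off low
vertices. -/
theorem highEdge_of_sep (hT : T.IsTree) {r u w : V} {c : ℕ} {e : Sym2 V} (hu : ¬ IsLow T r c u)
    (hw : ¬ IsLow T r c w) (he : Sep T e u w) : HighEdge T r c e := by
  obtain ⟨v, hv, rfl⟩ := exists_childEdge hT r he.mem_edgeSet
  rw [highEdge_childEdge hT hv]
  intro hlow
  rcases sep_trans hT he r with h | h
  · exact hu (hlow.of_isAnc hT ((sep_childEdge hT hv u).1 h.symm))
  · exact hw (hlow.of_isAnc hT ((sep_childEdge hT hv w).1 h))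

variable [Fintype V]

open Classical in
/-- The edges between `u` and `w` that are not high. -/
noncomputable def lowPathEdges (T : SimpleGraph V) (r : V) (c : ℕ) (u w : V) : Finset (Sym2 V) :=
  (pathEdges T u w).filter fun e => ¬ HighEdge T r c e

theorem mem_lowPathEdges {r u w : V} {c : ℕ} {e : Sym2 V} :
    e ∈ lowPathEdges T r c u w ↔ Sep T e u w ∧ ¬ HighEdge T r c e := by
  simp [lowPathEdges]

/-- The low ancestors of u have distances less than c from u, and these distances are distinct since
the ancestors form a chain. -/
theorem card_lowPathEdges_root_le (hT : T.IsTree) (r : V) (c : ℕ) (u : V) :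
    (lowPathEdges T r c r u).card ≤ c := by
  classical
  have hsub : lowPathEdges T r c r u ⊆
      (Finset.univ.filter fun v => IsLow T r c v ∧ IsAnc T r v u).image (childEdge T r) := by
    intro e he
    rw [mem_lowPathEdges] at he
    obtain ⟨v, hv, rfl⟩ := exists_childEdge hT r he.1.mem_edgeSet
    rw [highEdge_childEdge hT hv, not_not, sep_childEdge hT hv] at he
    exact Finset.mem_image_of_mem _ (by simp [he])
  refine (Finset.card_le_card hsub).trans (Finset.card_image_le.trans ?_)
  rw [← Finset.card_range c]
  refine Finset.card_le_card_of_injOn (fun v => T.dist v u) ?_ ?_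
  · intro v hv
    simp only [Finset.coe_filter, Finset.mem_univ, true_and, Set.mem_ofPred_eq] at hv
    simpa using hv.1.2 u hv.2
  · intro v hv w hw hvw
    simp only [Finset.coe_filter, Finset.mem_univ, true_and, Set.mem_ofPred_eq] at hv hw hvw
    have h1 := hv.2
    have h2 := hw.2
    unfold IsAnc at h1 h2
    exact (hv.2.chain hT hw.2 (by omega)).eq_of_dist_le hT (by omega)

/-- Between x and r all edges are high, so every low edge between x and u is also between r and u.
-/
theorem card_lowPathEdges_le_of_high (hT : T.IsTree) {r x : V} {c : ℕ} (hx : ¬ IsLow T r c x)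
    (u : V) : (lowPathEdges T r c x u).card ≤ c := by
  refine le_trans (Finset.card_le_card fun e he => ?_) (card_lowPathEdges_root_le hT r c u)
  rw [mem_lowPathEdges] at he ⊢
  rcases sep_trans hT he.1 r with h | h
  · exact absurd (highEdge_of_sep hT hx (not_isLow_root r c) h) he.2
  · exact ⟨h, he.2⟩

theorem card_lowPathEdges_le (hT : T.IsTree) (r : V) (c : ℕ) (u w : V) :
    (lowPathEdges T r c u w).card ≤ 2 * c := by
  classical
  have h : lowPathEdges T r c u w ⊆ lowPathEdges T r c r u ∪ lowPathEdges T r c r w := by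
    intro e he
    rw [Finset.mem_union, mem_lowPathEdges, mem_lowPathEdges]
    rw [mem_lowPathEdges] at he
    rcases sep_trans hT he.1 r with h | h
    · exact Or.inl ⟨h.symm, he.2⟩
    · exact Or.inr ⟨h, he.2⟩
  have h1 := (Finset.card_le_card h).trans (Finset.card_union_le _ _)
  have h2 := card_lowPathEdges_root_le hT r c u
  have h3 := card_lowPathEdges_root_le hT r c w
  omega

end HighEdges

/-! ### Colorings in which all large color trees share a hub. -/

section HubColoring

variable {V : Type*} {T : SimpleGraph V}

/-- `g` sends each edge to a representative of its color: edges that are not high have a color of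
their own, and the high edges of a color form a tree that contains `hub`. -/
structure IsHubColoring (T : SimpleGraph V) (r : V) (c : ℕ) (hub : V)
    (g : Sym2 V → Sym2 V) : Prop where
  low : ∀ e, ¬ HighEdge T r c e → g e = e
  high : ∀ e, HighEdge T r c e → HighEdge T r c (g e)
  path : ∀ e, HighEdge T r c e → ∀ u ∈ e, ∀ e', Sep T e' hub u → HighEdge T r c e' ∧ g e' = g e

theorem colorForest_reachable {f : Sym2 V → ℕ} {a : ℕ} {u w : V} (p : T.Walk u w)
    (hp : ∀ e ∈ p.edges, f e = a) (hu : u ∈ (colorForest T f a).verts)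
    (hw : w ∈ (colorForest T f a).verts) :
    (colorForest T f a).coe.Reachable ⟨u, hu⟩ ⟨w, hw⟩ := by
  induction p with
  | nil => exact Reachable.refl _
  | @cons x y z h p ih =>
    have hxy : f s(x, y) = a := hp _ (by simp)
    have hy : y ∈ (colorForest T f a).verts := ⟨x, h.symm, by rw [Sym2.eq_swap]; exact hxy⟩
    refine Reachable.trans (v := ⟨y, hy⟩) (Adj.reachable ?_)
      (ih (fun e he => hp e (by simp [he])) hy hw)
    exact ⟨h, hxy⟩

/-- Acyclicity is inherited from T, and every vertex of the color is joined to x by a path of that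
color. -/
theorem colorForest_isTree (hT : T.IsTree) {f : Sym2 V → ℕ} {a : ℕ} {x : V}
    (hx : x ∈ (colorForest T f a).verts)
    (h : ∀ u ∈ (colorForest T f a).verts, ∀ e, Sep T e x u → f e = a) :
    (colorForest T f a).coe.IsTree := by
  have hreach : ∀ u (hu : u ∈ (colorForest T f a).verts),
      (colorForest T f a).coe.Reachable ⟨x, hx⟩ ⟨u, hu⟩ := by
    intro u hu
    obtain ⟨p, hp, -⟩ := hT.1.exists_path_of_dist x u
    exact colorForest_reachable p
      (fun e he => h u hu e ((mem_edges_iff_sep hT p hp.isTrail e).1 he)) hx hu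
  refine ⟨?_, hT.2.subgraph _⟩
  rw [connected_iff]
  exact ⟨fun u w => (hreach u.1 u.2).symm.trans (hreach w.1 w.2), ⟨⟨x, hx⟩⟩⟩

variable {r hub : V} {c : ℕ} {g : Sym2 V → Sym2 V} {code : Sym2 V → ℕ}

theorem IsHubColoring.hub_mem (hT : T.IsTree) (hg : IsHubColoring T r c hub g) {e : Sym2 V}
    (he : HighEdge T r c e) : hub ∈ (colorForest T (fun e => code (g e)) (code (g e))).verts := by
  obtain ⟨u, hu, hne⟩ : ∃ u ∈ e, hub ≠ u := by
    induction e with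
    | _ a b =>
      by_cases h : hub = a
      · exact ⟨b, Sym2.mem_mk_right _ _, fun hb => T.loopless.irrefl a (by
          have := he.1
          rwa [mem_edgeSet, ← hb, h] at this)⟩
      · exact ⟨a, Sym2.mem_mk_left _ _, h⟩
  refine ⟨parent T u hub, parent_adj hT hne, ?_⟩
  have h1 := hg.path e he u hu (childEdge T u hub)
    ((sep_childEdge hT hne hub).2 (isAnc_refl _ _)).symm
  exact congrArg code h1.2

theorem IsHubColoring.isTree (hT : T.IsTree) (hg : IsHubColoring T r c hub g)
    (hcode : Function.Injective code) {e : Sym2 V} (he : e ∈ T.edgeSet) :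
    (colorForest T (fun e => code (g e)) (code (g e))).coe.IsTree := by
  by_cases hh : HighEdge T r c e
  · refine colorForest_isTree hT (hg.hub_mem hT hh) ?_
    rintro u ⟨w, huw, hc⟩ e' he'
    have hc' : g s(u, w) = g e := hcode hc
    have hhigh : HighEdge T r c s(u, w) := by
      by_contra hn
      rw [hg.low _ hn] at hc'
      exact hn (hc' ▸ hg.high e hh)
    exact congrArg code ((hg.path _ hhigh u (Sym2.mem_mk_left _ _) e' he').2.trans hc')
  · induction e with
    | _ a b =>
      refine colorForest_isTree hT (x := a) ⟨b, he, rfl⟩ ?_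
      rintro u ⟨w, huw, hc⟩ e' he'
      have hc' : g s(u, w) = g s(a, b) := hcode hc
      have hlow : ¬ HighEdge T r c s(u, w) := by
        intro hn
        have := hg.high _ hn
        rw [hc', hg.low _ hh] at this
        exact hh this
      rw [hg.low _ hlow, hg.low _ hh] at hc'
      have hu : u = a ∨ u = b := by
        rw [← Sym2.mem_iff, ← hc']
        exact Sym2.mem_mk_left _ _
      rcases hu with rfl | rfl
      · exact absurd he' not_sep_self
      · rw [(sep_adj hT he).1 he']

/-- A color without high edges belongs to a single edge, since such edges represent themselves and
`code` is injective. -/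
theorem IsHubColoring.exists_high_of_nontriv (hg : IsHubColoring T r c hub g)
    (hcode : Function.Injective code) {a : ℕ} (ha : Nontriv T (fun e => code (g e)) a) :
    ∃ e, HighEdge T r c e ∧ a = code (g e) := by
  by_contra hn
  push Not at hn
  have hsub : (colorForest T (fun e => code (g e)) a).edgeSet.Subsingleton := by
    have key : ∀ e ∈ (colorForest T (fun e => code (g e)) a).edgeSet, code e = a := by
      intro e he
      induction e with
      | _ u w =>
        have h2 : code (g s(u, w)) = a := he.2
        rw [hg.low _ fun h => hn _ h h2.symm] at h2
        exact h2
    intro e he e' he'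
    exact hcode ((key e he).trans (key e' he').symm)
  rcases Set.Subsingleton.eq_empty_or_singleton hsub with h | ⟨e, h⟩ <;>
  · rw [Nontriv, h] at ha
    simp at ha

/-- The edges above low vertices and the edges of `S` have pairwise different colors, since `g`
preserves being high and being not high. -/
theorem IsHubColoring.le_numColors [Fintype V] (hT : T.IsTree) (hg : IsHubColoring T r c hub g)
    (hcode : Function.Injective code) (S : Finset (Sym2 V)) (hS : ∀ e ∈ S, HighEdge T r c e)
    (hinj : Set.InjOn g S) : lowCard T r c + S.card ≤ numColors T fun e => code (g e) := by
  classical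
  let L := (Finset.univ.filter fun v => IsLow T r c v).image (childEdge T r)
  have hLlow : ∀ e ∈ L, e ∈ T.edgeSet ∧ ¬ HighEdge T r c e := by
    intro e he
    obtain ⟨v, hv, rfl⟩ := Finset.mem_image.1 he
    rw [Finset.mem_filter] at hv
    rw [highEdge_childEdge hT hv.2.1, not_not]
    exact ⟨childEdge_mem hT hv.2.1, hv.2⟩
  have hL : L.card = lowCard T r c := by
    refine Finset.card_image_of_injOn fun v hv w hw h => ?_
    simp only [Finset.coe_filter, Finset.mem_univ, true_and, Set.mem_ofPred_eq] at hv hw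
    exact childEdge_inj hT hv.1 hw.1 h
  have hdisj : Disjoint L S := Finset.disjoint_left.2 fun e he he' => (hLlow e he).2 (hS e he')
  rw [← hL, ← Finset.card_union_of_disjoint hdisj]
  have hinj' : Set.InjOn (fun e => code (g e)) (L ∪ S : Finset (Sym2 V)) := by
    intro e he e' he' h
    have h' : g e = g e' := hcode h
    rw [Finset.mem_coe, Finset.mem_union] at he he'
    rcases he with he | he <;> rcases he' with he' | he'
    · rwa [hg.low _ (hLlow e he).2, hg.low _ (hLlow e' he').2] at h'
    · rw [hg.low _ (hLlow e he).2] at h'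
      exact absurd (h' ▸ hg.high _ (hS e' he')) (hLlow e he).2
    · rw [hg.low _ (hLlow e' he').2] at h'
      exact absurd (h' ▸ hg.high _ (hS e he)) (hLlow e' he').2
    · exact hinj he he' h'
  rw [← Finset.card_image_of_injOn hinj', ← Set.ncard_coe_finset, numColors, Finset.coe_image]
  refine Set.ncard_le_ncard (Set.image_mono fun e he => ?_) (Set.toFinite _)
  rw [Finset.mem_coe, Finset.mem_union] at he
  rcases he with he | he
  · exact (hLlow e he).1
  · exact (hS e he).1

theorem card_image_pathEdges_le [Fintype V] (r : V) (c : ℕ) (f : Sym2 V → ℕ) (u w : V)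
    (A : Finset ℕ) (hA : ∀ e, HighEdge T r c e → Sep T e u w → f e ∈ A) :
    ((pathEdges T u w).image f).card ≤ (lowPathEdges T r c u w).card + A.card := by
  classical
  have h : (pathEdges T u w).image f ⊆ (lowPathEdges T r c u w).image f ∪ A := by
    intro a ha
    obtain ⟨e, he, rfl⟩ := Finset.mem_image.1 ha
    rw [mem_pathEdges] at he
    by_cases hh : HighEdge T r c e
    · exact Finset.mem_union_right _ (hA e hh he)
    · exact Finset.mem_union_left _ (Finset.mem_image_of_mem f (mem_lowPathEdges.2 ⟨he, hh⟩))
  refine (Finset.card_le_card h).trans ((Finset.card_union_le _ _).trans ?_)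
  gcongr
  exact Finset.card_image_le

end HubColoring

/-! ### Optimal colorings and the value of the color connection number. -/

section Extremal

variable {V : Type*} [Fintype V] {T : SimpleGraph V}

/-- The edges of each color form a tree, any two of these trees with more than one edge meet, and
each tree with more than one edge is near to each vertex of degree one. -/
structure IsTreeColoring (T : SimpleGraph V) (k : ℕ) (f : Sym2 V → ℕ) : Prop where
  isTree : ∀ c ∈ f '' T.edgeSet, (colorForest T f c).coe.IsTree
  meet : ∀ c c', Nontriv T f c → Nontriv T f c' →
    ((colorForest T f c).verts ∩ (colorForest T f c').verts).Nonempty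
  near : ∀ c u, Nontriv T f c → (T.neighborSet u).ncard = 1 →
    ∃ w ∈ (colorForest T f c).verts, colorDist T f u w ≤ k / 2

/-- The colorings are built with edges as colors; this turns them into natural numbers. -/
theorem exists_code (V : Type*) [Fintype V] : ∃ code : Sym2 V → ℕ, Function.Injective code := by
  classical
  exact ⟨fun e => Fintype.equivFin _ e, fun e e' h =>
    (Fintype.equivFin _).injective (Fin.ext h)⟩

omit [Fintype V] in
theorem IsHubColoring.isTreeColoring (hT : T.IsTree) {r hub : V} {c k : ℕ}
    {g : Sym2 V → Sym2 V} {code : Sym2 V → ℕ} (hg : IsHubColoring T r c hub g)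
    (hcode : Function.Injective code)
    (hnear : ∀ e u, HighEdge T r c e →
      ∃ w ∈ (colorForest T (fun e => code (g e)) (code (g e))).verts,
        colorDist T (fun e => code (g e)) u w ≤ k / 2) :
    IsTreeColoring T k fun e => code (g e) := by
  refine ⟨?_, ?_, ?_⟩
  · rintro a ⟨e, he, rfl⟩
    exact hg.isTree hT hcode he
  · intro a a' ha ha'
    obtain ⟨e, he, rfl⟩ := hg.exists_high_of_nontriv hcode ha
    obtain ⟨e', he', rfl⟩ := hg.exists_high_of_nontriv hcode ha'
    exact ⟨hub, hg.hub_mem hT he, hg.hub_mem hT he'⟩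
  · intro a u ha _
    obtain ⟨e, he, rfl⟩ := hg.exists_high_of_nontriv hcode ha
    exact hnear e u he

/-- All high edges receive one color, represented by a high edge `e₀`; the hub is r. A path has at
most 2c other edges. -/
theorem exists_coloring_of_odd (hT : T.IsTree) {r x y : V} {c : ℕ} (hxy : IsAnc T x r y)
    (hd : 2 * c + 1 ≤ T.dist x y) : ∃ f, IsColorConnection T (2 * c + 1) f ∧
      lowCard T r c + 1 ≤ numColors T f ∧ IsTreeColoring T (2 * c + 1) f := by
  classical
  obtain ⟨code, hcode⟩ := exists_code V
  obtain ⟨e₀, he₀⟩ : ∃ e₀, HighEdge T r c e₀ := by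
    obtain ⟨u, hu⟩ : ∃ u, c + 1 ≤ T.dist u r := by
      unfold IsAnc at hxy
      rw [T.dist_comm (u := r)] at hxy
      by_cases h : c + 1 ≤ T.dist x r
      · exact ⟨x, h⟩
      · exact ⟨y, by omega⟩
    obtain ⟨a, ha, -⟩ := exists_mem_highStar_root hT hu
    rw [mem_highStar] at ha
    exact ⟨_, (highEdge_childEdge hT ha.1).2 ha.2.1⟩
  let g : Sym2 V → Sym2 V := fun e => if HighEdge T r c e then e₀ else e
  have ghigh : ∀ e, HighEdge T r c e → g e = e₀ := fun e he => if_pos he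
  have hg : IsHubColoring T r c r g := by
    refine ⟨fun e he => if_neg he, fun e he => (ghigh e he).symm ▸ he₀, ?_⟩
    intro e he u hu e' he'
    have h1 := highEdge_of_sep hT (not_isLow_root r c) (he.2 u hu) he'
    exact ⟨h1, by rw [ghigh _ h1, ghigh _ he]⟩
  refine ⟨fun e => code (g e), ?_, ?_, hg.isTreeColoring hT hcode ?_⟩
  · rw [isColorConnection_iff hT]
    intro u w
    have h1 := card_image_pathEdges_le (T := T) r c (fun e => code (g e)) u w {code e₀}
      (fun e he _ => by simp [ghigh e he])
    have h2 := card_lowPathEdges_le hT r c u w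
    rw [Finset.card_singleton] at h1
    omega
  · have := hg.le_numColors hT hcode {e₀} (by simpa using he₀) (by simp)
    simpa using this
  · intro e u he
    -- The lowest ancestor of u that is not low. Only edges that are not high, hence at most c of
    -- them, lie between it and u.
    obtain ⟨w, hw, hmax⟩ := Finset.exists_max_image
      (Finset.univ.filter fun w => IsAnc T r w u ∧ ¬ IsLow T r c w) (fun w => T.dist r w)
      ⟨r, by simp [isAnc_root, not_isLow_root]⟩
    simp only [Finset.mem_filter, Finset.mem_univ, true_and] at hw hmax
    refine ⟨w, ?_, ?_⟩
    · by_cases hwr : w = r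
      · rw [hwr]
        exact hg.hub_mem hT he
      · refine ⟨parent T r w, parent_adj hT hwr, congrArg code ?_⟩
        rw [ghigh _ he]
        exact ghigh _ ((highEdge_childEdge hT hwr).2 hw.2)
    · rw [colorDist_eq hT]
      have hlow : ∀ e, Sep T e u w → Sep T e r u ∧ ¬ HighEdge T r c e := by
        intro e he
        have h1 := Sep.of_isAnc hT (IsAnc.symm hw.1) he
        obtain ⟨v, hv, rfl⟩ := exists_childEdge hT r he.mem_edgeSet
        refine ⟨h1.symm, fun hh => ?_⟩
        rw [highEdge_childEdge hT hv] at hh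
        have h2 := (sep_childEdge hT hv u).1 h1.symm
        have h3 : IsAnc T r v w := h2.chain hT hw.1 (hmax v ⟨h2, hh⟩)
        rw [← sep_childEdge hT hv] at h3
        exact not_sep_of_isAnc hT hw.1 h3 he.symm
      have h1 := card_image_pathEdges_le (T := T) r c (fun e => code (g e)) u w ∅
        (fun e he h => absurd he (hlow e h).2)
      have h2 : lowPathEdges T r c u w ⊆ lowPathEdges T r c r u := by
        intro e he
        rw [mem_lowPathEdges] at he ⊢
        exact hlow e he.1
      have h3 := (Finset.card_le_card h2).trans (card_lowPathEdges_root_le hT r c u)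
      rw [Finset.card_empty] at h1
      omega

/-- The hub h has maximum degree in the high subtree. A high edge is represented by the edge at h
through which it is reached from h. A path meets at most two branches at h, and at most 2c edges
that are not high. -/
theorem exists_coloring_of_even (hT : T.IsTree) {r x y : V} {c : ℕ} (hxy : IsAnc T x r y)
    (hx : c + 1 ≤ T.dist x r) (hy : c + 1 ≤ T.dist y r) :
    ∃ f, IsColorConnection T (2 * c + 2) f ∧
      lowCard T r c + highDegree T r c ≤ numColors T f ∧ IsTreeColoring T (2 * c + 2) f := by
  classical
  obtain ⟨code, hcode⟩ := exists_code V
  obtain ⟨h, -, hdeg⟩ := Finset.exists_mem_eq_sup Finset.univ ⟨r, Finset.mem_univ r⟩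
    fun x => (highStar T r c x).card
  change highDegree T r c = _ at hdeg
  have hhigh : ¬ IsLow T r c h := by
    have h2 := two_le_highDegree hT hxy hx hy
    obtain ⟨w, hw⟩ := Finset.card_pos.1 (by omega : 0 < (highStar T r c h).card)
    rw [mem_highStar] at hw
    refine ((highEdge_childEdge hT hw.1).2 hw.2.1).2 h ?_
    rcases hw.2.2 with h3 | h3
    · exact h3 ▸ Sym2.mem_mk_left _ _
    · exact h3 ▸ Sym2.mem_mk_right _ _
  -- `first b` will be the neighbor of h on the path to b; the value at h itself is irrelevant.
  have hfirst : ∀ b, ∃ a, b ≠ h → IsAnc T h a b ∧ T.dist h a = 1 := by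
    intro b
    by_cases hb : b = h
    · exact ⟨h, fun h' => absurd hb h'⟩
    · have hpos := hT.1.pos_dist_of_ne (Ne.symm hb)
      obtain ⟨a, ha, hab⟩ := exists_dist_eq hT h b (i := T.dist h b - 1) (by omega)
      refine ⟨a, fun _ => ⟨ha, ?_⟩⟩
      unfold IsAnc at ha
      omega
  choose first hfirst using hfirst
  have hfirst_eq : ∀ a b, IsAnc T h a b → a ≠ h → first a = first b := by
    intro a b hab ha
    have hb : b ≠ h := by
      rintro rfl
      exact ha (hab.eq_root hT)
    obtain ⟨h1, h2⟩ := hfirst a ha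
    obtain ⟨h3, h4⟩ := hfirst b hb
    exact ((h1.trans hT hab).chain hT h3 (by omega)).eq_of_dist_le hT (by omega)
  -- `child e` will be the end of e that is farther from h.
  have hchild : ∀ e, ∃ b, e ∈ T.edgeSet → b ≠ h ∧ childEdge T h b = e := by
    intro e
    by_cases he : e ∈ T.edgeSet
    · obtain ⟨b, hb⟩ := exists_childEdge hT h he
      exact ⟨b, fun _ => hb⟩
    · exact ⟨h, fun h' => absurd h' he⟩
  choose child hchild using hchild
  have hfirst_ne : ∀ b, b ≠ h → first b ≠ h := by
    intro b hb h'
    have := (hfirst b hb).2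
    rw [h'] at this
    simp at this
  let g : Sym2 V → Sym2 V := fun e =>
    if HighEdge T r c e then childEdge T h (first (child e)) else e
  have ghigh : ∀ e, HighEdge T r c e → g e = childEdge T h (first (child e)) := fun e he =>
    if_pos he
  have gsep : ∀ e u, HighEdge T r c e → Sep T e h u → g e = childEdge T h (first u) := by
    intro e u he hs
    obtain ⟨hb, hbe⟩ := hchild e he.1
    rw [ghigh e he]
    rw [← hbe, sep_childEdge hT hb] at hs
    rw [hfirst_eq _ _ hs hb]
  have hg : IsHubColoring T r c h g := by
    refine ⟨fun e he => if_neg he, ?_, ?_⟩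
    · intro e he
      obtain ⟨hb, hbe⟩ := hchild e he.1
      rw [ghigh e he]
      have hmem : child e ∈ childEdge T h (child e) := Sym2.mem_mk_left _ _
      rw [hbe] at hmem
      exact highEdge_of_sep hT hhigh (he.2 (child e) hmem)
        ((sep_childEdge hT (hfirst_ne _ hb) _).2 (hfirst _ hb).1)
    · intro e he u hu e' he'
      have h1 := highEdge_of_sep hT hhigh (he.2 u hu) he'
      refine ⟨h1, ?_⟩
      obtain ⟨hb, hbe⟩ := hchild e he.1
      have hanc : IsAnc T h u (child e) := by
        rw [← hbe] at hu
        rcases Sym2.mem_iff.1 hu with h2 | h2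
        · rw [← h2]
          exact isAnc_refl _ _
        · rw [h2]
          exact isAnc_parent hT hb
      have hu' : u ≠ h := by
        rintro rfl
        exact not_sep_self he'
      rw [gsep e' u h1 he', ghigh e he, hfirst_eq _ _ hanc hu']
  refine ⟨fun e => code (g e), ?_, ?_, hg.isTreeColoring hT hcode ?_⟩
  · rw [isColorConnection_iff hT]
    intro u w
    have h1 := card_image_pathEdges_le (T := T) r c (fun e => code (g e)) u w
      {code (childEdge T h (first u)), code (childEdge T h (first w))} (fun e he hs => by
        rw [Finset.mem_insert, Finset.mem_singleton]
        rcases sep_trans hT hs h with h' | h'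
        · exact Or.inl (congrArg code (gsep e u he h'.symm))
        · exact Or.inr (congrArg code (gsep e w he h')))
    have h2 := card_lowPathEdges_le hT r c u w
    have h3 := Finset.card_le_two (a := code (childEdge T h (first u)))
      (b := code (childEdge T h (first w)))
    omega
  · have hstar : ((highStar T r c h).image (childEdge T r)).card = highDegree T r c := by
      rw [hdeg]
      refine Finset.card_image_of_injOn fun v hv w hw h => ?_
      exact childEdge_inj hT (mem_highStar.1 hv).1 (mem_highStar.1 hw).1 h
    rw [← hstar]
    -- The high edges at h represent themselves, so they give `highDegree T r c` different colors.
    have hS : ∀ e ∈ (highStar T r c h).image (childEdge T r), HighEdge T r c e ∧ g e = e := by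
      intro e he
      obtain ⟨w, hw, rfl⟩ := Finset.mem_image.1 he
      rw [mem_highStar] at hw
      have hh := (highEdge_childEdge hT hw.1).2 hw.2.1
      refine ⟨hh, ?_⟩
      obtain ⟨hb, hbe⟩ := hchild _ hh.1
      have hmem : h ∈ childEdge T h (child (childEdge T r w)) := by
        rw [hbe]
        rcases hw.2.2 with h3 | h3
        · exact h3 ▸ Sym2.mem_mk_left _ _
        · exact h3 ▸ Sym2.mem_mk_right _ _
      have hp : h = parent T h (child (childEdge T r w)) := by
        rcases Sym2.mem_iff.1 hmem with h3 | h3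
        · exact absurd h3.symm hb
        · exact h3
      have hd := dist_parent hT hb
      rw [← hp, SimpleGraph.dist_self] at hd
      obtain ⟨h4, h5⟩ := hfirst _ hb
      rw [ghigh _ hh, h4.eq_of_dist_le hT (by omega), hbe]
    refine hg.le_numColors hT hcode _ (fun e he => (hS e he).1) fun e he e' he' hee' => ?_
    rwa [(hS e he).2, (hS e' he').2] at hee'
  · intro e u he
    refine ⟨h, hg.hub_mem hT he, ?_⟩
    rw [colorDist_eq hT, pathEdges_comm]
    have h1 := card_image_pathEdges_le (T := T) r c (fun e => code (g e)) h u
      {code (childEdge T h (first u))} (fun e he hs => by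
        rw [Finset.mem_singleton]
        exact congrArg code (gsep e u he hs))
    -- From the hub to u there is at most one branch color and at most c further edges, and c + 1 is
    -- half of k.
    have h2 := card_lowPathEdges_le_of_high hT hhigh u
    rw [Finset.card_singleton] at h1
    omega

omit [Fintype V] in
theorem cc_eq_of_le (k N : ℕ)
    (hle : ∀ f, IsColorConnection T k f → numColors T f ≤ N)
    (hex : ∃ f, IsColorConnection T k f ∧ N ≤ numColors T f ∧ IsTreeColoring T k f) :
    cc T k = N ∧ ∃ f, IsExtremal T k f ∧ IsTreeColoring T k f := by
  obtain ⟨f, hf, hN, hft⟩ := hex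
  have hfN : numColors T f = N := le_antisymm (hle f hf) hN
  have hcc : cc T k = N := by
    refine IsGreatest.csSup_eq ⟨⟨f, hf, hfN⟩, ?_⟩
    rintro _ ⟨f', hf', rfl⟩
    exact hle f' hf'
  exact ⟨hcc, f, ⟨hf, hfN.trans hcc.symm⟩, hft⟩

theorem cc_of_odd (hT : T.IsTree) {r : V} {c : ℕ} (hd : 2 * c + 1 ≤ T.diam)
    (hr : IsGoodRoot T (2 * c + 1) r) : cc T (2 * c + 1) = lowCard T r c + 1 ∧
      ∃ f, IsExtremal T (2 * c + 1) f ∧ IsTreeColoring T (2 * c + 1) f := by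
  obtain ⟨x, y, hxy, hb, -, -⟩ := hr.exists_ends hT
  exact cc_eq_of_le _ _ (fun f hf => numColors_le_of_odd hT hd hr hf)
    (exists_coloring_of_odd hT hb (by omega))

theorem cc_of_even (hT : T.IsTree) {r : V} {c : ℕ} (hd : 2 * c + 2 ≤ T.diam)
    (hr : IsGoodRoot T (2 * c + 2) r) :
    cc T (2 * c + 2) = lowCard T r c + highDegree T r c ∧
      ∃ f, IsExtremal T (2 * c + 2) f ∧ IsTreeColoring T (2 * c + 2) f := by
  obtain ⟨x, y, hxy, hb, hx, hy⟩ := hr.exists_ends hT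
  exact cc_eq_of_le _ _ (fun f hf => numColors_le_of_even hT hd hr hf)
    (exists_coloring_of_even hT hb (by omega) (by omega))

theorem cc_of_diam_lt (hT : T.IsTree) {k : ℕ} (hk : T.diam < k) :
    cc T k = Fintype.card V - 1 ∧ ∃ f, IsExtremal T k f ∧ IsTreeColoring T k f := by
  classical
  have hcard : T.edgeSet.ncard = Fintype.card V - 1 := by
    have := hT.card_edgeFinset
    rw [← coe_edgeFinset, Set.ncard_coe_finset]
    omega
  obtain ⟨r⟩ := hT.1.nonempty
  obtain ⟨code, hcode⟩ := exists_code V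
  -- With the height bound `T.diam + 1` every non-root vertex is low, so the coloring with all
  -- colors distinct is a hub coloring without high edges.
  have hnone : ∀ e, ¬ HighEdge T r (T.diam + 1) e := by
    intro e he
    obtain ⟨v, hv, rfl⟩ := exists_childEdge hT r he.1
    refine he.2 v (Sym2.mem_mk_left _ _) ⟨hv, fun u _ => ?_⟩
    exact Nat.lt_succ_of_le (dist_le_diam_of_isTree hT v u)
  have hg : IsHubColoring T r (T.diam + 1) r id :=
    ⟨fun _ _ => rfl, fun _ h => h, fun e he => absurd he (hnone e)⟩
  refine cc_eq_of_le _ _ ?_ ⟨fun e => code (id e), ?_, ?_,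
    hg.isTreeColoring hT hcode fun e _ he => absurd he (hnone e)⟩
  · intro f _
    rw [← hcard]
    exact Set.ncard_image_le (Set.toFinite _)
  · rw [isColorConnection_iff hT]
    intro u w
    refine Finset.card_image_le.trans ?_
    rw [card_pathEdges hT]
    exact (dist_le_diam_of_isTree hT u w).trans hk.le
  · rw [← hcard, numColors]
    exact (Set.ncard_image_of_injective _ hcode).ge

omit [Fintype V] in
/-- A path of maximum length contains a good root. -/
theorem isGoodRoot_of_dist (hT : T.IsTree) {k : ℕ} {x y r : V} (hxy : T.dist x y = T.diam)
    (hr : IsAnc T x r y) (hx : k / 2 ≤ T.dist x r) (hy : k / 2 ≤ T.dist y r) :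
    IsGoodRoot T k r := by
  obtain ⟨p, hp⟩ := hT.1.exists_walk_length_eq_dist x r
  obtain ⟨q, hq⟩ := hT.1.exists_walk_length_eq_dist r y
  have hl : (p.append q).length = T.dist x y := by
    rw [Walk.length_append, hp, hq]
    exact hr
  refine ⟨x, y, p.append q, Walk.isPath_of_length_eq_dist _ hl, hl.trans hxy, ?_, hx, hy⟩
  rw [Walk.mem_support_append_iff]
  exact Or.inl p.end_mem_support

omit [Fintype V] in
theorem exists_isGoodRoot (hT : T.IsTree) {k : ℕ} (hk : k ≤ T.diam) : ∃ r, IsGoodRoot T k r := by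
  have hne := hT.1.nonempty
  obtain ⟨x, y, hxy⟩ := T.exists_dist_eq_diam
  obtain ⟨r, hr, hri⟩ := exists_dist_eq hT x y (i := k / 2) (by omega)
  refine ⟨r, isGoodRoot_of_dist hT hxy hr ?_ (by rw [T.dist_comm]; omega)⟩
  unfold IsAnc at hr
  omega

theorem exists_extremal (hT : T.IsTree) {k : ℕ} (hk : 1 ≤ k) :
    ∃ f, IsExtremal T k f ∧ IsTreeColoring T k f := by
  by_cases hd : k ≤ T.diam
  · obtain ⟨r, hr⟩ := exists_isGoodRoot hT hd
    obtain ⟨c, rfl | rfl⟩ : ∃ c, k = 2 * c + 1 ∨ k = 2 * c + 2 := ⟨(k - 1) / 2, by omega⟩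
    · exact (cc_of_odd hT hd hr).2
    · exact (cc_of_even hT hd hr).2
  · exact (cc_of_diam_lt hT (by omega)).2

end Extremal

/-! ### Running times of loops on the machine. -/

section Machine

@[simp] theorem State.setReg_reg (s : State) (x m y : ℕ) :
    (s.setReg x m).reg y = if y = x then m else s.reg y := by
  simp [State.setReg, Function.update_apply]

@[simp] theorem State.setReg_mem (s : State) (x m : ℕ) : (s.setReg x m).mem = s.mem := rfl

@[simp] theorem State.setMem_reg (s : State) (a i m : ℕ) : (s.setMem a i m).reg = s.reg := rfl

@[simp] theorem State.setMem_mem (s : State) (a i m b : ℕ) :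
    (s.setMem a i m).mem b = if b = a then Function.update (s.mem b) i m else s.mem b := by
  by_cases h : b = a
  · subst h; simp [State.setMem]
  · simp [State.setMem, h]

/-- The program has no loops. -/
def Prog.LoopFree : Prog → Prop
  | .skip => True
  | .assign _ _ => True
  | .store _ _ _ => True
  | .seq p q => p.LoopFree ∧ q.LoopFree
  | .ite _ p q => p.LoopFree ∧ q.LoopFree
  | .loop _ _ => False

open Classical in
/-- The final state of a program without loops. -/
noncomputable def Prog.exec : Prog → State → State
  | .skip, s => s
  | .assign x e, s => s.setReg x (e.eval s)
  | .store a i e, s => s.setMem a (i.eval s) (e.eval s)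
  | .seq p q, s => q.exec (p.exec s)
  | .ite c p q, s => if c.Holds s then p.exec s else q.exec s
  | .loop _ _, s => s

/-- A bound for the number of steps of a program without loops. -/
def Prog.bound : Prog → ℕ
  | .skip => 1
  | .assign _ e => e.cost + 1
  | .store _ i e => i.cost + e.cost + 1
  | .seq p q => p.bound + q.bound
  | .ite c p q => c.cost + 1 + p.bound + q.bound
  | .loop _ _ => 0

theorem Prog.LoopFree.runs {p : Prog} (hp : p.LoopFree) (s : State) :
    ∃ t, Runs p s (p.exec s) t ∧ t ≤ p.bound := by
  induction p generalizing s with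
  | skip => exact ⟨_, Runs.skip s, le_rfl⟩
  | assign x e => exact ⟨_, Runs.assign s x e, le_rfl⟩
  | store a i e => exact ⟨_, Runs.store s a i e, le_rfl⟩
  | seq p q ihp ihq =>
    obtain ⟨t, h, ht⟩ := ihp hp.1 s
    obtain ⟨t', h', ht'⟩ := ihq hp.2 (p.exec s)
    exact ⟨_, Runs.seq h h', Nat.add_le_add ht ht'⟩
  | ite c p q ihp ihq =>
    by_cases hc : c.Holds s
    · obtain ⟨t, h, ht⟩ := ihp hp.1 s
      rw [Prog.exec, if_pos hc, Prog.bound]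
      exact ⟨_, Runs.ite_true hc h, by omega⟩
    · obtain ⟨t, h, ht⟩ := ihq hp.2 s
      rw [Prog.exec, if_neg hc, Prog.bound]
      exact ⟨_, Runs.ite_false hc h, by omega⟩
  | loop c p => exact hp.elim

/-- A loop with an invariant `Inv i s t`, where `t` is the number of steps until now. -/
theorem exists_runs_loop {c : Test} {p : Prog} (N : ℕ) (Inv : ℕ → State → ℕ → Prop)
    (step : ∀ i s t, i < N → Inv i s t → c.Holds s ∧
      ∃ s' t', Runs p s s' t' ∧ Inv (i + 1) s' (t + (c.cost + 1 + t')))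
    (hexit : ∀ s t, Inv N s t → ¬ c.Holds s) {s : State} (h0 : Inv 0 s 0) :
    ∃ s' t, Runs (.loop c p) s s' (t + (c.cost + 1)) ∧ Inv N s' t := by
  have key : ∀ d i s t, i + d = N → Inv i s t →
      ∃ s' t', Runs (.loop c p) s s' (t' + (c.cost + 1)) ∧ Inv N s' (t + t') := by
    intro d
    induction d with
    | zero =>
      intro i s t hi h
      obtain rfl : i = N := hi
      exact ⟨s, 0, by rw [zero_add]; exact Runs.loop_stop (hexit s t h), h⟩
    | succ d ih =>
      intro i s t hi h
      obtain ⟨hc, s', t', hr, h'⟩ := step i s t (by omega) h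
      obtain ⟨s'', t'', hr', h''⟩ := ih (i + 1) s' _ (by omega) h'
      refine ⟨s'', c.cost + 1 + t' + t'', ?_, ?_⟩
      · have := Runs.loop_step hc hr hr'
        rwa [← add_assoc] at this
      · rwa [add_assoc] at h''
  obtain ⟨s', t, hr, h⟩ := key N 0 s 0 (zero_add N) h0
  exact ⟨s', t, hr, by rwa [zero_add] at h⟩

/-- A round costs at most the body, `e.cost + 3` for the test and 4 for the increment. The extra
round in `N + 1` pays for the initialization and the last test. -/
theorem exists_runs_forTo {x : ℕ} {e : Expr} {p : Prog} (hp : p.LoopFree) (N : ℕ)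
    (Inv : ℕ → State → Prop) (hInv : ∀ i s, Inv i s → s.reg x = i ∧ e.eval s = N)
    (step : ∀ i s, i < N → Inv i s → Inv (i + 1) ((p.exec s).setReg x ((p.exec s).reg x + 1)))
    {s : State} (h0 : Inv 0 (s.setReg x 0)) :
    ∃ s' t, Runs (Prog.forTo x e p) s s' t ∧ Inv N s' ∧
      t ≤ (N + 1) * (p.bound + e.cost + 7) := by
  have hlf : (Prog.seq p (.assign x (.add (.var x) (.lit 1)))).LoopFree := ⟨hp, trivial⟩
  obtain ⟨s', t, hr, h, ht⟩ := exists_runs_loop (c := .lt (.var x) e)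
    (p := .seq p (.assign x (.add (.var x) (.lit 1)))) N
    (fun i s t => Inv i s ∧ t ≤ i * (p.bound + e.cost + 7)) (by
      rintro i s t hi ⟨h, ht⟩
      obtain ⟨h1, h2⟩ := hInv i s h
      refine ⟨by simpa [Test.Holds, Expr.eval, h1, h2] using hi, ?_⟩
      obtain ⟨t', hr, ht'⟩ := hlf.runs s
      refine ⟨_, t', hr, step i s hi h, ?_⟩
      rw [Prog.bound, Prog.bound] at ht'
      simp only [Expr.cost, Test.cost] at ht' ⊢
      rw [add_mul]
      omega)
    (by
      rintro s t ⟨h, -⟩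
      obtain ⟨h1, h2⟩ := hInv N s h
      simp [Test.Holds, Expr.eval, h1, h2]) (s := s.setReg x 0) ⟨h0, by omega⟩
  refine ⟨s', _, Runs.seq (Runs.assign s x (.lit 0)) hr, h, ?_⟩
  simp only [Expr.cost, Test.cost]
  rw [add_mul]
  omega

theorem exists_runs_forNonRoot {p : Prog} (hp : p.LoopFree) {n : ℕ}
    (Inv : ℕ → State → Prop) (hN : ∀ i s, Inv i s → s.reg rN = n)
    (hI : ∀ i s m, Inv i s → Inv i (s.setReg rI m))
    (step : ∀ i s, i + 1 < n → s.reg rI = i → s.reg rJ = s.mem aPar i → Inv i s →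
      (p.exec s).reg rI = i ∧ Inv (i + 1) (p.exec s))
    (hJ : ∀ i s m, Inv i s → Inv i (s.setReg rJ m))
    {s : State} (hn : 1 ≤ n) (h0 : Inv 0 s) :
    ∃ s' t, Runs (forNonRoot p) s s' t ∧ Inv (n - 1) s' ∧ t ≤ (n + 1) * (p.bound + 19) := by
  obtain ⟨s', t, hr, h, ht⟩ := exists_runs_forTo (x := rI) (e := .var rN)
    (p := .ite (.lt (.add (.var rI) (.lit 1)) (.var rN)) (.seq (.assign rJ (cellI aPar)) p) .skip)
    -- The last round, for the root, does nothing; therefore the index of the invariant stops at n -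
    -- 1.
    ⟨⟨trivial, hp⟩, trivial⟩ n (fun i s => Inv (min i (n - 1)) s ∧ s.reg rI = i)
    (fun i s h => ⟨h.2, hN _ s h.1⟩) (by
      rintro i s hi ⟨h, hri⟩
      have hrn := hN _ s h
      rw [Prog.exec]
      simp only [Test.Holds, Expr.eval, hri, hrn]
      split_ifs with hlt
      · rw [Prog.exec, Prog.exec]
        rw [min_eq_left (by omega)] at h ⊢
        obtain ⟨h1, h2⟩ := step i (s.setReg rJ ((cellI aPar).eval s)) hlt
          (by simpa using hri) (by simp [Expr.eval, hri]) (hJ _ _ _ h)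
        exact ⟨hI _ _ _ h2, by simp [h1]⟩
      · rw [Prog.exec]
        rw [min_eq_right (by omega)] at h ⊢
        exact ⟨hI _ _ _ h, by simp [hri]⟩)
    (s := s) ⟨hI _ _ _ (by simpa using h0), by simp⟩
  refine ⟨s', t, hr, ?_, ?_⟩
  · rw [min_eq_right (by omega)] at h
    exact h.1
  · refine ht.trans (Nat.mul_le_mul_left _ ?_)
    simp only [Prog.bound, Test.cost, Expr.cost]
    omega

end Machine

/-! ### The numbers a and b, independently of the machine. -/

section Numeric

/-- The pointers `par` describe a rooted tree on `{0, …, n - 1}` with root `n - 1`, in which the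
subtree below `j` has height `ht j`. -/
structure IsPointerTree (n : ℕ) (par ht : ℕ → ℕ) : Prop where
  pos : 1 ≤ n
  lt_par : ∀ i, i + 1 < n → i < par i
  par_lt : ∀ i, i + 1 < n → par i < n
  ht_eq : ∀ j, j < n → ht j = ((Finset.range (n - 1)).filter fun i => par i = j).sup fun i => ht i + 1

/-- The number of the `l < i` with `ht l < c`. -/
def lowCount (c : ℕ) (ht : ℕ → ℕ) (i : ℕ) : ℕ := ((Finset.range i).filter fun l => ht l < c).card

/-- The values `A` and `B` of `a` and `b` after the vertices before `i` are processed. -/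
structure UpInv (n c : ℕ) (par ht : ℕ → ℕ) (i : ℕ) (A B : ℕ → ℕ) : Prop where
  b_eq : ∀ j, j < n → B j = ((Finset.range i).filter fun l => par l = j).sup fun l => min c (ht l + 1)
  sum_a : ∑ j ∈ Finset.Ico i n, A j = lowCount c ht i

variable {n c : ℕ} {par ht A B : ℕ → ℕ} {i : ℕ}

theorem UpInv.zero (hA : ∀ j, j < n → A j = 0) (hB : ∀ j, j < n → B j = 0) :
    UpInv n c par ht 0 A B := by
  refine ⟨fun j hj => by simp [hB j hj], ?_⟩
  rw [Finset.sum_eq_zero fun j hj => hA j (Finset.mem_Ico.1 hj).2]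
  simp [lowCount]

/-- Children have smaller numbers than their parents, so all children of i are processed before i.
-/
theorem UpInv.b_self (hP : IsPointerTree n par ht) (h : UpInv n c par ht i A B) (hi : i + 1 < n) :
    B i = min c (ht i) := by
  have h1 : ((Finset.range i).filter fun l => par l = i) =
      (Finset.range (n - 1)).filter fun l => par l = i := by
    ext l
    simp only [Finset.mem_filter, Finset.mem_range]
    constructor
    · rintro ⟨h1, h2⟩
      exact ⟨by omega, h2⟩
    · rintro ⟨h1, h2⟩
      have := hP.lt_par l (by omega)
      exact ⟨by omega, h2⟩
  rw [h.b_eq i (by omega), hP.ht_eq i (by omega), h1]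
  exact (Finset.sup_inf_distrib_left _ _ c).symm

theorem UpInv.b_le (h : UpInv n c par ht i A B) {j : ℕ} (hj : j < n) : B j ≤ c := by
  rw [h.b_eq j hj]
  exact Finset.sup_le fun l _ => min_le_left _ _

theorem UpInv.b_eq_iff (hP : IsPointerTree n par ht) (h : UpInv n c par ht i A B)
    (hi : i + 1 < n) : B i = c ↔ ¬ ht i < c := by
  rw [h.b_self hP hi]
  omega

/-- The value of i moves to its parent, which is not yet processed, and grows by 1 exactly if i has
height less than c; so the sum over the unprocessed vertices counts the low vertices processed so
far. If B i = c, overwriting B at the parent amounts to taking a maximum, as no value of B exceeds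
c. -/
theorem UpInv.step (hP : IsPointerTree n par ht) (h : UpInv n c par ht i A B) (hi : i + 1 < n) :
    UpInv n c par ht (i + 1)
      (Function.update A (par i) (A i + A (par i) + if B i = c then 0 else 1))
      (Function.update B (par i) (if B i = c then B i else max (B (par i)) (B i + 1))) := by
  have hself := h.b_self hP hi
  have hlt := hP.lt_par i hi
  have hpn := hP.par_lt i hi
  constructor
  · intro j hj
    rw [Finset.range_add_one, Finset.filter_insert]
    by_cases hji : par i = j
    · rw [if_pos hji, Finset.sup_insert, ← h.b_eq j hj, hji, Function.update_self]
      have := h.b_le hj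
      change _ = max (min c (ht i + 1)) (B j)
      split_ifs with hb <;> omega
    · rw [if_neg hji, Function.update_of_ne (Ne.symm hji), h.b_eq j hj]
  · have h1 := h.sum_a
    rw [Finset.sum_eq_sum_Ico_succ_bot (by omega : i < n)] at h1
    have hmem : par i ∈ Finset.Ico (i + 1) n := Finset.mem_Ico.2 ⟨hlt, hpn⟩
    rw [Finset.sum_update_of_mem hmem]
    rw [Finset.sum_eq_add_sum_sdiff_singleton_of_mem hmem] at h1
    have h2 : lowCount c ht (i + 1) = lowCount c ht i + if B i = c then 0 else 1 := by
      rw [lowCount, Finset.range_add_one, Finset.filter_insert]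
      by_cases hc : ht i < c
      · rw [if_pos hc, Finset.card_insert_of_notMem (by simp),
          if_neg (by rw [h.b_eq_iff hP hi]; simpa using hc)]
        rfl
      · rw [if_neg hc, if_pos ((h.b_eq_iff hP hi).2 hc)]
        rfl
    rw [h2]
    omega

theorem UpInv.root (hP : IsPointerTree n par ht) (h : UpInv n c par ht (n - 1) A B) :
    A (n - 1) = lowCount c ht (n - 1) := by
  have h1 := h.sum_a
  have := hP.pos
  rwa [Finset.sum_eq_sum_Ico_succ_bot (by omega : n - 1 < n), Nat.sub_add_cancel this,
    Finset.Ico_self, Finset.sum_empty, add_zero] at h1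

/-- The edges at `x` that join `l` to its parent, for an `l < i` with `c ≤ ht l`. -/
def highAt (c : ℕ) (par ht : ℕ → ℕ) (i x : ℕ) : ℕ :=
  ((Finset.range i).filter fun l => c ≤ ht l ∧ (l = x ∨ par l = x)).card

end Numeric

/-! ### Correctness and running time of the two algorithms. -/

section Algorithms

variable {n k c : ℕ} {par ht : ℕ → ℕ}

/-- The part of the input that the algorithms do not change. -/
def Kept (n k : ℕ) (par : ℕ → ℕ) (s : State) : Prop :=
  s.reg rN = n ∧ s.reg rK = k ∧ s.mem aPar = par

theorem exists_runs_initAB {s : State} (hs : Kept n k par s) :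
    ∃ s' t, Runs initAB s s' t ∧ Kept n k par s' ∧ (∀ j, j < n → s'.mem aA j = 0) ∧
      (∀ j, j < n → s'.mem aB j = 0) ∧ t ≤ (n + 1) * 14 := by
  obtain ⟨s', t, hr, h, ht⟩ := exists_runs_forTo (x := rI) (e := .var rN)
    (p := .seq (.store aA (.var rI) (.lit 0)) (.store aB (.var rI) (.lit 0))) ⟨trivial, trivial⟩ n
    (fun i s => Kept n k par s ∧ s.reg rI = i ∧ (∀ j, j < i → s.mem aA j = 0) ∧
      ∀ j, j < i → s.mem aB j = 0)
    (fun i s h => ⟨h.2.1, h.1.1⟩) (by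
      rintro i s hi ⟨⟨h1, h2, h3⟩, h4, h5, h6⟩
      refine ⟨⟨?_, ?_, ?_⟩, ?_, ?_, ?_⟩
      · simpa [Prog.exec] using h1
      · simpa [Prog.exec] using h2
      · simpa [Prog.exec] using h3
      · simpa [Prog.exec] using h4
      · intro j hj
        have := h5 j
        simp [Prog.exec, Expr.eval, h4, Function.update_apply]
        omega
      · intro j hj
        have := h6 j
        simp [Prog.exec, Expr.eval, h4, Function.update_apply]
        omega)
    (s := s) ⟨hs, by simp, by simp, by simp⟩
  exact ⟨s', t, hr, h.1, h.2.2.1, h.2.2.2, ht⟩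

theorem mergeUp_reg (s : State) : (mergeUp.exec s).reg = s.reg := rfl

theorem mergeUp_mem {b : ℕ} (h1 : b ≠ aA) (h2 : b ≠ aB) (s : State) :
    (mergeUp.exec s).mem b = s.mem b := by
  simp [mergeUp, Prog.exec, h1, h2]

theorem freshUp_reg (s : State) : (freshUp.exec s).reg = s.reg := by
  by_cases h : s.mem aB (s.reg rJ) < s.mem aB (s.reg rI) + 1 <;>
    simp [freshUp, Prog.exec, Expr.eval, Test.Holds, h]

theorem freshUp_mem {b : ℕ} (h1 : b ≠ aA) (h2 : b ≠ aB) (s : State) :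
    (freshUp.exec s).mem b = s.mem b := by
  by_cases h : s.mem aB (s.reg rJ) < s.mem aB (s.reg rI) + 1 <;>
    simp [freshUp, Prog.exec, Expr.eval, Test.Holds, h, h1, h2]

variable {i : ℕ} {s : State}

theorem mergeUp_upInv (hP : IsPointerTree n par ht)
    (h : UpInv n c par ht i (s.mem aA) (s.mem aB)) (hi : i + 1 < n) (hri : s.reg rI = i)
    (hrj : s.reg rJ = par i) (hb : s.mem aB i = c) :
    UpInv n c par ht (i + 1) ((mergeUp.exec s).mem aA) ((mergeUp.exec s).mem aB) := by
  have := h.step hP hi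
  rw [if_pos hb, if_pos hb] at this
  convert this using 1 <;> simp [mergeUp, Prog.exec, Expr.eval, hri, hrj]

theorem freshUp_upInv (hP : IsPointerTree n par ht)
    (h : UpInv n c par ht i (s.mem aA) (s.mem aB)) (hi : i + 1 < n) (hri : s.reg rI = i)
    (hrj : s.reg rJ = par i) (hb : s.mem aB i ≠ c) :
    UpInv n c par ht (i + 1) ((freshUp.exec s).mem aA) ((freshUp.exec s).mem aB) := by
  have := h.step hP hi
  rw [if_neg hb, if_neg hb] at this
  convert this using 1
  · by_cases h2 : s.mem aB (par i) < s.mem aB i + 1 <;>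
      simp [freshUp, Prog.exec, Expr.eval, Test.Holds, hri, hrj, h2]
  · by_cases h2 : s.mem aB (par i) < s.mem aB i + 1
    · simp [freshUp, Prog.exec, Expr.eval, Test.Holds, hri, hrj, h2, max_eq_right h2.le]
    · simp [freshUp, Prog.exec, Expr.eval, Test.Holds, hri, hrj, h2, max_eq_left (not_lt.1 h2)]

theorem exists_runs_algOdd (hP : IsPointerTree n par ht) (hs : Kept n (2 * c + 1) par s) :
    ∃ s' t, Runs algOdd s s' t ∧ s'.reg rOut = lowCount c ht (n - 1) + 1 ∧ t ≤ 300 * n := by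
  have hn := hP.pos
  obtain ⟨s₁, t₁, hr₁, hs₁, hA, hB, ht₁⟩ := exists_runs_initAB hs
  obtain ⟨s₂, t₂, hr₂, ⟨hs₂, hU⟩, ht₂⟩ := exists_runs_forNonRoot
    (p := .ite (.eq (cellI aB) (.half (.sub (.var rK) (.lit 1)))) mergeUp freshUp)
    (by simp [Prog.LoopFree, mergeUp, freshUp]) (n := n)
    (fun i s => Kept n (2 * c + 1) par s ∧ UpInv n c par ht i (s.mem aA) (s.mem aB))
    (fun i s h => h.1.1) (fun i s m h => by simpa [Kept] using h)
    (by
      rintro i s hi hri hrj ⟨⟨h1, h2, h3⟩, hU⟩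
      rw [h3] at hrj
      have hk : (2 * c + 1 - 1) / 2 = c := by omega
      rw [Prog.exec]
      simp only [Test.Holds, Expr.eval, hri, h2, hk]
      split_ifs with hb
      · refine ⟨hri, ⟨h1, h2, ?_⟩, mergeUp_upInv hP hU hi hri hrj hb⟩
        rw [mergeUp_mem (by decide) (by decide), h3]
      · rw [freshUp_reg]
        refine ⟨hri, ⟨?_, ?_, ?_⟩, freshUp_upInv hP hU hi hri hrj hb⟩
        · rw [freshUp_reg, h1]
        · rw [freshUp_reg, h2]
        · rw [freshUp_mem (by decide) (by decide), h3])
    (fun i s m h => by simpa [Kept] using h) hn (s := s₁) ⟨hs₁, UpInv.zero hA hB⟩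
  refine ⟨_, _, hr₁.seq (hr₂.seq (Runs.assign s₂ rOut _)), ?_, ?_⟩
  · have := hU.root hP
    simpa [Expr.eval, hs₂.1] using this
  · simp only [Prog.bound, mergeUp, freshUp, Expr.cost, Test.cost] at ht₂ ⊢
    omega

theorem exists_runs_maxDegS (hP : IsPointerTree n par ht) (hs : Kept n k par s)
    (hS : ∀ i, i + 1 < n → (s.mem aS i = 1 ↔ c ≤ ht i)) :
    ∃ s' t, Runs maxDegS s s' t ∧ Kept n k par s' ∧ s'.mem aA = s.mem aA ∧
      s'.reg rDelta = (Finset.range n).sup (highAt c par ht (n - 1)) ∧ t ≤ 300 * n := by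
  have hn := hP.pos
  obtain ⟨s₁, t₁, hr₁, ⟨hs₁, -, hA₁, hS₁, hD₁⟩, ht₁⟩ := exists_runs_forTo (x := rI) (e := .var rN)
    (p := .store aDeg (.var rI) (.lit 0)) trivial n
    (fun i s' => Kept n k par s' ∧ s'.reg rI = i ∧ s'.mem aA = s.mem aA ∧ s'.mem aS = s.mem aS ∧
      ∀ j, j < i → s'.mem aDeg j = 0)
    (fun i s' h => ⟨h.2.1, h.1.1⟩) (by
      rintro i s' hi ⟨⟨h1, h2, h3⟩, h4, h5, h6, h7⟩
      refine ⟨⟨?_, ?_, ?_⟩, ?_, ?_, ?_, ?_⟩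
      · simpa [Prog.exec] using h1
      · simpa [Prog.exec] using h2
      · simpa [Prog.exec] using h3
      · simpa [Prog.exec] using h4
      · simpa [Prog.exec] using h5
      · simpa [Prog.exec] using h6
      · intro j hj
        have := h7 j
        simp [Prog.exec, Expr.eval, h4, Function.update_apply]
        omega)
    (s := s) ⟨hs, by simp, by simp, by simp, by simp⟩
  obtain ⟨s₂, t₂, hr₂, ⟨hs₂, hA₂, hS₂, hD₂⟩, ht₂⟩ := exists_runs_forNonRoot
    (p := .ite (.eq (cellI aS) (.lit 1))
      (.seq (.store aDeg (.var rI) (.add (cellI aDeg) (.lit 1)))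
        (.store aDeg (.var rJ) (.add (cellJ aDeg) (.lit 1)))) .skip)
    (by simp [Prog.LoopFree]) (n := n)
    (fun i s' => Kept n k par s' ∧ s'.mem aA = s.mem aA ∧ s'.mem aS = s.mem aS ∧
      ∀ x, x < n → s'.mem aDeg x = highAt c par ht i x)
    (fun i s h => h.1.1) (fun i s m h => by simpa [Kept] using h)
    (by
      rintro i s' hi hri hrj ⟨⟨h1, h2, h3⟩, h4, h5, h6⟩
      rw [h3] at hrj
      have hlt := hP.lt_par i hi
      have hH : ∀ x, highAt c par ht (i + 1) x =
          highAt c par ht i x + if c ≤ ht i ∧ (i = x ∨ par i = x) then 1 else 0 := by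
        intro x
        rw [highAt, Finset.range_add_one, Finset.filter_insert]
        split_ifs
        · rw [Finset.card_insert_of_notMem (by simp)]
          rfl
        · rfl
      rw [Prog.exec]
      simp only [Test.Holds, Expr.eval, hri, h5, hS i hi]
      split_ifs with hb
      · refine ⟨hri, ⟨by simpa [Prog.exec] using h1, by simpa [Prog.exec] using h2,
          by simpa [Prog.exec] using h3⟩, by simpa [Prog.exec] using h4,
          by simpa [Prog.exec] using h5, fun x hx => ?_⟩
        rw [hH, ← h6 x hx]
        simp only [Prog.exec, Expr.eval, State.setMem_mem, State.setMem_reg, hri, hrj, if_true,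
          Function.update_apply]
        -- Since i < `par i`, the two increments hit different cells, and each end of the edge gains
        -- exactly 1.
        by_cases hx1 : x = i
        · subst hx1
          simp [hb, hlt.ne]
        · by_cases hx2 : x = par i
          · subst hx2
            simp [hb, hlt.ne']
          · simp [hx1, hx2, Ne.symm hx1, Ne.symm hx2]
      · refine ⟨hri, ⟨h1, h2, h3⟩, h4, h5, fun x hx => ?_⟩
        rw [hH, if_neg fun h => hb h.1, Prog.exec, h6 x hx, add_zero])
    (fun i s m h => by simpa [Kept] using h) hn (s := s₁)
    ⟨hs₁, hA₁, hS₁, fun x hx => by simpa [highAt] using hD₁ x hx⟩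
  obtain ⟨s₃, t₃, hr₃, ⟨hs₃, -, hA₃, -, hM₃⟩, ht₃⟩ := exists_runs_forTo (x := rI) (e := .var rN)
    (p := .ite (.lt (.var rDelta) (cellI aDeg)) (.assign rDelta (cellI aDeg)) .skip)
    (by simp [Prog.LoopFree]) n
    (fun i s' => Kept n k par s' ∧ s'.reg rI = i ∧ s'.mem aA = s.mem aA ∧
      (∀ x, x < n → s'.mem aDeg x = highAt c par ht (n - 1) x) ∧
      s'.reg rDelta = (Finset.range i).sup (highAt c par ht (n - 1)))
    (fun i s' h => ⟨h.2.1, h.1.1⟩) (by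
      rintro i s' hi ⟨⟨h1, h2, h3⟩, h4, h5, h6, h7⟩
      have hsup : (Finset.range (i + 1)).sup (highAt c par ht (n - 1)) =
          max (s'.mem aDeg i) (s'.reg rDelta) := by
        rw [Finset.range_add_one, Finset.sup_insert, h6 i hi, h7]
      rw [Prog.exec]
      simp only [Test.Holds, Expr.eval, h4]
      split_ifs with hb
      · refine ⟨⟨?_, ?_, ?_⟩, ?_, ?_, ?_, ?_⟩
        · simpa [Prog.exec] using h1
        · simpa [Prog.exec] using h2
        · simpa [Prog.exec] using h3
        · simpa [Prog.exec] using h4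
        · simpa [Prog.exec] using h5
        · simpa [Prog.exec] using h6
        · rw [hsup, max_eq_left hb.le]
          simp [Prog.exec, Expr.eval, h4]
      · refine ⟨⟨?_, ?_, ?_⟩, ?_, ?_, ?_, ?_⟩
        · simpa [Prog.exec] using h1
        · simpa [Prog.exec] using h2
        · simpa [Prog.exec] using h3
        · simpa [Prog.exec] using h4
        · simpa [Prog.exec] using h5
        · simpa [Prog.exec] using h6
        · rw [hsup, max_eq_right (not_lt.1 hb)]
          simp [Prog.exec])
    (s := s₂.setReg rDelta 0) ⟨by simpa [Kept] using hs₂, by simp, by simpa using hA₂,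
      by simpa using hD₂, by simp⟩
  refine ⟨s₃, _, hr₁.seq (hr₂.seq ((Runs.assign s₂ rDelta _).seq hr₃)), hs₃, hA₃, hM₃, ?_⟩
  simp only [Prog.bound, Expr.cost, Test.cost] at ht₁ ht₂ ht₃ ⊢
  omega

theorem exists_runs_algEven (hP : IsPointerTree n par ht) (hs : Kept n (2 * c + 2) par s) :
    ∃ s' t, Runs algEven s s' t ∧
      s'.reg rOut = lowCount c ht (n - 1) + (Finset.range n).sup (highAt c par ht (n - 1)) ∧
      t ≤ 700 * n := by
  have hn := hP.pos
  obtain ⟨s₁, t₁, hr₁, hs₁, hA, hB, ht₁⟩ := exists_runs_initAB hs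
  obtain ⟨s₂, t₂, hr₂, ⟨hs₂, -, hA₂, hB₂, hS₂⟩, ht₂⟩ := exists_runs_forTo (x := rI) (e := .var rN)
    (p := .store aS (.var rI) (.lit 0)) trivial n
    (fun i s' => Kept n (2 * c + 2) par s' ∧ s'.reg rI = i ∧ s'.mem aA = s₁.mem aA ∧
      s'.mem aB = s₁.mem aB ∧ ∀ j, j < i → s'.mem aS j = 0)
    (fun i s' h => ⟨h.2.1, h.1.1⟩) (by
      rintro i s' hi ⟨⟨h1, h2, h3⟩, h4, h5, h6, h7⟩
      refine ⟨⟨?_, ?_, ?_⟩, ?_, ?_, ?_, ?_⟩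
      · simpa [Prog.exec] using h1
      · simpa [Prog.exec] using h2
      · simpa [Prog.exec] using h3
      · simpa [Prog.exec] using h4
      · simpa [Prog.exec] using h5
      · simpa [Prog.exec] using h6
      · intro j hj
        have := h7 j
        simp [Prog.exec, Expr.eval, h4, Function.update_apply]
        omega)
    (s := s₁) ⟨hs₁, by simp, by simp, by simp, by simp⟩
  obtain ⟨s₃, t₃, hr₃, ⟨hs₃, hU, hS₃⟩, ht₃⟩ := exists_runs_forNonRoot
    (p := .ite (.eq (cellI aB) (.sub (.half (.var rK)) (.lit 1)))
      (.seq mergeUp (.store aS (.var rI) (.lit 1))) freshUp)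
    (by simp [Prog.LoopFree, mergeUp, freshUp]) (n := n)
    (fun i s => Kept n (2 * c + 2) par s ∧ UpInv n c par ht i (s.mem aA) (s.mem aB) ∧
      ∀ l, l < n → s.mem aS l = if l < i ∧ c ≤ ht l then 1 else 0)
    (fun i s h => h.1.1) (fun i s m h => by simpa [Kept] using h)
    (by
      rintro i s hi hri hrj ⟨⟨h1, h2, h3⟩, hU, h4⟩
      rw [h3] at hrj
      have hbi := hU.b_eq_iff hP hi
      have hk : (2 * c + 2) / 2 - 1 = c := by omega
      rw [Prog.exec]
      simp only [Test.Holds, Expr.eval, hri, h2, hk]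
      split_ifs with hb
      · rw [Prog.exec, Prog.exec]
        refine ⟨hri, ⟨h1, h2, ?_⟩, ?_, fun l hl => ?_⟩
        · rw [State.setMem_mem, if_neg (by decide), mergeUp_mem (by decide) (by decide), h3]
        · rw [State.setMem_mem, State.setMem_mem, if_neg (by decide), if_neg (by decide)]
          exact mergeUp_upInv hP hU hi hri hrj hb
        · rw [State.setMem_mem, if_pos rfl, mergeUp_mem (by decide) (by decide)]
          simp only [Expr.eval, mergeUp_reg, hri, Function.update_apply, h4 l hl]
          rw [hb] at hbi
          have : ¬ ht i < c := hbi.1 rfl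
          by_cases hli : l = i
          · subst hli
            simp; omega
          · rw [if_neg hli]
            congr 1
            simp only [eq_iff_iff]
            omega
      · rw [freshUp_reg]
        refine ⟨hri, ⟨?_, ?_, ?_⟩, freshUp_upInv hP hU hi hri hrj hb, fun l hl => ?_⟩
        · rw [freshUp_reg, h1]
        · rw [freshUp_reg, h2]
        · rw [freshUp_mem (by decide) (by decide), h3]
        · rw [freshUp_mem (by decide) (by decide), h4 l hl]
          congr 1
          simp only [eq_iff_iff]
          have : ht i < c := by
            by_contra hc
            exact hb (hbi.2 hc)
          by_cases hli : l = i
          · subst hli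
            omega
          · omega)
    (fun i s m h => by simpa [Kept] using h) hn (s := s₂)
    ⟨hs₂, UpInv.zero (by rwa [hA₂]) (by rwa [hB₂]), fun l hl => by simpa using hS₂ l hl⟩
  obtain ⟨s₄, t₄, hr₄, hs₄, hA₄, hM₄, ht₄⟩ := exists_runs_maxDegS hP hs₃ (c := c) (by
    intro i hi
    rw [hS₃ i (by omega)]
    have : i < n - 1 := by omega
    by_cases h : c ≤ ht i <;> simp [h, this])
  refine ⟨_, _, hr₁.seq (hr₂.seq (hr₃.seq (hr₄.seq (Runs.assign s₄ rOut _)))), ?_, ?_⟩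
  · have := hU.root hP
    simp [Expr.eval, hs₄.1, hA₄, hM₄, this]
  · simp only [Prog.bound, mergeUp, freshUp, Expr.cost, Test.cost] at ht₂ ht₃ ⊢
    omega

end Algorithms

/-! ### The recursion for the heights of subtrees. -/

section Height

variable {V : Type*} [Fintype V] {T : SimpleGraph V}

open Classical in
/-- The height of the subtree below `v` in the tree `T` rooted at `r`. -/
noncomputable def height (T : SimpleGraph V) (r v : V) : ℕ :=
  (Finset.univ.filter fun u => IsAnc T r v u).sup fun u => T.dist v u

theorem IsAnc.dist_le_height {r v u : V} (h : IsAnc T r v u) : T.dist v u ≤ height T r v :=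
  Finset.le_sup (f := fun u => T.dist v u) (by simpa using h)

theorem exists_dist_eq_height (r v : V) : ∃ u, IsAnc T r v u ∧ T.dist v u = height T r v := by
  classical
  obtain ⟨u, hu, h⟩ := Finset.exists_mem_eq_sup (Finset.univ.filter fun u => IsAnc T r v u)
    ⟨v, by simp [isAnc_refl]⟩ fun u => T.dist v u
  exact ⟨u, by simpa using hu, h.symm⟩

theorem isLow_iff {r v : V} {c : ℕ} : IsLow T r c v ↔ v ≠ r ∧ height T r v < c := by
  refine and_congr_right fun _ => ⟨fun h => ?_, fun h u hu => hu.dist_le_height.trans_lt h⟩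
  obtain ⟨u, hu, hd⟩ := exists_dist_eq_height (T := T) r v
  exact hd ▸ h u hu

theorem height_child_lt (hT : T.IsTree) {r w : V} (hw : w ≠ r) :
    height T r w + 1 ≤ height T r (parent T r w) := by
  obtain ⟨u, hu, hd⟩ := exists_dist_eq_height (T := T) r w
  have h1 := isAnc_parent hT hw
  have h2 := (h1.trans hT hu).dist_le_height
  rw [h1.dist_eq hT hu, hd, dist_eq_one_iff_adj.2 (parent_adj hT hw).symm] at h2
  omega

/-- The child is the first vertex on the way from v to a deepest descendant. With `height_child_lt`
this gives the recursion required by `IsPointerTree`. -/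
theorem exists_child_of_height_pos (hT : T.IsTree) {r v : V} (hv : 0 < height T r v) :
    ∃ w, w ≠ r ∧ parent T r w = v ∧ height T r v ≤ height T r w + 1 := by
  obtain ⟨u, hu, hd⟩ := exists_dist_eq_height (T := T) r v
  obtain ⟨w, hw, hwi⟩ := exists_dist_eq hT v u (i := T.dist v u - 1) (by omega)
  have h1 : IsAnc T r v w ∧ IsAnc T r w u ∧ T.dist v w = 1 := by
    have t1 := hT.1.dist_triangle (u := r) (v := v) (w := w)
    have t2 := hT.1.dist_triangle (u := r) (v := w) (w := u)
    unfold IsAnc at *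
    omega
  obtain ⟨h1, h2, h3⟩ := h1
  have hadj := dist_eq_one_iff_adj.1 h3
  refine ⟨w, ?_, ?_, ?_⟩
  · rintro rfl
    exact hadj.ne (h1.eq_root hT)
  · refine (eq_parent hT hadj.symm ?_).symm
    unfold IsAnc at h1
    omega
  · have := h2.dist_le_height
    omega

end Height

/-! ### From numbered vertices back to the tree. -/

section Bridge

variable {n : ℕ} {T : SimpleGraph (Fin n)}

/-- The vertices of the tree `T` are numbered by `v`, the last one is the root, and `par i` is the
number of the parent of `v i`, which is greater than `i`. -/
structure IsNumbering (T : SimpleGraph (Fin n)) (v : Fin n ≃ Fin n) (root : Fin n)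
    (par : ℕ → ℕ) : Prop where
  last : (root : ℕ) + 1 = n
  par_spec : ∀ i : Fin n, i ≠ root → ∃ j : Fin n, par i = j ∧ i < j ∧
    v j = parent T (v root) (v i)

/-- The heights of the subtrees, by number. -/
noncomputable def heightAt (T : SimpleGraph (Fin n)) (v : Fin n ≃ Fin n) (root : Fin n) (i : ℕ) : ℕ :=
  if h : i < n then height T (v root) (v ⟨i, h⟩) else 0

variable {v : Fin n ≃ Fin n} {root : Fin n} {par : ℕ → ℕ} {c : ℕ}

theorem heightAt_coe (i : Fin n) : heightAt T v root i = height T (v root) (v i) :=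
  dif_pos i.2

theorem IsNumbering.ne_root (h : IsNumbering T v root par) {i : Fin n} :
    i ≠ root ↔ (i : ℕ) < n - 1 := by
  have := h.last
  have := i.2
  rw [Ne, Fin.ext_iff]
  omega

theorem IsNumbering.isPointerTree (hT : T.IsTree) (h : IsNumbering T v root par) :
    IsPointerTree n par (heightAt T v root) := by
  have hlast := h.last
  refine ⟨by omega, ?_, ?_, ?_⟩
  · intro i hi
    obtain ⟨j, h1, h2, -⟩ := h.par_spec ⟨i, by omega⟩ (h.ne_root.2 (by simp; omega))
    rw [Fin.lt_def] at h2
    simp only at h1 h2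
    omega
  · intro i hi
    obtain ⟨j, h1, -, -⟩ := h.par_spec ⟨i, by omega⟩ (h.ne_root.2 (by simp; omega))
    simp only at h1
    exact h1 ▸ j.2
  · intro j hj
    obtain ⟨j, rfl⟩ : ∃ j' : Fin n, (j' : ℕ) = j := ⟨⟨j, hj⟩, rfl⟩
    rw [heightAt_coe]
    refine le_antisymm ?_ (Finset.sup_le fun i hi => ?_)
    · by_cases hpos : 0 < height T (v root) (v j)
      · obtain ⟨w, hw, hwj, hle⟩ := exists_child_of_height_pos hT hpos
        obtain ⟨i, rfl⟩ := v.surjective w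
        have hi : i ≠ root := fun h' => hw (h' ▸ rfl)
        obtain ⟨j', h1, -, h2⟩ := h.par_spec i hi
        rw [hwj] at h2
        rw [v.injective h2] at h1
        refine hle.trans ?_
        rw [← heightAt_coe]
        refine Finset.le_sup (f := fun i => heightAt T v root i + 1) ?_
        rw [Finset.mem_filter, Finset.mem_range]
        exact ⟨h.ne_root.1 hi, h1⟩
      · omega
    · rw [Finset.mem_filter, Finset.mem_range] at hi
      obtain ⟨i, rfl⟩ : ∃ i' : Fin n, (i' : ℕ) = i := ⟨⟨i, by omega⟩, rfl⟩
      have hir := h.ne_root.2 hi.1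
      obtain ⟨j', h1, -, h2⟩ := h.par_spec i hir
      have hjj : j' = j := Fin.ext (h1.symm.trans hi.2)
      rw [heightAt_coe, ← hjj, h2]
      exact height_child_lt hT fun h' => hir (v.injective h')

/-- The range n - 1 leaves out the number of the root, and the root is never low. -/
theorem IsNumbering.lowCount_eq (h : IsNumbering T v root par) :
    lowCount c (heightAt T v root) (n - 1) = lowCard T (v root) c := by
  classical
  symm
  refine Finset.card_bij (fun x _ => (v.symm x : ℕ)) ?_ ?_ ?_
  · intro x hx
    obtain ⟨i, rfl⟩ := v.surjective x
    rw [Finset.mem_filter, isLow_iff] at hx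
    rw [v.symm_apply_apply, Finset.mem_filter, Finset.mem_range, heightAt_coe, ← h.ne_root]
    exact ⟨fun h' => hx.2.1 (h' ▸ rfl), hx.2.2⟩
  · intro x _ y _ hxy
    exact v.symm.injective (Fin.ext hxy)
  · intro i hi
    rw [Finset.mem_filter, Finset.mem_range] at hi
    obtain ⟨i, rfl⟩ : ∃ i' : Fin n, (i' : ℕ) = i := ⟨⟨i, by omega⟩, rfl⟩
    rw [heightAt_coe, ← h.ne_root] at hi
    refine ⟨v i, ?_, by simp⟩
    rw [Finset.mem_filter, isLow_iff]
    exact ⟨Finset.mem_univ _, fun h' => hi.1 (v.injective h'), hi.2⟩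

theorem IsNumbering.highAt_eq (h : IsNumbering T v root par) (x : Fin n) :
    highAt c par (heightAt T v root) (n - 1) x = (highStar T (v root) c (v x)).card := by
  classical
  have key : ∀ i : Fin n, i ≠ root → (parent T (v root) (v i) = v x ↔ par i = x) := by
    intro i hi
    obtain ⟨j, h1, -, h2⟩ := h.par_spec i hi
    rw [← h2, h1, v.injective.eq_iff, Fin.ext_iff]
  symm
  refine Finset.card_bij (fun x _ => (v.symm x : ℕ)) ?_ ?_ ?_
  · intro w hw
    obtain ⟨i, rfl⟩ := v.surjective w
    rw [mem_highStar, isLow_iff] at hw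
    have hi : i ≠ root := fun h' => hw.1 (h' ▸ rfl)
    rw [key i hi, v.injective.eq_iff, Fin.ext_iff] at hw
    rw [v.symm_apply_apply, Finset.mem_filter, Finset.mem_range, heightAt_coe, ← h.ne_root]
    refine ⟨hi, ?_, hw.2.2⟩
    by_contra hc
    exact hw.2.1 ⟨hw.1, by omega⟩
  · intro x _ y _ hxy
    exact v.symm.injective (Fin.ext hxy)
  · intro i hi
    rw [Finset.mem_filter, Finset.mem_range] at hi
    obtain ⟨i, rfl⟩ : ∃ i' : Fin n, (i' : ℕ) = i := ⟨⟨i, by omega⟩, rfl⟩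
    rw [heightAt_coe, ← h.ne_root] at hi
    refine ⟨v i, ?_, by simp⟩
    rw [mem_highStar, isLow_iff, key i hi.1, v.injective.eq_iff, Fin.ext_iff]
    exact ⟨fun h' => hi.1 (v.injective h'), fun h' => absurd h'.2 (not_lt.2 hi.2.1), hi.2.2⟩

theorem IsNumbering.sup_highAt_eq (h : IsNumbering T v root par) :
    (Finset.range n).sup (highAt c par (heightAt T v root) (n - 1)) =
      highDegree T (v root) c := by
  refine le_antisymm (Finset.sup_le fun x hx => ?_) (Finset.sup_le fun x _ => ?_)
  · rw [Finset.mem_range] at hx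
    exact (h.highAt_eq ⟨x, hx⟩).trans_le (card_highStar_le _ _ _)
  · obtain ⟨i, rfl⟩ := v.surjective x
    rw [← h.highAt_eq]
    exact Finset.le_sup (f := highAt c par (heightAt T v root) (n - 1))
      (Finset.mem_range.2 i.2)

theorem HoldsRooted.exists_numbering (hT : T.IsTree) {k : ℕ} {s : State}
    (hs : HoldsRooted T k v s) :
    ∃ root, IsGoodRoot T k (v root) ∧ IsNumbering T v root (s.mem aPar) ∧
      Kept n k (s.mem aPar) s := by
  obtain ⟨h1, h2, root, h3, h4, h5⟩ := hs
  refine ⟨root, h4, ⟨h3, fun i hi => ?_⟩, h1, h2, rfl⟩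
  obtain ⟨j, hj, hij, hadj, hd⟩ := h5 i hi
  refine ⟨j, hj, hij, eq_parent hT hadj ?_⟩
  rwa [T.dist_comm (u := v root), T.dist_comm (u := v root)]

theorem HoldsRooted.exists_runs_odd (hT : T.IsTree) {k : ℕ} {s : State}
    (hs : HoldsRooted T k v s) (hk : k ≤ T.diam) (hodd : Odd k) :
    ∃ s' t, Runs algOdd s s' t ∧ s'.reg rOut = cc T k ∧ t ≤ 300 * n := by
  obtain ⟨c, rfl⟩ := hodd
  obtain ⟨root, hr, hnum, hkept⟩ := hs.exists_numbering hT
  obtain ⟨s', t, hrun, hout, ht⟩ := exists_runs_algOdd (hnum.isPointerTree hT) hkept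
  exact ⟨s', t, hrun, by rw [hout, (cc_of_odd hT hk hr).1, hnum.lowCount_eq], ht⟩

theorem HoldsRooted.exists_runs_even (hT : T.IsTree) {k : ℕ} {s : State}
    (hs : HoldsRooted T k v s) (hk : k ≤ T.diam) (hpos : 1 ≤ k) (heven : Even k) :
    ∃ s' t, Runs algEven s s' t ∧ s'.reg rOut = cc T k ∧ t ≤ 700 * n := by
  obtain ⟨c, rfl⟩ : ∃ c, k = 2 * c + 2 := by
    obtain ⟨c, rfl⟩ := heven
    exact ⟨c - 1, by omega⟩
  obtain ⟨root, hr, hnum, hkept⟩ := hs.exists_numbering hT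
  obtain ⟨s', t, hrun, hout, ht⟩ := exists_runs_algEven (hnum.isPointerTree hT) hkept
  exact ⟨s', t, hrun, by
    rw [hout, (cc_of_even hT hk hr).1, hnum.lowCount_eq, hnum.sup_highAt_eq], ht⟩

end Bridge

/-! ### The queue of a breadth-first search in a tree. -/

section Queue

variable {n : ℕ} {T : SimpleGraph (Fin n)}

/-- The vertices `q 0, …, q (tail - 1)` are found by a breadth-first search of the tree `T` from
`src`, `P t` is the position of the parent of `q t`, and the children of `q i` are being found. -/
structure BfsTree (T : SimpleGraph (Fin n)) (src : Fin n) (q : ℕ → Fin n) (P : ℕ → ℕ)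
    (i tail : ℕ) : Prop where
  tail_pos : 0 < tail
  q_zero : q 0 = src
  P_zero : P 0 = 0
  inj : ∀ a < tail, ∀ b < tail, q a = q b → a = b
  par : ∀ t, 0 < t → t < tail → P t < t ∧ T.Adj (q t) (q (P t)) ∧
    T.dist src (q t) = T.dist src (q (P t)) + 1
  mono : ∀ a b, a ≤ b → b < tail → P a ≤ P b
  P_le : ∀ t < tail, P t ≤ i

variable {src : Fin n} {q : ℕ → Fin n} {P : ℕ → ℕ} {i tail : ℕ}

theorem BfsTree.tail_le (h : BfsTree T src q P i tail) : tail ≤ n := by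
  have := Fintype.card_le_of_injective (fun t : Fin tail => q t)
    fun a b hab => Fin.ext (h.inj a a.2 b b.2 hab)
  simpa using this

/-- The queue serves parents in order, so the parents of two queued vertices are in the same order
as the vertices, and induction on the later position applies. -/
theorem BfsTree.dist_mono (h : BfsTree T src q P i tail) {a b : ℕ} (hab : a ≤ b) (hb : b < tail) :
    T.dist src (q a) ≤ T.dist src (q b) := by
  induction b using Nat.strong_induction_on generalizing a with
  | _ b ih =>
    rcases Nat.eq_zero_or_pos a with rfl | ha
    · rw [h.q_zero, SimpleGraph.dist_self]
      exact Nat.zero_le _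
    · obtain ⟨-, -, h1⟩ := h.par a ha (by omega)
      obtain ⟨h2, -, h3⟩ := h.par b (by omega) hb
      rw [h1, h3]
      exact Nat.succ_le_succ (ih (P b) h2 (h.mono a b hab hb) (by omega))

/-- A neighbor of `q i` that is not its parent is farther away from the source. -/
theorem BfsTree.dist_neighbor (hT : T.IsTree) (h : BfsTree T src q P i tail) (hi : i < tail)
    {w : Fin n} (hadj : T.Adj (q i) w) (hw : w ≠ q (P i)) :
    T.dist src w = T.dist src (q i) + 1 := by
  rcases hT.dist_eq_dist_add_one_of_adj src hadj with hd | hd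
  · rcases Nat.eq_zero_or_pos i with rfl | hi0
    · rw [h.q_zero, SimpleGraph.dist_self] at hd
      omega
    · obtain ⟨-, h1, h2⟩ := h.par i hi0 hi
      exact absurd (parent_unique hT hadj hd h1 h2) hw
  · exact hd

/-- No marks for visited vertices are needed. A neighbor of q i other than its parent is a child of
q i, and a child has no other parent, so it can only have been queued while q i was scanned. -/
theorem BfsTree.ne_of_new (hT : T.IsTree) (h : BfsTree T src q P i tail) (hi : i < tail)
    {w : Fin n} (hadj : T.Adj (q i) w) (hw : w ≠ q (P i))
    (hnew : ∀ t, 0 < t → t < tail → P t = i → q t ≠ w) : ∀ t < tail, q t ≠ w := by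
  rintro t ht rfl
  have hd := h.dist_neighbor hT hi hadj hw
  rcases Nat.eq_zero_or_pos t with rfl | ht0
  · rw [h.q_zero, SimpleGraph.dist_self] at hd
    omega
  · obtain ⟨h1, h2, h3⟩ := h.par t ht0 ht
    have := parent_unique hT h2 h3 hadj.symm hd
    exact hnew t ht0 ht (h.inj _ (by omega) _ hi this) rfl

theorem BfsTree.push (hT : T.IsTree) (h : BfsTree T src q P i tail) (hi : i < tail)
    {w : Fin n} (hadj : T.Adj (q i) w) (hw : w ≠ q (P i))
    (hnew : ∀ t, 0 < t → t < tail → P t = i → q t ≠ w) :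
    BfsTree T src (Function.update q tail w) (Function.update P tail i) i (tail + 1) := by
  have hd := h.dist_neighbor hT hi hadj hw
  have hne := h.ne_of_new hT hi hadj hw hnew
  have hq : ∀ t, t < tail → Function.update q tail w t = q t := fun t ht =>
    Function.update_of_ne ht.ne _ _
  have hP : ∀ t, t < tail → Function.update P tail i t = P t := fun t ht =>
    Function.update_of_ne ht.ne _ _
  have h0 := h.tail_pos
  constructor
  · omega
  · rw [hq 0 h0, h.q_zero]
  · rw [hP 0 h0, h.P_zero]
  · intro a ha b hb hab
    rcases Nat.lt_succ_iff_lt_or_eq.1 ha with ha | rfl <;>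
      rcases Nat.lt_succ_iff_lt_or_eq.1 hb with hb | rfl
    · rw [hq a ha, hq b hb] at hab
      exact h.inj a ha b hb hab
    · rw [hq a ha, Function.update_self] at hab
      exact absurd hab (hne a ha)
    · rw [hq b hb, Function.update_self] at hab
      exact absurd hab.symm (hne b hb)
    · rfl
  · intro t ht0 ht
    rcases Nat.lt_succ_iff_lt_or_eq.1 ht with ht | rfl
    · obtain ⟨h1, h2, h3⟩ := h.par t ht0 ht
      rw [hP t ht, hq t ht, hq _ (h1.trans ht)]
      exact ⟨h1, h2, h3⟩
    · rw [Function.update_self, Function.update_self, hq i hi]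
      exact ⟨hi, hadj.symm, hd⟩
  · intro a b hab hb
    rcases Nat.lt_succ_iff_lt_or_eq.1 hb with hb | rfl
    · rw [hP a (by omega), hP b hb]
      exact h.mono a b hab hb
    · rcases hab.lt_or_eq with ha | rfl
      · rw [hP a ha, Function.update_self]
        exact h.P_le a ha
      · exact le_rfl
  · intro t ht
    rcases Nat.lt_succ_iff_lt_or_eq.1 ht with ht | rfl
    · rw [hP t ht]
      exact h.P_le t ht
    · rw [Function.update_self]

theorem BfsTree.next (h : BfsTree T src q P i tail) : BfsTree T src q P (i + 1) tail :=
  ⟨h.tail_pos, h.q_zero, h.P_zero, h.inj, h.par, h.mono, fun t ht => (h.P_le t ht).trans (by omega)⟩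

theorem BfsTree.surj_of_closed (hT : T.IsTree) (h : BfsTree T src q P i tail)
    (hc : ∀ j < tail, ∀ w, T.Adj (q j) w → ∃ t < tail, q t = w) (w : Fin n) :
    ∃ t < tail, q t = w := by
  obtain ⟨p⟩ := hT.1.preconnected src w
  have key : ∀ {u w : Fin n} (p : T.Walk u w), (∃ t < tail, q t = u) → ∃ t < tail, q t = w := by
    intro u w p
    induction p with
    | nil => exact id
    | cons hadj p ih =>
      rintro ⟨t, ht, rfl⟩
      exact ih (hc t ht _ hadj)
  exact key p ⟨0, h.tail_pos, h.q_zero⟩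

theorem le_tail_of_surj (h : ∀ w, ∃ t < tail, q t = w) : n ≤ tail := by
  have := Fintype.card_le_of_surjective (fun t : Fin tail => q t) fun w => by
    obtain ⟨t, ht, rfl⟩ := h w
    exact ⟨⟨t, ht⟩, rfl⟩
  simpa using this

end Queue

/-! ### Breadth-first search on the machine. -/

section Bfs

/-- the number of vertices in the queue -/
abbrev rTail : ℕ := 7
/-- the current position in the adjacency lists -/
abbrev rPos : ℕ := 8
/-- the source of the search -/
abbrev rSrc : ℕ := 9
/-- the queue -/
abbrev aQueue : ℕ := 7
/-- the positions of the parents in the queue -/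
abbrev aUp : ℕ := 8
/-- the distances from the source -/
abbrev aDist : ℕ := 9

/-- Append the current neighbor of the current vertex to the queue, unless it is its parent. -/
def bfsScan : Prog :=
  .seq
    (.ite (.eq (.get aNbr (.var rPos)) (.get aQueue (.get aUp (.var rI)))) .skip
      (.seq (.store aQueue (.var rTail) (.get aNbr (.var rPos)))
        (.seq (.store aUp (.var rTail) (.var rI))
          (.seq (.store aDist (.var rTail) (.add (.get aDist (.var rI)) (.lit 1)))
            (.assign rTail (.add (.var rTail) (.lit 1)))))))
    (.assign rPos (.add (.var rPos) (.lit 1)))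

/-- Append the children of the current vertex to the queue. -/
def bfsExpand : Prog :=
  .seq (.assign rPos (.get aOff (cellI aQueue)))
    (.loop (.lt (.var rPos) (.get aOff (.add (cellI aQueue) (.lit 1)))) bfsScan)

/-- Breadth-first search from `rSrc` in a tree. -/
def bfs : Prog :=
  .seq
    (.seq (.store aQueue (.lit 0) (.var rSrc))
      (.seq (.store aUp (.lit 0) (.lit 0))
        (.seq (.store aDist (.lit 0) (.lit 0))
          (.seq (.assign rTail (.lit 1)) (.assign rI (.lit 0))))))
    (.loop (.lt (.var rI) (.var rTail))
      (.seq bfsExpand (.assign rI (.add (.var rI) (.lit 1)))))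

/-- The adjacency lists of `T`. -/
def IsAdjLists {n : ℕ} (T : SimpleGraph (Fin n)) (off nbr : ℕ → ℕ) : Prop :=
  ∀ v : Fin n, off v ≤ off (v + 1) ∧
    Set.BijOn nbr (Set.Ico (off v) (off (v + 1))) {w : ℕ | ∃ h : w < n, T.Adj v ⟨w, h⟩}

variable {n : ℕ} {T : SimpleGraph (Fin n)}

/-- The state `s` during the breadth-first search from `src` that started in the state `s₀`, while
the children of the vertex at position `i` in the queue are being found. -/
structure BfsState (T : SimpleGraph (Fin n)) (src : Fin n) (s₀ : State) (q : ℕ → Fin n)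
    (i tail : ℕ) (s : State) : Prop where
  reg_eq : ∀ x, x ≠ rI → x ≠ rTail → x ≠ rPos → s.reg x = s₀.reg x
  off_eq : s.mem aOff = s₀.mem aOff
  nbr_eq : s.mem aNbr = s₀.mem aNbr
  reg_i : s.reg rI = i
  reg_tail : s.reg rTail = tail
  tree : BfsTree T src q (s.mem aUp) i tail
  le_tail : i ≤ tail
  queue_eq : ∀ t < tail, s.mem aQueue t = q t
  dist_eq : ∀ t < tail, s.mem aDist t = T.dist src (q t)
  closed : ∀ j < i, ∀ w, T.Adj (q j) w → ∃ t < tail, q t = w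

variable {src : Fin n} {s₀ s : State} {q : ℕ → Fin n} {i tail : ℕ}

theorem BfsState.setPos (h : BfsState T src s₀ q i tail s) (m : ℕ) :
    BfsState T src s₀ q i tail (s.setReg rPos m) :=
  ⟨fun x h1 h2 h3 => by simp [h3, h.reg_eq x h1 h2 h3], h.off_eq, h.nbr_eq, by simp [h.reg_i],
    by simp [h.reg_tail], h.tree, h.le_tail, h.queue_eq, h.dist_eq, h.closed⟩

theorem bfsScan_loopFree : bfsScan.LoopFree := by simp [bfsScan, Prog.LoopFree]

theorem BfsState.scan_skip (h : BfsState T src s₀ q i tail s) (hi : i < tail)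
    (hw : s.mem aNbr (s.reg rPos) = q (s.mem aUp i)) :
    bfsScan.exec s = s.setReg rPos (s.reg rPos + 1) := by
  have hP : s.mem aUp i < tail := by
    -- The source is recorded as its own parent, at position 0.
    rcases Nat.eq_zero_or_pos i with rfl | h0
    · rw [h.tree.P_zero]; exact hi
    · exact (h.tree.par i h0 hi).1.trans hi
  simp [bfsScan, Prog.exec, Test.Holds, Expr.eval, h.reg_i, h.queue_eq _ hP, hw]

theorem BfsState.scan_push (hT : T.IsTree) (h : BfsState T src s₀ q i tail s) (hi : i < tail)
    {w : Fin n} (hw : s.mem aNbr (s.reg rPos) = w) (hadj : T.Adj (q i) w)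
    (hne : w ≠ q (s.mem aUp i))
    (hnew : ∀ t, 0 < t → t < tail → s.mem aUp t = i → q t ≠ w) :
    BfsState T src s₀ (Function.update q tail w) i (tail + 1) (bfsScan.exec s) ∧
      (bfsScan.exec s).reg rPos = s.reg rPos + 1 ∧
      (bfsScan.exec s).mem aUp = Function.update (s.mem aUp) tail i := by
  have hP : s.mem aUp i < tail := by
    rcases Nat.eq_zero_or_pos i with rfl | h0
    · rw [h.tree.P_zero]; exact hi
    · exact (h.tree.par i h0 hi).1.trans hi
  have hne' : ¬ (w : ℕ) = (q (s.mem aUp i) : ℕ) := fun h' => hne (Fin.ext h')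
  have hup : (bfsScan.exec s).mem aUp = Function.update (s.mem aUp) tail i := by
    simp [bfsScan, Prog.exec, Test.Holds, Expr.eval, h.reg_i, h.queue_eq _ hP, hw, hne',
      h.reg_tail]
  refine ⟨⟨?_, ?_, ?_, ?_, ?_, ?_, ?_, ?_, ?_, ?_⟩, ?_, hup⟩
  · intro x h1 h2 h3
    rw [← h.reg_eq x h1 h2 h3]
    simp [bfsScan, Prog.exec, Test.Holds, Expr.eval, h.reg_i, h.queue_eq _ hP, hw, hne', h2, h3]
  · rw [← h.off_eq]
    simp [bfsScan, Prog.exec, Test.Holds, Expr.eval, h.reg_i, h.queue_eq _ hP, hw, hne']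
  · rw [← h.nbr_eq]
    simp [bfsScan, Prog.exec, Test.Holds, Expr.eval, h.reg_i, h.queue_eq _ hP, hw, hne']
  · simp [bfsScan, Prog.exec, Test.Holds, Expr.eval, h.reg_i, h.queue_eq _ hP, hw, hne']
  · simp [bfsScan, Prog.exec, Test.Holds, Expr.eval, h.reg_i, h.queue_eq _ hP, hw, hne',
      h.reg_tail]
  · rw [hup]
    exact h.tree.push hT hi hadj hne hnew
  · omega
  · intro t ht
    have : (bfsScan.exec s).mem aQueue = Function.update (s.mem aQueue) tail w := by
      simp [bfsScan, Prog.exec, Test.Holds, Expr.eval, h.reg_i, h.queue_eq _ hP, hw, hne',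
        h.reg_tail]
    rw [this]
    rcases Nat.lt_succ_iff_lt_or_eq.1 ht with ht | rfl
    · rw [Function.update_of_ne ht.ne, Function.update_of_ne ht.ne, h.queue_eq t ht]
    · rw [Function.update_self, Function.update_self]
  · intro t ht
    have : (bfsScan.exec s).mem aDist =
        Function.update (s.mem aDist) tail (T.dist src (q i) + 1) := by
      simp [bfsScan, Prog.exec, Test.Holds, Expr.eval, h.reg_i, h.queue_eq _ hP, hw, hne',
        h.reg_tail, h.dist_eq i hi]
    rw [this]
    rcases Nat.lt_succ_iff_lt_or_eq.1 ht with ht | rfl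
    · rw [Function.update_of_ne ht.ne, Function.update_of_ne ht.ne, h.dist_eq t ht]
    · rw [Function.update_self, Function.update_self]
      exact (h.tree.dist_neighbor hT hi hadj hne).symm
  · intro j hj w' hw'
    rw [Function.update_of_ne (hj.trans hi).ne] at hw'
    obtain ⟨t, ht, rfl⟩ := h.closed j hj w' hw'
    exact ⟨t, by omega, Function.update_of_ne ht.ne _ _⟩
  · simp [bfsScan, Prog.exec, Test.Holds, Expr.eval, h.reg_i, h.queue_eq _ hP, hw, hne']

/-- The time bound is amortized: scanning a list of d neighbors costs at most 60d steps plus a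
constant and appends at least d - 1 vertices, as only the parent is skipped. -/
theorem BfsState.exists_runs_expand (hT : T.IsTree)
    (hG : IsAdjLists T (s₀.mem aOff) (s₀.mem aNbr)) (h : BfsState T src s₀ q i tail s)
    (hi : i < tail) (hnone : ∀ t, 0 < t → t < tail → s.mem aUp t < i) :
    ∃ s' t q' tail', Runs bfsExpand s s' t ∧ BfsState T src s₀ q' i tail' s' ∧
      (∀ w, T.Adj (q' i) w → ∃ t < tail', q' t = w) ∧ t + 100 * tail ≤ 100 * tail' + 200 := by
  obtain ⟨hle, hbij⟩ := hG (q i)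
  set a := s₀.mem aOff (q i) with ha
  set b := s₀.mem aOff (q i + 1) with hb
  obtain ⟨s', t, hr, ⟨q', tail', h', hqi, hpos, hfound, -, hcount, ht⟩⟩ := exists_runs_loop
    (c := .lt (.var rPos) (.get aOff (.add (cellI aQueue) (.lit 1)))) (p := bfsScan) (b - a)
    (fun m s' t => ∃ (q' : ℕ → Fin n) (tail' : ℕ), BfsState T src s₀ q' i tail' s' ∧ q' i = q i ∧
      s'.reg rPos = a + m ∧
      (∀ e, a ≤ e → e < a + m → ∃ t < tail', (q' t : ℕ) = s₀.mem aNbr e) ∧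
      (∀ t, 0 < t → t < tail' → s'.mem aUp t = i →
        ∃ e, a ≤ e ∧ e < a + m ∧ (q' t : ℕ) = s₀.mem aNbr e) ∧
      -- At most one of the first m entries was skipped, and none as long as the parent has not come
      -- up.
      (m + tail ≤ tail' + 1 ∧ i < tail' ∧
        ((∀ e, a ≤ e → e < a + m → s₀.mem aNbr e ≠ q' (s'.mem aUp i)) → m + tail ≤ tail')) ∧
      t ≤ 60 * m)
    (by
      rintro m s' t hm ⟨q', tail', h', hqi, hpos, hfound, hold, ⟨hc1, hi', hc2⟩, ht⟩
      have hQi := h'.queue_eq i hi'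
      have hmem : a + m ∈ Set.Ico a b := ⟨by omega, by omega⟩
      obtain ⟨hwn, hadj⟩ := hbij.mapsTo hmem
      refine ⟨?_, ?_⟩
      · simp only [Test.Holds, Expr.eval, hpos, h'.reg_i, hQi, hqi, h'.off_eq, ← hb]
        omega
      · obtain ⟨t', hr', ht'⟩ := bfsScan_loopFree.runs s'
        refine ⟨_, t', hr', ?_⟩
        have hw : s'.mem aNbr (s'.reg rPos) = s₀.mem aNbr (a + m) := by rw [hpos, h'.nbr_eq]
        have htime : t + ((Test.lt (.var rPos)
            (.get aOff (.add (cellI aQueue) (.lit 1)))).cost + 1 + t') ≤ 60 * (m + 1) := by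
          simp only [bfsScan, Prog.bound, Expr.cost, Test.cost] at ht' ⊢
          omega
        by_cases hpar : s₀.mem aNbr (a + m) = q' (s'.mem aUp i)
        · have hex := h'.scan_skip hi' (by rw [hw, hpar])
          rw [hex, hpos]
          refine ⟨q', tail', h'.setPos _, hqi, by simp [add_assoc], ?_, ?_, ?_, htime⟩
          · intro e he1 he2
            rcases Nat.lt_or_eq_of_le (by omega : e ≤ a + m) with he | rfl
            · exact hfound e he1 he
            · refine ⟨s'.mem aUp i, ?_, hpar.symm⟩
              rcases Nat.eq_zero_or_pos i with h0 | h0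
              · rw [h0, h'.tree.P_zero]
                exact h'.tree.tail_pos
              · exact (h'.tree.par i h0 hi').1.trans hi'
          · intro t ht0 ht1 hti
            obtain ⟨e, he1, he2, he3⟩ := hold t ht0 ht1 hti
            exact ⟨e, he1, by omega, he3⟩
          -- The parent occurs only once in the list, so nothing was skipped before.
          · have hc3 := hc2 fun e he1 he2 he3 => by
              have := hbij.injOn (⟨he1, by omega⟩ : e ∈ Set.Ico a b) hmem (he3.trans hpar.symm)
              omega
            refine ⟨by omega, hi', fun hno => ?_⟩
            exact absurd hpar (hno (a + m) (by omega) (by omega))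
        · have hnew : ∀ t, 0 < t → t < tail' → s'.mem aUp t = i →
              q' t ≠ ⟨s₀.mem aNbr (a + m), hwn⟩ := by
            intro t ht0 ht1 hti heq
            obtain ⟨e, he1, he2, he3⟩ := hold t ht0 ht1 hti
            rw [heq] at he3
            have := hbij.injOn hmem (⟨he1, by omega⟩ : e ∈ Set.Ico a b) he3
            omega
          obtain ⟨h'', hpos'', hup⟩ := h'.scan_push hT hi' (w := ⟨s₀.mem aNbr (a + m), hwn⟩) hw
            (by rw [hqi]; exact hadj) (fun heq => hpar (congrArg Fin.val heq)) hnew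
          have hq : ∀ t, t < tail' →
              Function.update q' tail' ⟨s₀.mem aNbr (a + m), hwn⟩ t = q' t := fun t ht =>
            Function.update_of_ne ht.ne _ _
          refine ⟨_, _, h'', by rw [hq i hi', hqi], by rw [hpos'', hpos, add_assoc], ?_, ?_, ?_,
            htime⟩
          · intro e he1 he2
            rcases Nat.lt_or_eq_of_le (by omega : e ≤ a + m) with he | rfl
            · obtain ⟨t, ht0, hte⟩ := hfound e he1 he
              exact ⟨t, by omega, by rw [hq t ht0, hte]⟩
            · exact ⟨tail', by omega, by rw [Function.update_self]⟩
          · intro t ht0 ht1 hti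
            rcases Nat.lt_succ_iff_lt_or_eq.1 ht1 with ht1 | rfl
            · rw [hup, Function.update_of_ne ht1.ne] at hti
              obtain ⟨e, he1, he2, he3⟩ := hold t ht0 ht1 hti
              exact ⟨e, he1, by omega, by rw [hq t ht1, he3]⟩
            · exact ⟨a + m, by omega, by omega, by rw [Function.update_self]⟩
          · refine ⟨by omega, by omega, fun hno => ?_⟩
            have := hc2 fun e he1 he2 he3 => hno e he1 (by omega) (by
              rw [hup, Function.update_of_ne hi'.ne, hq, he3]
              rcases Nat.eq_zero_or_pos i with h0 | h0
              · rw [h0, h'.tree.P_zero]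
                exact h'.tree.tail_pos
              · exact (h'.tree.par i h0 hi').1.trans hi')
            omega)
    (by
      rintro s' t ⟨q', tail', h', hqi, hpos, -, -, ⟨-, hi', -⟩, -⟩
      simp only [Test.Holds, Expr.eval, hpos, h'.reg_i, h'.queue_eq i hi', hqi, h'.off_eq, ← hb]
      omega)
    (s := s.setReg rPos a)
    ⟨q, tail, h.setPos _, rfl, by simp, fun e h1 h2 => by omega, fun t h1 h2 h3 =>
      absurd h3 (hnone t h1 h2).ne, ⟨by omega, hi, fun _ => by omega⟩, le_rfl⟩
  have hassign : (Expr.get aOff (cellI aQueue)).eval s = a := by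
    simp [Expr.eval, h.reg_i, h.queue_eq i hi, h.off_eq, ← ha]
  have hr₀ := Runs.assign s rPos (.get aOff (cellI aQueue))
  rw [hassign] at hr₀
  refine ⟨s', _, q', tail', hr₀.seq hr, h', fun w hw => ?_, ?_⟩
  · rw [hqi] at hw
    obtain ⟨e, ⟨he1, he2⟩, he3⟩ := hbij.surjOn (⟨w.2, hw⟩ : (w : ℕ) ∈ {w : ℕ | ∃ h : w < n, _})
    obtain ⟨t, ht0, hte⟩ := hfound e he1 (by omega)
    exact ⟨t, ht0, Fin.ext (hte.trans he3)⟩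
  · simp only [Expr.cost, Test.cost]
    omega

/-- The final state `s` of a breadth-first search of `T` from `src`. -/
structure BfsDone (T : SimpleGraph (Fin n)) (src : Fin n) (s₀ : State) (q : ℕ → Fin n)
    (s : State) : Prop where
  reg_eq : ∀ x, x ≠ rI → x ≠ rTail → x ≠ rPos → s.reg x = s₀.reg x
  off_eq : s.mem aOff = s₀.mem aOff
  nbr_eq : s.mem aNbr = s₀.mem aNbr
  tree : BfsTree T src q (s.mem aUp) n n
  surj : ∀ w, ∃ t < n, q t = w
  queue_eq : ∀ t < n, s.mem aQueue t = q t
  dist_eq : ∀ t < n, s.mem aDist t = T.dist src (q t)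

theorem exists_runs_bfs (hT : T.IsTree) (hG : IsAdjLists T (s₀.mem aOff) (s₀.mem aNbr))
    (hsrc : s₀.reg rSrc = src) :
    ∃ s' t q, Runs bfs s₀ s' t ∧ BfsDone T src s₀ q s' ∧ t ≤ 1000 * n := by
  have hn : 0 < n := src.pos
  obtain ⟨t₀, hr₀, ht₀⟩ := Prog.LoopFree.runs
    (p := .seq (.store aQueue (.lit 0) (.var rSrc))
      (.seq (.store aUp (.lit 0) (.lit 0))
        (.seq (.store aDist (.lit 0) (.lit 0))
          (.seq (.assign rTail (.lit 1)) (.assign rI (.lit 0))))))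
    (by simp [Prog.LoopFree]) s₀
  have hinit : BfsState T src s₀ (fun _ => src) 0 1
      ((Prog.seq (.store aQueue (.lit 0) (.var rSrc))
      (.seq (.store aUp (.lit 0) (.lit 0))
        (.seq (.store aDist (.lit 0) (.lit 0))
          (.seq (.assign rTail (.lit 1)) (.assign rI (.lit 0)))))).exec s₀) := by
    refine ⟨?_, ?_, ?_, ?_, ?_, ⟨?_, rfl, ?_, ?_, ?_, ?_, ?_⟩, ?_, ?_, ?_, ?_⟩
    · intro x h1 h2 h3
      simp [Prog.exec, h1, h2]
    · simp [Prog.exec]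
    · simp [Prog.exec]
    · simp [Prog.exec, Expr.eval]
    · simp [Prog.exec, Expr.eval]
    · omega
    · simp [Prog.exec, Expr.eval]
    · intro a ha b hb _
      omega
    · intro t h1 h2
      omega
    · intro a b h1 h2
      obtain rfl : b = 0 := by omega
      obtain rfl : a = 0 := by omega
      exact le_rfl
    · intro t ht
      obtain rfl : t = 0 := by omega
      simp [Prog.exec, Expr.eval]
    · omega
    · intro t ht
      obtain rfl : t = 0 := by omega
      simp [Prog.exec, Expr.eval, hsrc]
    · intro t ht
      obtain rfl : t = 0 := by omega
      simp [Prog.exec, Expr.eval]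
    · intro j hj
      omega
  -- The queue cannot run empty early: if all queued vertices have been expanded, the queue is
  -- closed under adjacency and contains all n vertices by connectedness.
  have hlt : ∀ {s q i tail}, BfsState T src s₀ q i tail s → i < n → i < tail := by
    intro s q i tail h hi
    refine lt_of_le_of_ne h.le_tail ?_
    rintro rfl
    exact absurd (le_tail_of_surj (h.tree.surj_of_closed hT h.closed)) (not_le.2 hi)
  obtain ⟨s', t, hr, ⟨q, tail, h', -, ht⟩⟩ := exists_runs_loop
    (c := .lt (.var rI) (.var rTail))
    (p := .seq bfsExpand (.assign rI (.add (.var rI) (.lit 1)))) n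
    (fun i s t => ∃ q tail, BfsState T src s₀ q i tail s ∧
      -- No child of the vertex at position i has been queued yet. The term `100 * tail` is the
      -- potential used by the amortized bound.
      (∀ t, 0 < t → t < tail → s.mem aUp t < i) ∧ t ≤ 100 * tail + 300 * i)
    (by
      rintro i s t hi ⟨q, tail, h, hnone, ht⟩
      have hit := hlt h hi
      refine ⟨by simpa [Test.Holds, Expr.eval, h.reg_i, h.reg_tail] using hit, ?_⟩
      obtain ⟨s', t', q', tail', hr, h', hcl, ht'⟩ := h.exists_runs_expand hT hG hit hnone
      refine ⟨_, _, hr.seq (Runs.assign s' rI _), q', tail', ?_, ?_, ?_⟩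
      · simp only [Expr.eval, h'.reg_i]
        refine ⟨fun x h1 h2 h3 => by simp [h1, h'.reg_eq x h1 h2 h3], h'.off_eq, h'.nbr_eq,
          by simp, by simp [h'.reg_tail], h'.tree.next, ?_, h'.queue_eq, h'.dist_eq, ?_⟩
        · exact hlt h' hi
        · intro j hj w hw
          rcases Nat.lt_succ_iff_lt_or_eq.1 hj with hj | rfl
          · exact h'.closed j hj w hw
          · exact hcl w hw
      · intro t _ h2
        exact Nat.lt_succ_of_le (h'.tree.P_le t h2)
      · simp only [Expr.cost, Test.cost]
        omega)
    (by
      rintro s t ⟨q, tail, h, -, -⟩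
      have := h.tree.tail_le
      simp [Test.Holds, Expr.eval, h.reg_i, h.reg_tail, this])
    ⟨_, _, hinit, fun t h1 h2 => by omega, by omega⟩
  have htail : tail = n := le_antisymm h'.tree.tail_le h'.le_tail
  subst htail
  refine ⟨s', _, q, hr₀.seq hr, ⟨h'.reg_eq, h'.off_eq, h'.nbr_eq, h'.tree,
    h'.tree.surj_of_closed hT h'.closed, h'.queue_eq, h'.dist_eq⟩, ?_⟩
  simp only [Prog.bound, Expr.cost, Test.cost] at ht₀ ⊢
  omega

end Bfs

/-! ### The diameter, a good root and a legal input in linear time. -/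

section Preparation

variable {n k : ℕ} {T : SimpleGraph (Fin n)}

/-- Walk from the last vertex of the queue half the distance to the source and choose the vertex
that is reached as the new source. -/
def findMiddle : Prog :=
  .seq (.assign rJ (.sub (.var rN) (.lit 1)))
    (.seq (.forTo rI (.half (.var rDiam)) (.assign rJ (.get aUp (.var rJ))))
      (.assign rSrc (.get aQueue (.var rJ))))

/-- Store the parents, for the reversed order of the queue. -/
def storeParents : Prog :=
  .forTo rI (.var rN)
    (.store aPar (.var rI)
      (.sub (.sub (.var rN) (.lit 1)) (.get aUp (.sub (.sub (.var rN) (.lit 1)) (.var rI)))))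

/-- Make the last vertex of the queue the new source. -/
def sourceLast : Prog := .assign rSrc (.get aQueue (.sub (.var rN) (.lit 1)))

/-- Compute the diameter of the tree and a legal input from the adjacency lists. -/
def prepare : Prog :=
  .seq (.assign rSrc (.lit 0))
    (.seq bfs
      (.seq sourceLast
        (.seq bfs
          (.seq (.assign rDiam (.get aDist (.sub (.var rN) (.lit 1))))
            (.seq findMiddle
              (.seq bfs storeParents))))))

theorem BfsDone.setReg {src : Fin n} {s₀ s : State} {q : ℕ → Fin n}
    (h : BfsDone T src s₀ q s) (x m : ℕ) :
    BfsDone T src (s₀.setReg x m) q (s.setReg x m) :=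
  ⟨fun y h1 h2 h3 => by simp [h.reg_eq y h1 h2 h3], h.off_eq, h.nbr_eq, h.tree, h.surj,
    h.queue_eq, h.dist_eq⟩

theorem BfsDone.dist_le_last {src : Fin n} {s₀ s : State} {q : ℕ → Fin n}
    (h : BfsDone T src s₀ q s) (u : Fin n) : T.dist src u ≤ T.dist src (q (n - 1)) := by
  obtain ⟨t, ht, rfl⟩ := h.surj u
  exact h.tree.dist_mono (by omega) (by omega)

theorem BfsDone.exists_runs_findMiddle (hT : T.IsTree) {src : Fin n} {s₀ s : State}
    {q : ℕ → Fin n} (h : BfsDone T src s₀ q s) (hN : s.reg rN = n)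
    (hD : s.reg rDiam = T.dist src (q (n - 1))) :
    ∃ (s' : State) (t : ℕ) (r : Fin n), Runs findMiddle s s' t ∧ s'.reg rSrc = r ∧
      s'.mem aOff = s₀.mem aOff ∧ s'.mem aNbr = s₀.mem aNbr ∧
      (∀ x, x ≠ rI → x ≠ rJ → x ≠ rSrc → s'.reg x = s.reg x) ∧
      IsAnc T src r (q (n - 1)) ∧ T.dist r (q (n - 1)) = T.dist src (q (n - 1)) / 2 ∧
      t ≤ 100 * n := by
  have hn : 0 < n := src.pos
  set D := T.dist src (q (n - 1)) with hDdef
  have hDn : D / 2 + 1 ≤ n := by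
    have h1 : D < n := by
      obtain ⟨p, hp, hl⟩ := hT.1.exists_path_of_dist src (q (n - 1))
      have := hp.length_lt
      rw [hl, Fintype.card_fin] at this
      exact this
    omega
  obtain ⟨s', t, hr, ⟨-, j, hj, hrj, hanc, hd, hmem, hreg⟩, ht⟩ := exists_runs_forTo (x := rI)
    (e := .half (.var rDiam)) (p := .assign rJ (.get aUp (.var rJ))) trivial (D / 2)
    (fun i s' => s'.reg rI = i ∧ ∃ j < n, s'.reg rJ = j ∧ IsAnc T src (q j) (q (n - 1)) ∧
      T.dist (q j) (q (n - 1)) = i ∧ s'.mem = s.mem ∧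
      ∀ x, x ≠ rI → x ≠ rJ → s'.reg x = s.reg x)
    (by
      rintro i s' ⟨h1, j, -, -, -, -, -, h2⟩
      refine ⟨h1, ?_⟩
      rw [Expr.eval, Expr.eval, h2 rDiam (by decide) (by decide), hD])
    (by
      rintro i s' hi ⟨h1, j, hj, hrj, hanc, hd, hmem, hreg⟩
      refine ⟨by simp [Prog.exec, h1], s.mem aUp j, ?_⟩
      -- The walk cannot have reached the source, whose distance to the last vertex is D, after
      -- fewer than D / 2 steps.
      have hj0 : 0 < j := by
        rcases Nat.eq_zero_or_pos j with rfl | h0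
        · rw [h.tree.q_zero] at hd
          omega
        · exact h0
      obtain ⟨hlt, hadj, hdp⟩ := h.tree.par j hj0 hj
      have hanc' := (isAnc_of_adj hadj hdp).trans hT hanc
      refine ⟨hlt.trans hj, by simp [Prog.exec, Expr.eval, hrj, hmem], hanc', ?_,
        by simp [Prog.exec, hmem], ?_⟩
      · unfold IsAnc at hanc hanc'
        omega
      · intro x hx1 hx2
        simp [Prog.exec, hx1, hx2, hreg x hx1 hx2])
    (s := s.setReg rJ (n - 1))
    ⟨by simp, n - 1, by omega, by simp, isAnc_refl _ _, by simp, rfl, fun x h1 h2 => by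
      simp [h1, h2]⟩
  have hr₀ := Runs.assign s rJ (.sub (.var rN) (.lit 1))
  have he : (Expr.sub (.var rN) (.lit 1)).eval s = n - 1 := by rw [← hN]; rfl
  rw [he] at hr₀
  refine ⟨_, _, q j, hr₀.seq (hr.seq (Runs.assign s' rSrc (.get aQueue (.var rJ)))), ?_, ?_, ?_, ?_,
    hanc, hd, ?_⟩
  · simp [Expr.eval, hrj, hmem, h.queue_eq j hj]
  · rw [State.setReg_mem, hmem, h.off_eq]
  · rw [State.setReg_mem, hmem, h.nbr_eq]
  · intro x h1 h2 h3
    simp [h1, h2, h3, hreg x]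
  · have h1 := Nat.mul_le_mul_right (Prog.bound (.assign rJ (.get aUp (.var rJ))) +
      Expr.cost (.half (.var rDiam)) + 7) hDn
    simp only [Prog.bound, Expr.cost] at h1 ht ⊢
    omega

theorem BfsDone.exists_runs_storeParents {r : Fin n} {s₀ s : State}
    {q : ℕ → Fin n} (h : BfsDone T r s₀ q s) (hN : s.reg rN = n) (hK : s.reg rK = k) :
    ∃ (s' : State) (t : ℕ), Runs storeParents s s' t ∧ s'.reg rN = n ∧ s'.reg rK = k ∧
      s'.reg rDiam = s.reg rDiam ∧ t ≤ 100 * n ∧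
      (IsGoodRoot T k r → ∃ v : Fin n ≃ Fin n, HoldsRooted T k v s') := by
  have hn : 0 < n := r.pos
  obtain ⟨s', t, hr, ⟨-, h1, h2, h3, hup, hpar⟩, ht⟩ := exists_runs_forTo (x := rI)
    (e := .var rN) (p := .store aPar (.var rI)
      (.sub (.sub (.var rN) (.lit 1)) (.get aUp (.sub (.sub (.var rN) (.lit 1)) (.var rI)))))
    trivial n
    (fun i s' => s'.reg rI = i ∧ s'.reg rN = n ∧ s'.reg rK = k ∧ s'.reg rDiam = s.reg rDiam ∧
      s'.mem aUp = s.mem aUp ∧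
      ∀ j < i, s'.mem aPar j = n - 1 - s.mem aUp (n - 1 - j))
    (fun i s' h => ⟨h.1, h.2.1⟩) (by
      rintro i s' hi ⟨h0, h1, h2, h3, hup, hpar⟩
      refine ⟨by simp [Prog.exec, h0], by simp [Prog.exec, h1], by simp [Prog.exec, h2],
        by simp [Prog.exec, h3], by simp [Prog.exec, hup], fun j hj => ?_⟩
      rcases Nat.lt_succ_iff_lt_or_eq.1 hj with hj | rfl
      · simp [Prog.exec, Expr.eval, h0, hj.ne, hpar j hj]
      · simp [Prog.exec, Expr.eval, h0, h1, hup])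
    (s := s) ⟨by simp, by simp [hN], by simp [hK], by simp, by simp, by simp⟩
  refine ⟨s', t, hr, h1, h2, h3, ?_, fun hgood => ?_⟩
  · simp only [Prog.bound, Expr.cost] at ht
    omega
  -- The numbering is the reversed queue: the source comes last, and parents, which are queued
  -- before their children, get larger numbers.
  · have hbij : Function.Bijective fun i : Fin n => q (n - 1 - i) := by
      rw [Fintype.bijective_iff_injective_and_card]
      refine ⟨fun i j hij => ?_, rfl⟩
      have := h.tree.inj _ (by omega) _ (by omega) hij
      exact Fin.ext (by omega)
    refine ⟨Equiv.ofBijective _ hbij, h1, h2, ⟨n - 1, by omega⟩, by simp; omega, ?_, ?_⟩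
    · simpa [h.tree.q_zero] using hgood
    · intro i hi
      have hi' : (i : ℕ) ≠ n - 1 := fun h' => hi (Fin.ext h')
      obtain ⟨h4, h5, h6⟩ := h.tree.par (n - 1 - i) (by omega) (by omega)
      refine ⟨⟨n - 1 - s.mem aUp (n - 1 - i), by omega⟩, hpar i i.2, ?_, ?_, ?_⟩
      · rw [Fin.lt_def]
        simp only
        omega
      · have h7 : n - 1 - (n - 1 - s.mem aUp (n - 1 - i)) = s.mem aUp (n - 1 - i) := by omega
        simpa [h7] using h5
      · have h7 : n - 1 - (n - 1 - s.mem aUp (n - 1 - i)) = s.mem aUp (n - 1 - i) := by omega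
        have h8 : n - 1 - (n - 1) = 0 := by omega
        simp only [Equiv.ofBijective_apply, h7, h8, h.tree.q_zero]
        rw [T.dist_comm (v := r), T.dist_comm (v := r)]
        exact h6

theorem exists_runs_prepare (hT : T.IsTree) {s : State} (hs : HoldsGraph T k s) :
    ∃ (s' : State) (t : ℕ), Runs prepare s s' t ∧ t ≤ 4000 * n ∧
      s'.reg rN = n ∧ s'.reg rK = k ∧ s'.reg rDiam = T.diam ∧
      (k ≤ T.diam → ∃ v : Fin n ≃ Fin n, HoldsRooted T k v s') := by
  obtain ⟨hN, hK, -, hG⟩ := hs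
  have hn : 0 < n := by
    obtain ⟨x⟩ := hT.1.nonempty
    exact x.pos
  have hlast : ∀ (s s₀ : State) (src : Fin n) (q : ℕ → Fin n), BfsDone T src s₀ q s →
      s.reg rN = n → (Expr.get aQueue (.sub (.var rN) (.lit 1))).eval s = q (n - 1) := by
    intro s s₀ src q h h'
    have := h.queue_eq (n - 1) (by omega)
    simpa [Expr.eval, h'] using this
  have hr₀ := Runs.assign s rSrc (.lit 0)
  obtain ⟨s₁, t₁, q₁, hr₁, h₁, ht₁⟩ := exists_runs_bfs (s₀ := s.setReg rSrc 0)
    (src := ⟨0, hn⟩) hT hG (by simp)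
  have hN₁ : s₁.reg rN = n := by
    rw [h₁.reg_eq rN (by decide) (by decide) (by decide)]
    simpa using hN
  have hK₁ : s₁.reg rK = k := by
    rw [h₁.reg_eq rK (by decide) (by decide) (by decide)]
    simpa using hK
  have hr₂ := Runs.assign s₁ rSrc (.get aQueue (.sub (.var rN) (.lit 1)))
  rw [hlast s₁ _ _ _ h₁ hN₁] at hr₂
  set x := q₁ (n - 1) with hx
  have hG₁ : IsAdjLists T ((s₁.setReg rSrc x).mem aOff) ((s₁.setReg rSrc x).mem aNbr) := by
    rw [State.setReg_mem, h₁.off_eq, h₁.nbr_eq]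
    exact hG
  obtain ⟨s₃, t₃, q₃, hr₃, h₃, ht₃⟩ := exists_runs_bfs (s₀ := s₁.setReg rSrc x)
    (src := x) hT hG₁ (by simp)
  have hN₃ : s₃.reg rN = n := by
    rw [h₃.reg_eq rN (by decide) (by decide) (by decide)]
    simpa using hN₁
  have hK₃ : s₃.reg rK = k := by
    rw [h₃.reg_eq rK (by decide) (by decide) (by decide)]
    simpa using hK₁
  set y := q₃ (n - 1) with hy
  -- The last vertex of a queue is farthest from its source, so the first two searches are the two
  -- sweeps of `dist_le_of_double_sweep`.
  have hdiam : T.dist x y = T.diam := by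
    refine le_antisymm (dist_le_diam_of_isTree hT x y) ?_
    have hne := hT.1.nonempty
    obtain ⟨u, w, huw⟩ := T.exists_dist_eq_diam
    rw [← huw]
    exact dist_le_of_double_sweep hT h₁.dist_le_last h₃.dist_le_last u w
  have hr₄ := Runs.assign s₃ rDiam (.get aDist (.sub (.var rN) (.lit 1)))
  have he₄ : (Expr.get aDist (.sub (.var rN) (.lit 1))).eval s₃ = T.dist x y := by
    have := h₃.dist_eq (n - 1) (by omega)
    simpa [Expr.eval, hN₃] using this
  rw [he₄] at hr₄
  have h₄ := h₃.setReg rDiam (T.dist x y)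
  obtain ⟨s₅, t₅, r, hr₅, hsrc, hoff, hnbr, hreg, hanc, hd, ht₅⟩ := h₄.exists_runs_findMiddle hT
    (by simpa using hN₃) (by simp [hy])
  have hG₅ : IsAdjLists T (s₅.mem aOff) (s₅.mem aNbr) := by
    rw [hoff, hnbr]
    exact hG₁
  obtain ⟨s₆, t₆, q₆, hr₆, h₆, ht₆⟩ := exists_runs_bfs hT hG₅ hsrc
  have hreg₆ : ∀ z, z ≠ rI → z ≠ rJ → z ≠ rSrc → z ≠ rTail → z ≠ rPos →
      s₆.reg z = (s₃.setReg rDiam (T.dist x y)).reg z := by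
    intro z h1 h2 h3 h4 h5
    rw [h₆.reg_eq z h1 h4 h5, hreg z h1 h2 h3]
  have hN₆ : s₆.reg rN = n := by
    rw [hreg₆ rN (by decide) (by decide) (by decide) (by decide) (by decide)]
    simpa using hN₃
  have hK₆ : s₆.reg rK = k := by
    rw [hreg₆ rK (by decide) (by decide) (by decide) (by decide) (by decide)]
    simpa using hK₃
  have hD₆ : s₆.reg rDiam = T.diam := by
    rw [hreg₆ rDiam (by decide) (by decide) (by decide) (by decide) (by decide)]
    simpa using hdiam
  obtain ⟨s₇, t₇, hr₇, hN₇, hK₇, hD₇, ht₇, hgood⟩ := h₆.exists_runs_storeParents hN₆ hK₆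
  refine ⟨s₇, _, hr₀.seq (hr₁.seq (hr₂.seq (hr₃.seq (hr₄.seq (hr₅.seq (hr₆.seq hr₇)))))), ?_, hN₇,
    hK₇, hD₇.trans hD₆, fun hk => hgood (isGoodRoot_of_dist hT hdiam hanc ?_ ?_)⟩
  · simp only [Expr.cost]
    omega
  -- The root r divides the longest path into parts of lengths ⌈D/2⌉ and ⌊D/2⌋, and k ≤ D.
  · have hanc' : T.dist x r + T.dist r y = T.dist x y := hanc
    have hd' : T.dist r y = T.dist x y / 2 := hd
    omega
  · have hd' : T.dist r y = T.dist x y / 2 := hd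
    rw [T.dist_comm]
    omega

theorem exists_runs_solver (hT : T.IsTree) (hk : 1 ≤ k) {s : State} (hs : HoldsGraph T k s) :
    ∃ (s' : State) (t : ℕ), Runs (solver prepare) s s' t ∧ s'.reg rOut = cc T k ∧
      t ≤ 5000 * n := by
  have hn : 0 < n := by
    obtain ⟨x⟩ := hT.1.nonempty
    exact x.pos
  obtain ⟨s₁, t₁, hr₁, ht₁, hN, hK, hD, hv⟩ := exists_runs_prepare hT hs
  by_cases hd : T.diam < k
  · refine ⟨_, _, hr₁.seq (Runs.ite_true ?_ (Runs.assign s₁ rOut _)), ?_, ?_⟩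
    · simpa [Test.Holds, Expr.eval, hD, hK] using hd
    · rw [(cc_of_diam_lt hT hd).1]
      simp [Expr.eval, hN]
    · simp only [Test.cost, Expr.cost]
      omega
  · obtain ⟨v, hrooted⟩ := hv (not_lt.1 hd)
    have hlt : ¬ (Test.lt (.var rDiam) (.var rK)).Holds s₁ := by
      simpa [Test.Holds, Expr.eval, hD, hK] using hd
    have htest : (Test.eq (.add (.half (.var rK)) (.half (.var rK))) (.var rK)).Holds s₁ ↔
        Even k := by
      simp only [Test.Holds, Expr.eval, hK, Nat.even_iff]
      omega
    rcases Nat.even_or_odd k with he | ho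
    · obtain ⟨s₂, t₂, hr₂, hout, ht₂⟩ := hrooted.exists_runs_even hT (not_lt.1 hd) hk he
      refine ⟨s₂, _, hr₁.seq (Runs.ite_false hlt (Runs.ite_true (htest.2 he) hr₂)), hout, ?_⟩
      simp only [Test.cost, Expr.cost]
      omega
    · obtain ⟨s₂, t₂, hr₂, hout, ht₂⟩ := hrooted.exists_runs_odd hT (not_lt.1 hd) ho
      refine ⟨s₂, _, hr₁.seq (Runs.ite_false hlt (Runs.ite_false
        (fun h => Nat.not_even_iff_odd.2 ho (htest.1 h)) hr₂)), hout, ?_⟩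
      simp only [Test.cost, Expr.cost]
      omega

end Preparation

end ColorConn

open ColorConn in
theorem mainTheorem5 :
    ∃ (C : ℕ) (prep : Prog), ∀ (n k : ℕ) (T : SimpleGraph (Fin n)), T.IsTree → 1 ≤ k →
      -- on every legal input, the algorithm for the parity of `k` computes `cc_k(T)` in linear time
      (k ≤ T.diam → ∀ (v : Fin n ≃ Fin n) (s : State), HoldsRooted T k v s →
        (Odd k → ∃ (s' : State) (t : ℕ),
          Runs algOdd s s' t ∧ s'.reg rOut = cc T k ∧ t ≤ C * n) ∧
        (Even k → ∃ (s' : State) (t : ℕ),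
          Runs algEven s s' t ∧ s'.reg rOut = cc T k ∧ t ≤ C * n)) ∧
      -- trees of smaller diameter
      (T.diam < k → cc T k = n - 1) ∧
      -- from adjacency lists, `prep` finds the diameter and a legal input in linear time, and then
      -- `cc_k(T)` is returned in linear time
      (∀ s : State, HoldsGraph T k s →
        (∃ (s' : State) (t : ℕ), Runs prep s s' t ∧ t ≤ C * n ∧
          s'.reg rN = n ∧ s'.reg rK = k ∧ s'.reg rDiam = T.diam ∧
          (k ≤ T.diam → ∃ v : Fin n ≃ Fin n, HoldsRooted T k v s')) ∧
        (∃ (s' : State) (t : ℕ),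
          Runs (solver prep) s s' t ∧ s'.reg rOut = cc T k ∧ t ≤ C * n)) ∧
      -- there is an extremal coloring of the following form
      (∃ f : Sym2 (Fin n) → ℕ, IsExtremal T k f ∧
        (∀ c ∈ f '' T.edgeSet, (colorForest T f c).coe.IsTree) ∧
        (∀ c c' : ℕ, Nontriv T f c → Nontriv T f c' →
          ((colorForest T f c).verts ∩ (colorForest T f c').verts).Nonempty) ∧
        (∀ (c : ℕ) (u : Fin n), Nontriv T f c → (T.neighborSet u).ncard = 1 →
          ∃ w ∈ (colorForest T f c).verts, colorDist T f u w ≤ k / 2)) := by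
  refine ⟨5000, prepare, fun n k T hT hk => ⟨fun hd v s hs => ⟨fun ho => ?_, fun he => ?_⟩,
    fun hd => ?_, fun s hs => ⟨?_, exists_runs_solver hT hk hs⟩, ?_⟩⟩
  · obtain ⟨s', t, hr, hout, ht⟩ := hs.exists_runs_odd hT hd ho
    exact ⟨s', t, hr, hout, by omega⟩
  · obtain ⟨s', t, hr, hout, ht⟩ := hs.exists_runs_even hT hd hk he
    exact ⟨s', t, hr, hout, by omega⟩
  · rw [(cc_of_diam_lt hT hd).1, Fintype.card_fin]
  · obtain ⟨s', t, hr, ht, h⟩ := exists_runs_prepare hT hs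
    exact ⟨s', t, hr, by omega, h⟩
  · obtain ⟨f, hf, htree⟩ := exists_extremal hT hk
    exact ⟨f, hf, htree.isTree, htree.meet, htree.near⟩
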